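/- **Conventions.** Let $\mathrm{Mp}=\mathrm{Mp}_2(\mathbb Z)$ be the group of pairs $(A,w)$ with $A=\begin{pmatrix}a&b\\c&d\end{pmatrix}\in \mathrm{SL}_2(\mathbb Z)$ and $w$ holomorphic on the upper half plane $\mathbb H$ with $w(\tau)^2=c\tau+d$, with $(A,w)(B,v)=(AB,\,w(B\tau)v(\tau))$. Let $e(x)=e^{2\pi i x}$. Let $F$ be a symmetric positive definite half-integral $n\times n$ matrix ($2F$ is integral with even diagonal), $F[x]=x^tFx$, and let $D_F=\mathbb Z^n/2F\mathbb Z^n$ with the quadratic form $Q(x)=\frac14F^{-1}[x] \bmod \mathbb Z$ and $B(x,y)=Q(x+y)-Q(x)-Q(y)$. Let $k\in\frac12\mathbb Z$. For functions on $\mathbb H\times\mathbb C^n$ put $$\phi|_{k,F}(A,w)(\tau,z)=\phi\Big(A\tau,\tfrac{z}{c\tau+d}\Big)\,w(\tau)^{-2k}\,e\Big(\tfrac{-cF[z]}{c\tau+d}\Big),\qquad \phi|_{k,F}[\lambda,\mu](\tau,z)=\phi(\tau,z+\lambda\tau+\mu)\,e(\tau F[\lambda]+2z^tF\lambda),$$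 and for functions on $\mathbb H$ put $h|_k(A,w)(\tau)=h(A\tau)w(\tau)^{-2k}$. For a subgroup $\Gamma\subset\mathrm{Mp}$ of finite index and a finite dimensional complex $\Gamma$-module $V$, $J_{k,F}(\Gamma,V)$ is the space of holomorphic $\phi:\mathbb H\times\mathbb C^n\to V$ with $\phi|_{k,F}g=g\phi$ for $g\in\Gamma$, $\phi|_{k,F}[\lambda,\mu]=\phi$ for $\lambda,\mu\in\mathbb Z^n$, and such that for every $\alpha\in\mathrm{Mp}$ the function $\phi|_{k,F}\alpha$ has a Fourier expansion $\sum c(l,r)\,e(l\tau)\,e(z^tr)$ over $l\in\mathbb Q$, $r\in\mathbb Z^n$ with $4l-F^{-1}[r]\ge0$. $M_k$ is the space of holomorphic functions on $\mathbb H$ which are invariant under $|_k$ of some finite index subgroup of $\mathrm{Mp}$ and for which $h|_k\alpha$ is bounded at $i\infty$ for every $\alpha\in\mathrm{Mp}$; it is a right $\mathrm{Mp}$-module under $|_k$. $W(F)$ is the left $\mathrm{Mp}$-module with underlying space $\mathbb C[D_F]$ (basis $\mathfrak e_x$, $x\in D_F$) such that, with $T=\begin{pmatrix}1&1\\0&1\end{pmatrix}$,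 $S=\begin{pmatrix}0&-1\\1&0\end{pmatrix}$ and $\sqrt\tau$ in the right half plane, $$(T,1)\mathfrak e_x=e(Q(x))\mathfrak e_x,\qquad (S,\sqrt\tau)\,\mathfrak e_x=\sigma|D_F|^{-1/2}\sum_{y\in D_F} e(-B(y,x))\,\mathfrak e_y,\qquad \sigma=|D_F|^{-1/2}\sum_{x\in D_F} e(-Q(x)).$$ $W(F)^*$ is the dual space with the right action $(\lambda g)(v)=\lambda(gv)$. Let $\vartheta_{F,x}(\tau,z)=\sum_{r\in\mathbb Z^n,\,r\equiv x \bmod 2F\mathbb Z^n}e(\tau\frac14F^{-1}[r]+r^tz)$, let $\Theta(F)$ be the span of the $\vartheta_{F,x}$, and $\theta_\lambda=\sum_{x\in D_F}\lambda(\mathfrak e_x)\vartheta_{F,x}$ for $\lambda\in W(F)^*$. **Theorem.** Let $\Gamma$ be a subgroup of finite index of $\mathrm{Mp}$. 1. The module $W(F)$ exists and is unique. 2. The map $\lambda\mapsto\theta_\lambda$ is an isomorphism of right $\mathrm{Mp}$-modules from $W(F)^*$ onto $\Theta(F)$ with the action $|_{\frac n2,F}$. 3. For every finite dimensional complex $\Gamma$-module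 $V$ such that the image of $\Gamma$ in $\mathrm{GL}(V)$ is finite, there is an isomorphism of complex vector spaces, natural in $V$, $$\Psi_V:\ J_{k,F}(\Gamma,V)\ \xrightarrow{\ \sim\ }\ \big(M_{k-\frac n2}\otimes W(F)^*\big)\otimes_{\mathbb C[\mathrm{Mp}]}\mathrm{Ind}_\Gamma^{\mathrm{Mp}}V,\qquad \mathrm{Ind}_\Gamma^{\mathrm{Mp}}V=\mathbb C[\mathrm{Mp}]\otimes_{\mathbb C[\Gamma]}V .$$ It is given by the theta decomposition: for every $\phi\in J_{k,F}(\Gamma,V)$ there is a unique element $\sum_i (h_i\otimes\lambda_i)\otimes v_i$ of $(M_{k-\frac n2}\otimes W(F)^*)\otimes V$ with $\phi(\tau,z)=\sum_i h_i(\tau)\,\theta_{\lambda_i}(\tau,z)\,v_i$, and $\Psi_V(\phi)$ is the class of $\sum_i (h_i\otimes\lambda_i)\otimes(1\otimes v_i)$. -/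

import Mathlib

open UpperHalfPlane
open scoped Manifold MatrixGroups TensorProduct

noncomputable section

namespace JacobiTheta

/-! ### The metaplectic group -/

/-- The automorphy factor `cτ + d` of `A = [a, b; c, d] ∈ SL₂(ℤ)`. -/
def autFactor (A : SL(2, ℤ)) (τ : ℍ) : ℂ := (A 1 0 : ℂ) * τ + (A 1 1 : ℂ)

theorem autFactor_ne_zero (A : SL(2, ℤ)) (τ : ℍ) : autFactor A τ ≠ 0 := by
  have := denom_ne_zero (A : GL (Fin 2) ℝ) τ
  rwa [ModularGroup.denom_apply] at this

theorem autFactor_one (τ : ℍ) : autFactor 1 τ = 1 := by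
  simp [autFactor]

theorem autFactor_mul (A B : SL(2, ℤ)) (τ : ℍ) :
    autFactor (A * B) τ = autFactor A (B • τ) * autFactor B τ := by
  have h := autFactor_ne_zero B τ
  unfold autFactor at h ⊢
  rw [coe_specialLinearGroup_apply]
  simp only [Matrix.SpecialLinearGroup.coe_mul, Matrix.mul_apply, Fin.sum_univ_two]
  simp only [algebraMap_int_eq, eq_intCast, Complex.ofReal_intCast] at *
  rw [add_mul, mul_assoc (A 1 0 : ℂ), div_mul_cancel₀ _ h]
  push_cast
  ring

theorem mdifferentiable_SL_smul (A : SL(2, ℤ)) :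
    MDifferentiable 𝓘(ℂ) 𝓘(ℂ) (fun τ : ℍ => A • τ) :=
  UpperHalfPlane.mdifferentiable_smul (g := (A : GL (Fin 2) ℝ)) (by simp)

/-- Integral powers of nowhere vanishing holomorphic functions are holomorphic. -/
theorem mdifferentiable_zpow {f : ℍ → ℂ} (hf : MDifferentiable 𝓘(ℂ) 𝓘(ℂ) f)
    (h0 : ∀ τ, f τ ≠ 0) (m : ℤ) : MDifferentiable 𝓘(ℂ) 𝓘(ℂ) (fun τ => f τ ^ m) := by
  rw [UpperHalfPlane.mdifferentiable_iff] at hf ⊢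
  intro z hz
  exact (hf z hz).zpow (Or.inl (h0 _))

/-- `Mp₂(ℤ)`: pairs `(A, w)` with `A ∈ SL₂(ℤ)` and `w` a holomorphic function on the upper half
plane such that `w(τ)² = cτ + d`. -/
@[ext]
structure Mp where
  /-- the matrix `A` -/
  mat : SL(2, ℤ)
  /-- the chosen holomorphic square root of `cτ + d` -/
  w : ℍ → ℂ
  holo : MDifferentiable 𝓘(ℂ) 𝓘(ℂ) w
  sq : ∀ τ, w τ ^ 2 = autFactor mat τ

namespace Mp

theorem w_ne_zero (g : Mp) (τ : ℍ) : g.w τ ≠ 0 := by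
  intro h
  have h1 := g.sq τ
  rw [h] at h1
  exact autFactor_ne_zero g.mat τ (by rw [← h1]; simp)

/-- The composition law `(A, w)(B, v) = (AB, w(Bτ) v(τ))`. -/
instance : Mul Mp where
  mul g h :=
    { mat := g.mat * h.mat
      w := fun τ => g.w (h.mat • τ) * h.w τ
      holo := (g.holo.comp (mdifferentiable_SL_smul h.mat)).mul h.holo
      sq := fun τ => by rw [mul_pow, g.sq, h.sq, autFactor_mul] }

instance : One Mp where
  one :=
    { mat := 1
      w := fun _ => 1
      holo := mdifferentiable_const
      sq := fun τ => by rw [autFactor_one, one_pow] }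

instance : Inv Mp where
  inv g :=
    { mat := g.mat⁻¹
      w := fun τ => g.w (g.mat⁻¹ • τ) ^ (-1 : ℤ)
      holo := mdifferentiable_zpow (g.holo.comp (mdifferentiable_SL_smul g.mat⁻¹))
        (fun _ => g.w_ne_zero _) _
      sq := fun τ => by
        have h : autFactor g.mat (g.mat⁻¹ • τ) * autFactor g.mat⁻¹ τ = 1 := by
          rw [← autFactor_mul, mul_inv_cancel, autFactor_one]
        rw [zpow_neg_one, inv_pow, g.sq]
        exact inv_eq_of_mul_eq_one_right h }

@[simp] theorem mul_mat (g h : Mp) : (g * h).mat = g.mat * h.mat := rfl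
@[simp] theorem mul_w (g h : Mp) (τ : ℍ) : (g * h).w τ = g.w (h.mat • τ) * h.w τ := rfl
@[simp] theorem one_mat : (1 : Mp).mat = 1 := rfl
@[simp] theorem one_w (τ : ℍ) : (1 : Mp).w τ = 1 := rfl
@[simp] theorem inv_mat (g : Mp) : g⁻¹.mat = g.mat⁻¹ := rfl
@[simp] theorem inv_w (g : Mp) (τ : ℍ) : g⁻¹.w τ = g.w (g.mat⁻¹ • τ) ^ (-1 : ℤ) := rfl

theorem ext' {g h : Mp} (h1 : g.mat = h.mat) (h2 : ∀ τ, g.w τ = h.w τ) : g = h :=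
  Mp.ext h1 (funext h2)

instance : Group Mp :=
  Group.ofLeftAxioms
    (fun a b c => ext' (by simp [mul_assoc]) (fun τ => by simp [mul_assoc, mul_smul]))
    (fun a => ext' (by simp) (fun τ => by simp))
    (fun a => ext' (by simp) (fun τ => by simp [a.w_ne_zero]))

/-- The element `(T, 1)` with `T = [1, 1; 0, 1]`. -/
def T : Mp where
  mat := ModularGroup.T
  w := fun _ => 1
  holo := mdifferentiable_const
  sq := fun τ => by simp [autFactor, ModularGroup.T]

/-- The element `(S, √τ)` with `S = [0, -1; 1, 0]` and `√τ` in the right half plane. -/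
def S : Mp where
  mat := ModularGroup.S
  w := fun τ => (τ : ℂ) ^ (1 / 2 : ℂ)
  holo := by
    rw [UpperHalfPlane.mdifferentiable_iff]
    have h : DifferentiableOn ℂ (fun z : ℂ => z ^ (1 / 2 : ℂ)) {z | 0 < z.im} := fun z hz =>
      (differentiableAt_id.cpow_const (Or.inr (ne_of_gt hz))).differentiableWithinAt
    refine h.congr fun z hz => ?_
    simp [ofComplex_apply_of_im_pos hz]
  sq := fun τ => by
    rw [← Complex.cpow_nat_mul]
    simp [autFactor, ModularGroup.S]

end Mp

/-! ### Scalar modular forms -/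

/-- The operator `h ↦ h|_{κ/2} (A, w)`, i.e. `h(Aτ) w(τ)^{-κ}`; `κ` is twice the weight. -/
def slash (κ : ℤ) (g : Mp) : (ℍ → ℂ) →ₗ[ℂ] (ℍ → ℂ) where
  toFun h := fun τ => h (g.mat • τ) * g.w τ ^ (-κ)
  map_add' _ _ := by ext; simp [add_mul]
  map_smul' _ _ := by ext; simp [mul_assoc]

theorem slash_apply (κ : ℤ) (g : Mp) (h : ℍ → ℂ) (τ : ℍ) :
    slash κ g h τ = h (g.mat • τ) * g.w τ ^ (-κ) := rfl

theorem slash_one (κ : ℤ) (h : ℍ → ℂ) : slash κ 1 h = h := by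
  ext τ; simp [slash_apply]

theorem slash_mul (κ : ℤ) (g g' : Mp) (h : ℍ → ℂ) :
    slash κ (g * g') h = slash κ g' (slash κ g h) := by
  ext τ; simp only [slash_apply, Mp.mul_mat, Mp.mul_w, mul_smul, mul_zpow]; ring

/-- The space `M_{κ/2}` of all modular forms of weight `κ/2` on some subgroup of finite index of
`Mp₂(ℤ)`. -/
def modularForms (κ : ℤ) : Submodule ℂ (ℍ → ℂ) where
  carrier := {h | MDifferentiable 𝓘(ℂ) 𝓘(ℂ) h ∧
    (∃ Δ : Subgroup Mp, Δ.FiniteIndex ∧ ∀ g ∈ Δ, slash κ g h = h) ∧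
    ∀ g : Mp, IsBoundedAtImInfty (slash κ g h)}
  zero_mem' := by
    refine ⟨mdifferentiable_const, ⟨⊤, inferInstance, fun g _ => map_zero _⟩, fun g => ?_⟩
    rw [map_zero]
    exact zero_form_isBoundedAtImInfty
  add_mem' := by
    rintro a b ⟨ha, ⟨Δ, hΔ, hΔa⟩, hac⟩ ⟨hb, ⟨Δ', hΔ', hΔb⟩, hbc⟩
    refine ⟨ha.add hb, ⟨Δ ⊓ Δ', inferInstance, fun g hg => ?_⟩, fun g => ?_⟩
    · rw [map_add, hΔa g hg.1, hΔb g hg.2]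
    · rw [map_add]
      exact (hac g).add (hbc g)
  smul_mem' := by
    rintro c a ⟨ha, ⟨Δ, hΔ, hΔa⟩, hac⟩
    refine ⟨ha.const_smul c, ⟨Δ, hΔ, fun g hg => ?_⟩, fun g => ?_⟩
    · rw [map_smul, hΔa g hg]
    · rw [map_smul]
      exact (hac g).smul c

theorem slash_mem_modularForms {κ : ℤ} {h : ℍ → ℂ} (hh : h ∈ modularForms κ) (g : Mp) :
    slash κ g h ∈ modularForms κ := by
  obtain ⟨hh, ⟨Δ, hΔ, hΔh⟩, hc⟩ := hh
  refine ⟨?_, ⟨Δ.comap (MulAut.conj g).toMonoidHom, ⟨?_⟩, fun x hx => ?_⟩, fun x => ?_⟩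
  · exact (hh.comp (mdifferentiable_SL_smul g.mat)).mul
      (mdifferentiable_zpow g.holo g.w_ne_zero _)
  · rw [Subgroup.index_comap_of_surjective _ (MulAut.conj g).surjective]
    exact hΔ.index_ne_zero
  · have hx' : g * x * g⁻¹ ∈ Δ := hx
    rw [← slash_mul, show g * x = (g * x * g⁻¹) * g by group, slash_mul, hΔh _ hx']
  · rw [← slash_mul]
    exact hc _

/-! ### Representations and tensor products over a group algebra

A right `ℂ[G]`-module is a representation of the opposite group `Gᵐᵒᵖ`. -/

/-- `M_{κ/2}` as a right `Mp₂(ℤ)`-module under the slash action. -/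
def modularFormsRep (κ : ℤ) : Representation ℂ Mpᵐᵒᵖ (modularForms κ) where
  toFun g := (slash κ g.unop).restrict fun _ hh => slash_mem_modularForms hh g.unop
  map_one' := by
    ext h : 2
    exact slash_one κ h
  map_mul' a b := by
    ext h : 2
    exact slash_mul κ b.unop a.unop h

/-- The right `G`-module `V^*` attached to a left `G`-module `V`: `(λ·g)(v) = λ(g v)`. -/
def rightDual {G V : Type*} [Group G] [AddCommGroup V] [Module ℂ V]
    (ρ : Representation ℂ G V) : Representation ℂ Gᵐᵒᵖ (Module.Dual ℂ V) where
  toFun g := (ρ g.unop).dualMap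
  map_one' := by ext; simp
  map_mul' a b := by ext; simp

/-- The relations `ag ⊗ b = a ⊗ gb` defining `A ⊗_{ℂ[G]} B`. -/
def balancedRelations {G A B : Type*} [Group G] [AddCommGroup A] [Module ℂ A]
    [AddCommGroup B] [Module ℂ B] (α : Representation ℂ Gᵐᵒᵖ A) (β : Representation ℂ G B) :
    Submodule ℂ (A ⊗[ℂ] B) :=
  Submodule.span ℂ {t | ∃ (g : G) (a : A) (b : B),
    t = α (MulOpposite.op g) a ⊗ₜ[ℂ] b - a ⊗ₜ[ℂ] β g b}

/-- The tensor product `A ⊗_{ℂ[G]} B` of a right and a left `G`-module. -/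
def BalancedTensor {G A B : Type*} [Group G] [AddCommGroup A] [Module ℂ A]
    [AddCommGroup B] [Module ℂ B] (α : Representation ℂ Gᵐᵒᵖ A) (β : Representation ℂ G B) :
    Type _ :=
  (A ⊗[ℂ] B) ⧸ balancedRelations α β

instance {G A B : Type*} [Group G] [AddCommGroup A] [Module ℂ A]
    [AddCommGroup B] [Module ℂ B] (α : Representation ℂ Gᵐᵒᵖ A) (β : Representation ℂ G B) :
    AddCommGroup (BalancedTensor α β) :=
  inferInstanceAs (AddCommGroup ((A ⊗[ℂ] B) ⧸ balancedRelations α β))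

instance {G A B : Type*} [Group G] [AddCommGroup A] [Module ℂ A]
    [AddCommGroup B] [Module ℂ B] (α : Representation ℂ Gᵐᵒᵖ A) (β : Representation ℂ G B) :
    Module ℂ (BalancedTensor α β) :=
  inferInstanceAs (Module ℂ ((A ⊗[ℂ] B) ⧸ balancedRelations α β))

/-- The canonical map `A ⊗_ℂ B → A ⊗_{ℂ[G]} B`. -/
def BalancedTensor.mk {G A B : Type*} [Group G] [AddCommGroup A] [Module ℂ A]
    [AddCommGroup B] [Module ℂ B] (α : Representation ℂ Gᵐᵒᵖ A) (β : Representation ℂ G B) :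
    A ⊗[ℂ] B →ₗ[ℂ] BalancedTensor α β :=
  (balancedRelations α β).mkQ

/-- `id ⊗ f : A ⊗_{ℂ[G]} B → A ⊗_{ℂ[G]} B'` for a `G`-linear map `f : B → B'`. -/
def BalancedTensor.map {G A B B' : Type*} [Group G] [AddCommGroup A] [Module ℂ A]
    [AddCommGroup B] [Module ℂ B] [AddCommGroup B'] [Module ℂ B']
    (α : Representation ℂ Gᵐᵒᵖ A) {β : Representation ℂ G B} {β' : Representation ℂ G B'}
    (f : β.IntertwiningMap β') : BalancedTensor α β →ₗ[ℂ] BalancedTensor α β' :=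
  Submodule.mapQ _ _ (f.toLinearMap.lTensor A) <| by
    refine Submodule.span_le.2 ?_
    rintro _ ⟨g, a, b, rfl⟩
    refine Submodule.subset_span ⟨g, a, f b, ?_⟩
    simp [f.isIntertwining]

/-- The map `Ind_Γ^G V → Ind_Γ^G V'` induced by a `Γ`-linear map `V → V'`. -/
def indMap {G V V' : Type*} [Group G] {Γ : Subgroup G} [AddCommGroup V] [Module ℂ V]
    [AddCommGroup V'] [Module ℂ V'] {ρ : Representation ℂ Γ V} {ρ' : Representation ℂ Γ V'}
    (f : ρ.IntertwiningMap ρ') :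
    (Representation.ind Γ.subtype ρ).IntertwiningMap (Representation.ind Γ.subtype ρ') :=
  ⟨Representation.Coinvariants.map _ _ ⟨f.toLinearMap.lTensor _, by
    intro g
    ext
    simp [f.isIntertwining]⟩,
    fun g => by ext; simp⟩

/-! ### Half-integral matrices, discriminant modules and Weil representations -/

/-- `F[x] = xᵗ F x`. -/
def quadVal {n : ℕ} {R : Type*} [CommSemiring R] (F : Matrix (Fin n) (Fin n) R) (x : Fin n → R) :
    R :=
  x ⬝ᵥ (F.mulVec x)

/-- A symmetric positive definite half-integral `n × n` matrix `F`, given by the matrix `2F`,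
which has integral entries and even diagonal. -/
structure HalfIntegralForm (n : ℕ) where
  /-- the matrix `2F` -/
  double : Matrix (Fin n) (Fin n) ℤ
  symm : double.IsSymm
  even_diag : ∀ i, Even (double i i)
  posDef : (double.map (Int.cast : ℤ → ℝ)).PosDef

/-- `∑ i, ∑ j, y i * G i j * y j` is even for `G` symmetric with even diagonal. -/
theorem even_quadVal {n : ℕ} (G : Matrix (Fin n) (Fin n) ℤ) (hs : G.IsSymm)
    (hd : ∀ i, Even (G i i)) (y : Fin n → ℤ) : Even (quadVal G y) := by
  rw [← ZMod.intCast_eq_zero_iff_even]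
  have h1 : ((quadVal G y : ℤ) : ZMod 2) =
      ∑ p : Fin n × Fin n, ((y p.1 * (G p.1 p.2 * y p.2) : ℤ) : ZMod 2) := by
    rw [Fintype.sum_prod_type]
    simp [quadVal, dotProduct, Matrix.mulVec, Finset.mul_sum]
  rw [h1]
  refine Finset.sum_involution (fun p _ => p.swap) ?_ ?_ (by simp) (by simp)
  · rintro ⟨i, j⟩ _
    rw [← Int.cast_add, ZMod.intCast_eq_zero_iff_even]
    simp only [Prod.swap_prod_mk]
    rw [hs.apply i j]
    exact ⟨y i * (G i j * y j), by ring⟩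
  · rintro ⟨i, j⟩ _ hne hsw
    obtain rfl : j = i := congrArg Prod.fst hsw
    refine hne ?_
    rw [ZMod.intCast_eq_zero_iff_even]
    exact ((hd j).mul_right _).mul_left _

namespace HalfIntegralForm

variable {n : ℕ} (F : HalfIntegralForm n)

/-- The matrix `F` itself. -/
def toMatrix : Matrix (Fin n) (Fin n) ℝ := (1 / 2 : ℝ) • F.double.map (Int.cast : ℤ → ℝ)

/-- `F` as a complex matrix. -/
def toMatrixC : Matrix (Fin n) (Fin n) ℂ := F.toMatrix.map Complex.ofReal

/-- The group `D_F = ℤⁿ / 2Fℤⁿ`. -/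
abbrev Disc : Type := (Fin n → ℤ) ⧸ LinearMap.range F.double.mulVecLin

theorem double_det_ne_zero : F.double.det ≠ 0 := by
  have h := F.posDef.det_pos.ne'
  intro h0
  apply h
  have := (Int.castRingHom ℝ).map_det F.double
  rw [h0] at this
  simpa using this.symm

instance : Finite F.Disc := by
  refine Submodule.finiteQuotientOfFreeOfRankEq _ (LinearMap.finrank_range_of_inj ?_)
  exact Matrix.mulVec_injective_of_det_ne_zero F.double_det_ne_zero

instance : Fintype F.Disc := Fintype.ofFinite _

/-- The matrix `2F` with real entries. -/
def doubleR : Matrix (Fin n) (Fin n) ℝ := F.double.map (Int.cast : ℤ → ℝ)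

theorem isUnit_det : IsUnit F.toMatrix.det := by
  rw [toMatrix, Matrix.det_smul]
  exact (mul_ne_zero (by positivity) F.posDef.det_pos.ne').isUnit

theorem doubleR_eq : F.doubleR = (2 : ℝ) • F.toMatrix := by
  rw [toMatrix, smul_smul, doubleR]; norm_num

theorem inv_mulVec (y : Fin n → ℝ) :
    F.toMatrix⁻¹.mulVec (F.doubleR.mulVec y) = (2 : ℝ) • y := by
  rw [doubleR_eq, Matrix.mulVec_mulVec, Matrix.mul_smul, Matrix.nonsing_inv_mul _ F.isUnit_det,
    Matrix.smul_mulVec, Matrix.one_mulVec]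

theorem mulVec_inv (y : Fin n → ℝ) :
    F.doubleR.mulVec (F.toMatrix⁻¹.mulVec y) = (2 : ℝ) • y := by
  rw [doubleR_eq, Matrix.mulVec_mulVec, Matrix.smul_mul, Matrix.mul_nonsing_inv _ F.isUnit_det,
    Matrix.smul_mulVec, Matrix.one_mulVec]

theorem mulVec_dot (x y : Fin n → ℝ) : F.doubleR.mulVec x ⬝ᵥ y = x ⬝ᵥ F.doubleR.mulVec y := by
  have h : F.doubleR.transpose = F.doubleR := by
    rw [doubleR, ← Matrix.transpose_map, F.symm]
  rw [Matrix.dotProduct_mulVec, ← Matrix.mulVec_transpose, h]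

theorem quadVal_inv_add (r u : Fin n → ℝ) :
    quadVal F.toMatrix⁻¹ (r + F.doubleR.mulVec u) =
      quadVal F.toMatrix⁻¹ r + 4 * (r ⬝ᵥ u) + 2 * quadVal F.doubleR u := by
  simp only [quadVal, Matrix.mulVec_add, inv_mulVec, dotProduct_add, add_dotProduct, mulVec_dot,
    mulVec_inv, dotProduct_smul, smul_eq_mul, dotProduct_comm u r]
  ring

/-- The quadratic form `x ↦ ¼ F⁻¹[x] mod ℤ` on `D_F`. -/
def discForm : F.Disc → UnitAddCircle :=
  Quotient.lift (s := Submodule.quotientRel _)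
    (fun x : Fin n → ℤ =>
      ((1 / 4 * quadVal F.toMatrix⁻¹ (fun i => (x i : ℝ)) : ℝ) : UnitAddCircle)) <| by
    intro a b hab
    obtain ⟨y, hy⟩ := (Submodule.quotientRel_def _).1 hab
    obtain ⟨m, hm⟩ := even_quadVal F.double F.symm F.even_diag y
    have ha : (fun i => (a i : ℝ)) =
        (fun i => (b i : ℝ)) + F.doubleR.mulVec (fun i => (y i : ℝ)) := by
      ext i
      have h := congrFun hy i
      simp only [Matrix.mulVecLin_apply, Matrix.mulVec, dotProduct, Pi.sub_apply] at h
      rw [eq_sub_iff_add_eq'] at h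
      rw [← h]
      simp [doubleR, Matrix.mulVec, dotProduct]
    have h1 : (fun i => (b i : ℝ)) ⬝ᵥ (fun i => (y i : ℝ)) = ((b ⬝ᵥ y : ℤ) : ℝ) := by
      simp [dotProduct]
    have h2 : quadVal F.doubleR (fun i => (y i : ℝ)) = ((m + m : ℤ) : ℝ) := by
      rw [← hm]
      simp [quadVal, doubleR, Matrix.mulVec, dotProduct]
    change ((1 / 4 * quadVal F.toMatrix⁻¹ (fun i => (a i : ℝ)) : ℝ) : UnitAddCircle) =
      ((1 / 4 * quadVal F.toMatrix⁻¹ (fun i => (b i : ℝ)) : ℝ) : UnitAddCircle)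
    rw [ha, quadVal_inv_add, h1, h2, ← sub_eq_zero, ← AddCircle.coe_sub, AddCircle.coe_eq_zero_iff]
    refine ⟨b ⬝ᵥ y + m, ?_⟩
    push_cast
    rw [zsmul_eq_mul]
    push_cast
    ring

end HalfIntegralForm

/-- The bilinear form `B(x, y) = Q(x + y) - Q(x) - Q(y)` of a quadratic form `Q`. -/
def bilin {M : Type*} [AddCommGroup M] (Q : M → UnitAddCircle) (x y : M) : UnitAddCircle :=
  Q (x + y) - Q x - Q y

/-- `e(t) = exp(2πit)` for `t ∈ ℝ/ℤ`. -/
def eCircle (t : UnitAddCircle) : ℂ := (AddCircle.toCircle t : ℂ)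

/-- `σ(M) = |M|^{-1/2} ∑ₓ e(-Q(x))`. -/
def gaussSum {M : Type*} [Fintype M] (Q : M → UnitAddCircle) : ℂ :=
  ((Real.sqrt (Fintype.card M) : ℝ) : ℂ)⁻¹ * ∑ x, eCircle (-Q x)

/-- The action of `Mp₂(ℤ)` on `ℂ[M]` given by `W` is the Weil representation of the finite quadratic
module `(M, Q)`: on the basis vectors `x ∈ M`, the elements `(T, 1)` and `(S, √τ)` act by
`x ↦ e(Q(x)) x` and `x ↦ σ |M|^{-1/2} ∑_y e(-B(y, x)) y`. -/
structure IsWeilRep {M : Type*} [AddCommGroup M] [Fintype M] (Q : M → UnitAddCircle)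
    (W : Representation ℂ Mp (M →₀ ℂ)) : Prop where
  T_apply : ∀ x, W Mp.T (Finsupp.single x 1) = eCircle (Q x) • Finsupp.single x 1
  S_apply : ∀ x, W Mp.S (Finsupp.single x 1) =
    (gaussSum Q * ((Real.sqrt (Fintype.card M) : ℝ) : ℂ)⁻¹) •
      ∑ y, eCircle (-bilin Q y x) • Finsupp.single y 1

open Classical in
/-- The Weil representation `W(F)` on `ℂ[D_F]`: the action of `Mp₂(ℤ)` that extends the action of
`(T, 1)` and `(S, √τ)`. (Existence and uniqueness of this extension are not presupposed: the value
is the trivial action if there is no extension.) -/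
def weilRep {n : ℕ} (F : HalfIntegralForm n) : Representation ℂ Mp (F.Disc →₀ ℂ) :=
  if h : ∃ W, IsWeilRep F.discForm W then h.choose else 1

/-! ### Jacobi forms -/

/-- `e(x) = exp(2πix)`. -/
def e (x : ℂ) : ℂ := Complex.exp (2 * Real.pi * Complex.I * x)

section Jacobi

variable {n : ℕ} (κ : ℤ) (F : HalfIntegralForm n) {V : Type*} [AddCommGroup V] [Module ℂ V]

/-- `(φ|_{κ/2,F}(A,w))(τ,z) = φ(Aτ, z/(cτ+d)) w(τ)^{-κ} e(-cF[z]/(cτ+d))`; `κ` is twice the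
weight. -/
def jacobiSlash (g : Mp) (φ : ℍ → (Fin n → ℂ) → V) : ℍ → (Fin n → ℂ) → V := fun τ z =>
  (g.w τ ^ (-κ) * e (-(g.mat 1 0 : ℂ) * quadVal F.toMatrixC z / autFactor g.mat τ)) •
    φ (g.mat • τ) ((autFactor g.mat τ)⁻¹ • z)

/-- `(φ|_F[l,m])(τ,z) = φ(τ, z + lτ + m) e(τF[l] + 2zᵗFl)` for `l, m ∈ ℤⁿ`. -/
def latticeSlash (l m : Fin n → ℤ) (φ : ℍ → (Fin n → ℂ) → V) : ℍ → (Fin n → ℂ) → V := fun τ z =>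
  e (τ * quadVal F.toMatrixC (fun i => (l i : ℂ)) +
      2 * (z ⬝ᵥ F.toMatrixC.mulVec (fun i => (l i : ℂ)))) •
    φ τ (fun i => z i + l i * τ + m i)

/-- Holomorphic functions on `ℍ × ℂⁿ` with values in a finite dimensional complex vector space. -/
def IsHolomorphic (φ : ℍ → (Fin n → ℂ) → V) : Prop :=
  ∀ v : Module.Dual ℂ V, DifferentiableOn ℂ
    (fun p : ℂ × (Fin n → ℂ) => v (φ (UpperHalfPlane.ofComplex p.1) p.2)) {p | 0 < p.1.im}

/-- `φ` has an absolutely convergent Fourier expansion `∑ c(l,r) q^l e(zᵗr)` over `l ∈ ℚ`,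
`r ∈ ℤⁿ` with `4l - F⁻¹[r] ≥ 0` (convergence in the finite dimensional space `V` is tested
against linear functionals). -/
def HasFourierExpansion (φ : ℍ → (Fin n → ℂ) → V) : Prop :=
  ∃ c : ℚ × (Fin n → ℤ) → V,
    (∀ l r, c (l, r) ≠ 0 → 0 ≤ 4 * (l : ℝ) - quadVal F.toMatrix⁻¹ (fun i => (r i : ℝ))) ∧
    ∀ (τ : ℍ) (z : Fin n → ℂ) (v : Module.Dual ℂ V),
      HasSum (fun p : ℚ × (Fin n → ℤ) =>
        v (c p) * (e ((p.1 : ℂ) * τ) * e (z ⬝ᵥ fun i => (p.2 i : ℂ)))) (v (φ τ z))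

theorem jacobiSlash_add (g : Mp) (φ ψ : ℍ → (Fin n → ℂ) → V) :
    jacobiSlash κ F g (φ + ψ) = jacobiSlash κ F g φ + jacobiSlash κ F g ψ := by
  ext; simp [jacobiSlash]

theorem jacobiSlash_smul (g : Mp) (a : ℂ) (φ : ℍ → (Fin n → ℂ) → V) :
    jacobiSlash κ F g (a • φ) = a • jacobiSlash κ F g φ := by
  ext; simp [jacobiSlash, smul_comm a]

/-- The space `J_{κ/2,F}(Γ,V)` of Jacobi forms of weight `κ/2`, index `F` and typus `(Γ,V)`. -/
def jacobiForms (Γ : Subgroup Mp) (ρ : Representation ℂ Γ V) :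
    Submodule ℂ (ℍ → (Fin n → ℂ) → V) where
  carrier := {φ | IsHolomorphic φ ∧
    (∀ (g : Γ) (τ : ℍ) (z : Fin n → ℂ), jacobiSlash κ F g φ τ z = ρ g (φ τ z)) ∧
    (∀ l m : Fin n → ℤ, latticeSlash F l m φ = φ) ∧
    ∀ g : Mp, HasFourierExpansion F (jacobiSlash κ F g φ)}
  zero_mem' := by
    refine ⟨fun v => ?_, fun g τ z => ?_, fun l m => ?_, fun g => ⟨0, by simp, fun τ z v => ?_⟩⟩
    · simp
    · simp [jacobiSlash]
    · ext; simp [latticeSlash]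
    · simp [jacobiSlash]
  add_mem' := by
    rintro φ ψ ⟨h1, h2, h3, h4⟩ ⟨k1, k2, k3, k4⟩
    refine ⟨fun v => ?_, fun g τ z => ?_, fun l m => ?_, fun g => ?_⟩
    · exact ((h1 v).add (k1 v)).congr fun p _ => map_add v _ _
    · rw [jacobiSlash_add, Pi.add_apply, Pi.add_apply, h2, k2, Pi.add_apply, Pi.add_apply, map_add]
    · conv_rhs => rw [← h3 l m, ← k3 l m]
      ext; simp [latticeSlash]
    · obtain ⟨c, hc, hc'⟩ := h4 g
      obtain ⟨d, hd, hd'⟩ := k4 g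
      refine ⟨c + d, fun l r hne => ?_, fun τ z v => ?_⟩
      · by_cases hcz : c (l, r) = 0
        · exact hd l r fun h => hne (by simp [hcz, h])
        · exact hc l r hcz
      · rw [jacobiSlash_add]
        simpa [add_mul] using (hc' τ z v).add (hd' τ z v)
  smul_mem' := by
    rintro a φ ⟨h1, h2, h3, h4⟩
    refine ⟨fun v => ?_, fun g τ z => ?_, fun l m => ?_, fun g => ?_⟩
    · exact ((h1 v).const_smul a).congr fun p _ => map_smul v a _
    · rw [jacobiSlash_smul, Pi.smul_apply, Pi.smul_apply, h2, Pi.smul_apply, Pi.smul_apply, map_smul]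
    · conv_rhs => rw [← h3 l m]
      ext; simp [latticeSlash, smul_comm a]
    · obtain ⟨c, hc, hc'⟩ := h4 g
      refine ⟨a • c, fun l r hne => hc l r fun h => hne (by simp [h]), fun τ z v => ?_⟩
      rw [jacobiSlash_smul]
      simpa [mul_assoc] using (hc' τ z v).mul_left a

/-- The theta series `ϑ_{F,x}(τ,z) = ∑_{r ≡ x mod 2F} e(τ ¼F⁻¹[r] + rᵗz)`. -/
def theta (x : F.Disc) : ℍ → (Fin n → ℂ) → ℂ := fun τ z =>
  ∑' r : {r : Fin n → ℤ // (Submodule.Quotient.mk r : F.Disc) = x},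
    e (τ * (1 / 4 * quadVal F.toMatrix⁻¹ (fun i => (r.1 i : ℝ)) : ℝ) +
      (fun i => (r.1 i : ℂ)) ⬝ᵥ z)

/-- The space `Θ(F)` spanned by the theta series `ϑ_{F,x}`. -/
def thetaSpan : Submodule ℂ (ℍ → (Fin n → ℂ) → ℂ) := Submodule.span ℂ (Set.range (theta F))

/-- The map `λ ↦ ∑_{x ∈ D_F} λ(x) ϑ_{F,x}` from `W(F)^*` to functions on `ℍ × ℂⁿ`. -/
def thetaMap : Module.Dual ℂ (F.Disc →₀ ℂ) →ₗ[ℂ] (ℍ → (Fin n → ℂ) → ℂ) where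
  toFun v := ∑ x, v (Finsupp.single x 1) • theta F x
  map_add' _ _ := by simp [add_smul, Finset.sum_add_distrib]
  map_smul' _ _ := by simp [mul_smul, Finset.smul_sum]

/-- The vector space `M_{κ/2-n/2} ⊗ W(F)^*`. -/
def FormsTensorDual : Type :=
  modularForms (κ - n) ⊗[ℂ] Module.Dual ℂ (F.Disc →₀ ℂ)

instance : AddCommGroup (FormsTensorDual κ F) :=
  inferInstanceAs (AddCommGroup (modularForms (κ - n) ⊗[ℂ] Module.Dual ℂ (F.Disc →₀ ℂ)))

instance : Module ℂ (FormsTensorDual κ F) :=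
  inferInstanceAs (Module ℂ (modularForms (κ - n) ⊗[ℂ] Module.Dual ℂ (F.Disc →₀ ℂ)))

/-- The element `h ⊗ λ` of `M_{κ/2-n/2} ⊗ W(F)^*`, linear in both arguments. -/
def FormsTensorDual.tmul : modularForms (κ - n) →ₗ[ℂ] Module.Dual ℂ (F.Disc →₀ ℂ) →ₗ[ℂ]
    FormsTensorDual κ F :=
  TensorProduct.mk ℂ (modularForms (κ - n)) (Module.Dual ℂ (F.Disc →₀ ℂ))

/-- The right `Mp₂(ℤ)`-module `M_{κ/2-n/2} ⊗ W(F)^*`. -/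
def formsTensorDual : Representation ℂ Mpᵐᵒᵖ (FormsTensorDual κ F) :=
  (modularFormsRep (κ - n)).tprod (rightDual (weilRep F))

/-- `(M_{κ/2-n/2} ⊗ W(F)^*) ⊗_{ℂ[Mp₂(ℤ)]} Ind_Γ V`. -/
abbrev ThetaTensor (Γ : Subgroup Mp) (ρ : Representation ℂ Γ V) : Type _ :=
  BalancedTensor (formsTensorDual κ F) (Representation.ind Γ.subtype ρ)

/-- The canonical map `t ⊗ v ↦ t ⊗ (1 ⊗ v)`. -/
def toThetaTensor (Γ : Subgroup Mp) (ρ : Representation ℂ Γ V) :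
    FormsTensorDual κ F ⊗[ℂ] V →ₗ[ℂ] ThetaTensor κ F Γ ρ :=
  BalancedTensor.mk (formsTensorDual κ F) (Representation.ind Γ.subtype ρ) ∘ₗ
    (Representation.IndV.mk Γ.subtype ρ 1).lTensor _

/-- The map between the spaces `(M_{κ/2-n/2} ⊗ W(F)^*) ⊗_{ℂ[Mp₂(ℤ)]} Ind_Γ V` induced by a `Γ`-linear
map `V → V'`. -/
def ThetaTensor.map {Γ : Subgroup Mp} {V' : Type*} [AddCommGroup V'] [Module ℂ V']
    {ρ : Representation ℂ Γ V} {ρ' : Representation ℂ Γ V'} (f : ρ.IntertwiningMap ρ') :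
    ThetaTensor κ F Γ ρ →ₗ[ℂ] ThetaTensor κ F Γ ρ' :=
  BalancedTensor.map (formsTensorDual κ F) (indMap f)

/-- The linear map `h ⊗ λ ↦ h(τ) ∑ₓ λ(x) ϑ_{F,x}(τ,z)`. -/
def FormsTensorDual.eval (τ : ℍ) (z : Fin n → ℂ) : FormsTensorDual κ F →ₗ[ℂ] ℂ :=
  TensorProduct.lift (LinearMap.mk₂ ℂ
    (fun (h : modularForms (κ - n)) (v : Module.Dual ℂ (F.Disc →₀ ℂ)) =>
      h.1 τ * thetaMap F v τ z)
    (by intros; simp [add_mul]) (by intros; simp [mul_assoc])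
    (by intros; simp [mul_add]) (by intros; simp [mul_left_comm]))

/-- The theta expansion `(h ⊗ λ) ⊗ v ↦ h(τ) (∑ₓ λ(x) ϑ_{F,x}(τ,z)) v`. -/
def thetaExpansion (V : Type*) [AddCommGroup V] [Module ℂ V] :
    FormsTensorDual κ F ⊗[ℂ] V →ₗ[ℂ]
      (ℍ → (Fin n → ℂ) → V) :=
  LinearMap.pi fun τ => LinearMap.pi fun z =>
    TensorProduct.lift <| LinearMap.toSpanSingleton ℂ (V →ₗ[ℂ] V) LinearMap.id ∘ₗ
      FormsTensorDual.eval κ F τ z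

theorem formsTensorDual_tmul (g : Mp) (h : modularForms (κ - n))
    (v : Module.Dual ℂ (F.Disc →₀ ℂ)) :
    formsTensorDual κ F (MulOpposite.op g) (FormsTensorDual.tmul κ F h v) =
      FormsTensorDual.tmul κ F ⟨slash (κ - n) g h, slash_mem_modularForms h.2 g⟩
        (v ∘ₗ weilRep F g) :=
  rfl

theorem toThetaTensor_tmul (Γ : Subgroup Mp) (ρ : Representation ℂ Γ V) (t : FormsTensorDual κ F)
    (v : V) : toThetaTensor κ F Γ ρ (t ⊗ₜ v) =
      BalancedTensor.mk _ _ (t ⊗ₜ Representation.IndV.mk Γ.subtype ρ 1 v) :=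
  rfl

theorem thetaExpansion_tmul (h : modularForms (κ - n)) (v : Module.Dual ℂ (F.Disc →₀ ℂ)) (x : V)
    (τ : ℍ) (z : Fin n → ℂ) :
    thetaExpansion κ F V (FormsTensorDual.tmul κ F h v ⊗ₜ x) τ z =
      (h.1 τ * thetaMap F v τ z) • x := by
  have : FormsTensorDual.eval κ F τ z (FormsTensorDual.tmul κ F h v) = h.1 τ * thetaMap F v τ z :=
    TensorProduct.lift.tmul _ _
  simp [thetaExpansion, this]

end Jacobi

end JacobiTheta

end

universe u

/-!
The theorem rests on the theta decomposition: a function of `z` that has the right behaviour under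
the lattice `ℤⁿ` is a combination of the finitely many theta series `ϑ_{F,x}`, with coefficients
that depend on `τ` only.

*The Weil representation.* Poisson summation for a Gaussian function on `ℝⁿ` shows that `(S, √τ)`
maps the span of the theta series to itself, up to one constant; for `(T, 1)` this is clear. As
these two elements generate `Mp₂(ℤ)` and the theta series are linearly independent, `Mp₂(ℤ)` acts on
them by matrices (`thetaMatrix`), and the transposed action is a representation on `ℂ[D_F]`. The
constant in the inversion formula is not computed analytically: the relation `TSTST = S`, read at
the matrix entry `(0, 0)`, forces it to be `σ |D_F|^{-1/2}` (`thetaMatrix_S`). So `W(F)` exists, and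
`W(F)^*` is the span of the theta series.

*Finiteness.* The group `Mp₂(ℤ)` permutes, by conjugation with the matrices `thetaMatrix`, the finite
set of multiples by roots of unity of the Heisenberg operators on `ℂ[D_F]`. What acts trivially is
scalar by nondegeneracy of the discriminant form, and its determinant is a root of unity of bounded
order. Hence the Weil representation has finite image (`finite_range_thetaMatrix`).

*Jacobi forms.* The Fourier expansion of a Jacobi form `φ`, regrouped by powers of `e(z)`, has
coefficients which are holomorphic in `τ`; the lattice invariance turns it into a combination
`∑ h_x ϑ_{F,x}`. The condition `4l ≥ F⁻¹[r]` bounds the `h_x` at `i∞`, also after the action of any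
element of `Mp₂(ℤ)`, since the theta series are transformed by an invertible matrix; the finite image
of the Weil representation makes the `h_x` modular on a subgroup of finite index
(`exists_modularForms_theta_combination`). Conversely every product of a modular form and a theta
series satisfies the analytic conditions. Thus the theta expansion identifies `J_{k,F}(Γ, V)` with
the `Γ`-invariants of `(M ⊗ W(F)^*) ⊗ V` (`jacobiFormsEquiv`).

*Induction.* For a right `G`-module `A` and a subgroup `Γ`, the module `A ⊗_{ℂ[G]} Ind V` is the space
of `Γ`-coinvariants of `A ⊗ V`. All vectors of `(M ⊗ W(F)^*) ⊗ V` are fixed by a subgroup of finite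
index, and under this condition averaging identifies the coinvariants with the invariants
(`bijective_mk_invariants`).
-/

open UpperHalfPlane
open scoped Manifold MatrixGroups TensorProduct

noncomputable section

namespace JacobiTheta

/-! ### The exponential functions -/

theorem e_add (x y : ℂ) : e (x + y) = e x * e y := by
  simp [e, mul_add, Complex.exp_add]

@[simp] theorem e_zero : e 0 = 1 := by simp [e]

theorem e_neg (x : ℂ) : e (-x) = (e x)⁻¹ := by
  simp [e, Complex.exp_neg]

theorem e_ne_zero (x : ℂ) : e x ≠ 0 := Complex.exp_ne_zero _

theorem e_intCast (m : ℤ) : e (m : ℂ) = 1 := by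
  rw [e, mul_comm]
  exact Complex.exp_int_mul_two_pi_mul_I m

theorem norm_e (x : ℂ) : ‖e x‖ = Real.exp (-(2 * Real.pi * x.im)) := by
  rw [e, Complex.norm_exp]
  congr 1
  simp

theorem differentiable_e : Differentiable ℂ e := by
  unfold e
  fun_prop

theorem eCircle_coe (x : ℝ) : eCircle (x : UnitAddCircle) = e x := by
  rw [eCircle, AddCircle.toCircle_apply_mk, Circle.coe_exp, e]
  push_cast
  ring_nf

@[simp] theorem eCircle_zero : eCircle 0 = 1 := by simp [eCircle]

theorem eCircle_add (x y : UnitAddCircle) : eCircle (x + y) = eCircle x * eCircle y := by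
  simp [eCircle, AddCircle.toCircle_add]

theorem eCircle_ne_zero (x : UnitAddCircle) : eCircle x ≠ 0 := by
  simp [eCircle]

theorem eCircle_injective : Function.Injective eCircle := fun _ _ h =>
  AddCircle.injective_toCircle one_ne_zero (Subtype.ext h)

theorem eCircle_nsmul (k : ℕ) (x : UnitAddCircle) : eCircle (k • x) = eCircle x ^ k := by
  induction k with
  | zero => simp
  | succ k ih => rw [succ_nsmul, eCircle_add, ih, pow_succ]

/-! ### The actions on functions of `τ` and `z` -/

theorem quadVal_smul {n : ℕ} {R : Type*} [CommSemiring R] (F : Matrix (Fin n) (Fin n) R) (a : R)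
    (x : Fin n → R) : quadVal F (a • x) = a ^ 2 * quadVal F x := by
  simp only [quadVal, Matrix.mulVec_smul, dotProduct_smul, smul_dotProduct, smul_eq_mul]
  ring

section

variable {n : ℕ} (κ : ℤ) (F : HalfIntegralForm n) {V : Type*} [AddCommGroup V] [Module ℂ V]

@[simp] theorem jacobiSlash_one (φ : ℍ → (Fin n → ℂ) → V) : jacobiSlash κ F 1 φ = φ := by
  ext τ z
  simp [jacobiSlash, autFactor_one]

/-- The cocycle identity behind the factor `e(-cF[z]/(cτ+d))`. -/
theorem cocycle_mul (A B : SL(2, ℤ)) (τ : ℍ) :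
    ((A * B) 1 0 : ℂ) / autFactor (A * B) τ =
      (B 1 0 : ℂ) / autFactor B τ +
        (A 1 0 : ℂ) / autFactor A (B • τ) * ((autFactor B τ)⁻¹ ^ 2) := by
  have h1 := autFactor_ne_zero B τ
  have h2 := autFactor_ne_zero A (B • τ)
  have h3 : ((A * B) 1 0 : ℂ) * autFactor B τ = (B 1 0 : ℂ) * autFactor (A * B) τ + A 1 0 := by
    have hd := B.det_coe
    rw [Matrix.det_fin_two] at hd
    have hd' : (B 0 0 : ℂ) * B 1 1 - B 0 1 * B 1 0 = 1 := by exact_mod_cast hd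
    simp only [autFactor, Matrix.SpecialLinearGroup.coe_mul, Matrix.mul_apply, Fin.sum_univ_two]
    push_cast
    linear_combination (A 1 0 : ℂ) * hd'
  rw [autFactor_mul] at h3 ⊢
  have key : ∀ a b c p q : ℂ, b ≠ 0 → a ≠ 0 → c * b = p * (a * b) + q →
      c / (a * b) = p / b + q / a * (b⁻¹ ^ 2) := by
    intro a b c p q hb ha h
    field_simp
    linear_combination h
  exact key _ _ _ _ _ h1 h2 h3

theorem jacobiSlash_mul (g g' : Mp) (φ : ℍ → (Fin n → ℂ) → V) :
    jacobiSlash κ F (g * g') φ = jacobiSlash κ F g' (jacobiSlash κ F g φ) := by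
  ext τ z
  have ha : (g.mat * g'.mat) • τ = g.mat • g'.mat • τ := mul_smul _ _ _
  simp only [jacobiSlash, Mp.mul_mat, Mp.mul_w, ha, mul_zpow, quadVal_smul]
  rw [smul_smul (M := ℂ) (α := V), smul_smul (M := ℂ) (α := Fin n → ℂ)]
  have h := cocycle_mul g.mat g'.mat τ
  have h2 : -((g.mat * g'.mat) 1 0 : ℂ) * quadVal F.toMatrixC z / autFactor (g.mat * g'.mat) τ =
      -(g'.mat 1 0 : ℂ) * quadVal F.toMatrixC z / autFactor g'.mat τ +
      -(g.mat 1 0 : ℂ) * ((autFactor g'.mat τ)⁻¹ ^ 2 * quadVal F.toMatrixC z) /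
        autFactor g.mat (g'.mat • τ) := by
    linear_combination (-quadVal F.toMatrixC z) * h
  rw [h2, e_add, autFactor_mul, mul_inv]
  congr 1
  · ring

/-- Weights add up: a function of `τ` of weight `(κ - n)/2` times one of weight `n/2` and index `F`. -/
theorem jacobiSlash_mul_smul (g : Mp) (h : ℍ → ℂ) (θ : ℍ → (Fin n → ℂ) → ℂ) (v : V) :
    jacobiSlash κ F g (fun τ z => (h τ * θ τ z) • v) =
      fun τ z => (slash (κ - n) g h τ * jacobiSlash (n : ℤ) F g θ τ z) • v := by
  ext τ z
  simp only [jacobiSlash, slash_apply, smul_smul, smul_eq_mul]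
  congr 1
  rw [show -κ = -(κ - n) + -n by ring, zpow_add₀ (g.w_ne_zero τ)]
  ring

theorem map_jacobiSlash {V' : Type*} [AddCommGroup V'] [Module ℂ V'] (f : V →ₗ[ℂ] V') (g : Mp)
    (φ : ℍ → (Fin n → ℂ) → V) (τ : ℍ) (z : Fin n → ℂ) :
    f (jacobiSlash κ F g φ τ z) = jacobiSlash κ F g (fun τ z => f (φ τ z)) τ z := by
  simp [jacobiSlash]

theorem jacobiSlash_sum {ι : Type*} (s : Finset ι) (g : Mp) (φ : ι → ℍ → (Fin n → ℂ) → V) :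
    jacobiSlash κ F g (∑ i ∈ s, φ i) = ∑ i ∈ s, jacobiSlash κ F g (φ i) := by
  ext τ z
  simp [jacobiSlash, Finset.smul_sum]

end

/-! ### Generators and relations of the metaplectic group -/

namespace Mp

/-- The central element `(1, -1)`. -/
def center : Mp where
  mat := 1
  w := fun _ => -1
  holo := mdifferentiable_const
  sq := fun τ => by simp [autFactor_one]

/-- Two holomorphic square roots of the same function on `ℍ` differ by a sign. -/
theorem eq_or_eq_of_mat_eq {g h : Mp} (hm : g.mat = h.mat) : g = h ∨ g = h * center := by
  have hc : ∀ τ, g.w τ = h.w τ ∨ g.w τ = -h.w τ := fun τ => by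
    rw [← sq_eq_sq_iff_eq_or_eq_neg, g.sq, h.sq, hm]
  have hcont : Continuous fun τ => g.w τ / h.w τ :=
    (g.holo.continuous).div (h.holo.continuous) h.w_ne_zero
  have hpc : IsPreconnected (Set.univ : Set ℍ) := isPreconnected_univ
  have hs := hpc.eq_one_or_eq_neg_one_of_sq_eq (f := fun τ => g.w τ / h.w τ) hcont.continuousOn
    (fun τ _ => by
      simp only [Pi.pow_apply, Pi.one_apply, div_pow, g.sq, h.sq, hm]
      exact div_self (autFactor_ne_zero _ _))
  rcases hs with hs | hs
  · refine Or.inl (ext' hm fun τ => ?_)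
    have := hs (Set.mem_univ τ)
    simp only [Pi.one_apply] at this
    rwa [div_eq_one_iff_eq (h.w_ne_zero τ)] at this
  · refine Or.inr (ext' (by simp [hm, center]) fun τ => ?_)
    have := hs (Set.mem_univ τ)
    simp only [Pi.neg_apply, Pi.one_apply] at this
    rw [div_eq_iff (h.w_ne_zero τ)] at this
    simp [this, center]

/-- A square root is determined by lying in the upper half plane. The relations below are verified
by this, since a product of at most two values of `√τ` lies in the upper half plane. -/
theorem eq_of_sq_eq_of_im_pos {a b : ℂ} (h : a ^ 2 = b ^ 2) (ha : 0 < a.im) (hb : 0 < b.im) :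
    a = b := by
  rcases sq_eq_sq_iff_eq_or_eq_neg.1 h with h | h
  · exact h
  · rw [h, Complex.neg_im] at ha
    linarith

theorem S_w_sq (τ : ℍ) : (S.w τ) ^ 2 = τ := by
  rw [S.sq]; simp [autFactor, S, ModularGroup.S]

/-- The chosen root `√τ` lies in the first quadrant. -/
theorem S_w_re_im_pos (τ : ℍ) : 0 < (S.w τ).re ∧ 0 < (S.w τ).im := by
  have h0 : (τ : ℂ) ≠ 0 := τ.ne_zero
  have harg : (τ : ℂ).arg ∈ Set.Ioo 0 Real.pi := by
    refine ⟨?_, ?_⟩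
    · refine lt_of_le_of_ne (Complex.arg_nonneg_iff.2 τ.im_pos.le) fun h => ?_
      have := Complex.arg_eq_zero_iff.1 h.symm
      exact τ.im_pos.ne' this.2
    · exact Complex.arg_lt_pi_iff.2 (Or.inr τ.im_pos.ne')
  have hw : S.w τ = Complex.exp (Complex.log τ * (1 / 2 : ℂ)) := by
    simp only [S]
    rw [Complex.cpow_def_of_ne_zero h0]
  have him : (Complex.log τ * (1 / 2 : ℂ)).im = (τ : ℂ).arg / 2 := by
    rw [show (1 / 2 : ℂ) = ((1 / 2 : ℝ) : ℂ) by norm_num, Complex.im_mul_ofReal, Complex.log_im]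
    ring
  rw [hw, Complex.exp_re, Complex.exp_im, him]
  exact ⟨mul_pos (Real.exp_pos _) (Real.cos_pos_of_mem_Ioo ⟨by linarith [harg.1, Real.pi_pos],
    by linarith [harg.2]⟩), mul_pos (Real.exp_pos _) (Real.sin_pos_of_pos_of_lt_pi
    (by linarith [harg.1]) (by linarith [harg.2, Real.pi_pos]))⟩

theorem S_w_mul_im_pos (τ τ' : ℍ) : 0 < (S.w τ * S.w τ').im := by
  rw [Complex.mul_im]
  have h1 := S_w_re_im_pos τ
  have h2 := S_w_re_im_pos τ'
  exact add_pos (mul_pos h1.1 h2.2) (mul_pos h1.2 h2.1)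

theorem coe_S_smul (τ : ℍ) : ((ModularGroup.S • τ : ℍ) : ℂ) = -1 / τ := by
  rw [UpperHalfPlane.modular_S_smul]
  simp [neg_div]

theorem coe_T_smul (τ : ℍ) : ((ModularGroup.T • τ : ℍ) : ℂ) = τ + 1 := by
  rw [UpperHalfPlane.modular_T_smul]
  simp [add_comm]

theorem S_pow_four : S ^ 4 = center := by
  have hw : ∀ τ, (S * S).w τ = Complex.I := fun τ => by
    refine eq_of_sq_eq_of_im_pos ?_ (S_w_mul_im_pos _ _) (by simp)
    rw [mul_w, mul_pow, S_w_sq, S_w_sq, show S.mat = ModularGroup.S from rfl, coe_S_smul]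
    have := τ.ne_zero
    field_simp
    simp
  rw [show S ^ 4 = (S * S) * (S * S) by rw [← pow_two, ← pow_two, ← pow_mul]]
  refine ext' ?_ fun τ => ?_
  · have : ModularGroup.S * ModularGroup.S * (ModularGroup.S * ModularGroup.S) = 1 := by decide
    exact this
  · rw [mul_w, hw, hw]
    simp [center]

/-- `Mp₂(ℤ)` is generated by `(T, 1)` and `(S, √τ)`. -/
theorem closure_S_T : Subgroup.closure {S, T} = ⊤ := by
  let π : Mp →* SL(2, ℤ) := ⟨⟨Mp.mat, rfl⟩, fun _ _ => rfl⟩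
  have hS : S ∈ Subgroup.closure {S, T} := Subgroup.subset_closure (by simp)
  have hmap : (Subgroup.closure {S, T}).map π = ⊤ := by
    rw [MonoidHom.map_closure, Set.image_pair]
    exact SpecialLinearGroup.SL2Z_generators
  refine eq_top_iff.2 fun g _ => ?_
  obtain ⟨h, hh, hg⟩ : g.mat ∈ (Subgroup.closure {S, T}).map π := hmap ▸ Subgroup.mem_top _
  rcases eq_or_eq_of_mat_eq (g := g) (h := h) hg.symm with rfl | rfl
  · exact hh
  · exact mul_mem hh (S_pow_four ▸ pow_mem hS 4)

/-- The relation `STS = T⁻¹ST⁻¹`. It holds in `Mp₂(ℤ)` without a sign. -/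
theorem S_T_S : T * (S * T * S) * T = S := by
  have hm : ModularGroup.T * (ModularGroup.S * ModularGroup.T * ModularGroup.S) *
    ModularGroup.T = ModularGroup.S := by decide
  refine ext' hm fun τ => ?_
  refine eq_of_sq_eq_of_im_pos ?_ ?_ (S_w_re_im_pos τ).2
  · rw [Mp.sq, Mp.sq]
    exact congrArg (autFactor · τ) hm
  · have : ∀ τ', T.w τ' = 1 := fun _ => rfl
    simp only [mul_w, this, one_mul, mul_one]
    exact S_w_mul_im_pos _ _

theorem S_pow_eight : S ^ 8 = 1 := by
  rw [show S ^ 8 = S ^ 4 * S ^ 4 by rw [← pow_add], S_pow_four]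
  exact ext' (by simp [center]) fun τ => by simp [center]

end Mp

/-! ### Multidimensional Fourier series -/

section Fourier

open MeasureTheory UnitAddTorus

/-- The circle `ℝ/ℤ` is given total volume `1`, as in Mathlib's theory of Fourier series. -/
local instance : MeasureSpace UnitAddCircle := ⟨AddCircle.haarAddCircle⟩

local instance : Measure.IsAddHaarMeasure (volume : Measure UnitAddCircle) :=
  inferInstanceAs (Measure.IsAddHaarMeasure AddCircle.haarAddCircle)

local instance : IsProbabilityMeasure (volume : Measure UnitAddCircle) :=
  inferInstanceAs (IsProbabilityMeasure AddCircle.haarAddCircle)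

variable {n : ℕ}

theorem mFourier_coe (r : Fin n → ℤ) (x : Fin n → ℝ) :
    mFourier r (fun i => (x i : UnitAddCircle)) =
      e ((fun i => (r i : ℂ)) ⬝ᵥ fun i => (x i : ℂ)) := by
  simp only [mFourier, ContinuousMap.coe_mk, fourier_coe_apply, e, dotProduct]
  rw [← Complex.exp_sum, Finset.mul_sum]
  congr 1
  refine Finset.sum_congr rfl fun i _ => ?_
  push_cast
  ring

theorem exists_coe_eq (t : UnitAddTorus (Fin n)) :
    ∃ x : Fin n → ℝ, t = fun i => (x i : UnitAddCircle) := by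
  choose x hx using fun i => QuotientAddGroup.mk_surjective (t i)
  exact ⟨x, funext fun i => (hx i).symm⟩

/-- The coefficients of a pointwise convergent Fourier series on `ℝⁿ` with sum zero vanish. -/
theorem fourier_coeff_eq_zero {a : (Fin n → ℤ) → ℂ}
    (h : ∀ x : Fin n → ℝ,
      HasSum (fun r => a r * e ((fun i => (r i : ℂ)) ⬝ᵥ fun i => (x i : ℂ))) 0) : a = 0 := by
  have hs : Summable fun r => ‖a r‖ := by
    have := (h 0).summable.norm
    simpa [dotProduct] using this
  have hs' : Summable fun r => a r • (mFourier r : C(UnitAddTorus (Fin n), ℂ)) :=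
    Summable.of_norm (by simpa [norm_smul, mFourier_norm] using hs)
  obtain ⟨G, hG⟩ := hs'
  have hG0 : G = 0 := by
    ext t
    obtain ⟨x, rfl⟩ := exists_coe_eq t
    have h1 := (ContinuousMap.evalCLM ℂ (fun i => (x i : UnitAddCircle))).hasSum hG
    refine h1.unique ?_
    convert! h x using 2 with r
    simp [mFourier_coe]
  rw [hG0] at hG
  have h2 := (ContinuousMap.toLp (E := ℂ) 2 (volume : Measure (UnitAddTorus (Fin n))) ℂ).hasSum hG
  rw [map_zero] at h2
  ext s
  have h3 := (innerSL ℂ (mFourierLp (d := Fin n) 2 s)).hasSum h2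
  rw [map_zero] at h3
  refine (h3.unique ?_).symm
  refine (hasSum_ite_eq s (a s)).congr_fun fun r => ?_
  have := orthonormal_iff_ite.1 (orthonormal_mFourier (d := Fin n)) s r
  rw [map_smul, map_smul, innerSL_apply_apply,
    smul_eq_mul]
  erw [this]
  by_cases hrs : r = s
  · simp [hrs]
  · simp [hrs, Ne.symm hrs]

theorem fourier_coeff_unique {a b : (Fin n → ℤ) → ℂ} {f : (Fin n → ℝ) → ℂ}
    (ha : ∀ x, HasSum (fun r => a r * e ((fun i => (r i : ℂ)) ⬝ᵥ fun i => (x i : ℂ))) (f x))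
    (hb : ∀ x, HasSum (fun r => b r * e ((fun i => (r i : ℂ)) ⬝ᵥ fun i => (x i : ℂ))) (f x)) :
    a = b := by
  have := fourier_coeff_eq_zero (a := a - b) fun x => by
    simpa [sub_mul] using (ha x).sub (hb x)
  exact sub_eq_zero.1 this

/-- Poisson summation in several variables. The periodization of `f` descends to a continuous
function on the torus; its Fourier coefficients are computed by unfolding, and are summable by
hypothesis, so that its Fourier series converges to it at `0`. -/
theorem poisson_summation {f : (Fin n → ℝ) → ℂ} (hf : Continuous f) (hi : Integrable f)
    (hbd : ∀ R : ℝ, ∃ g : (Fin n → ℤ) → ℝ, Summable g ∧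
      ∀ (x : Fin n → ℝ) (m : Fin n → ℤ), ‖x‖ ≤ R → ‖f (x + fun i => (m i : ℝ))‖ ≤ g m)
    (hs : Summable fun s : Fin n → ℤ =>
      ∫ u, e (-((fun i => (s i : ℂ)) ⬝ᵥ fun i => (u i : ℂ))) * f u) :
    ∑' m : Fin n → ℤ, f (fun i => (m i : ℝ)) =
      ∑' s : Fin n → ℤ, ∫ u, e (-((fun i => (s i : ℂ)) ⬝ᵥ fun i => (u i : ℂ))) * f u := by
  let G : (Fin n → ℝ) → ℂ := fun x => ∑' m : Fin n → ℤ, f (x + fun i => (m i : ℝ))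
  have hGc : Continuous G := by
    rw [continuous_iff_continuousAt]
    intro x₀
    obtain ⟨g, hg, hgb⟩ := hbd (‖x₀‖ + 1)
    have hcont : ContinuousOn G (Metric.closedBall 0 (‖x₀‖ + 1)) :=
      continuousOn_tsum (fun m => (hf.comp (by fun_prop)).continuousOn) hg
        (fun m x hx => hgb x m (by simpa using hx))
    refine hcont.continuousAt (Metric.closedBall_mem_nhds_of_mem ?_)
    simp
  have hper : ∀ x y : Fin n → ℝ, (fun i => (x i : UnitAddCircle)) = (fun i => (y i : UnitAddCircle))
      → G x = G y := by
    intro x y hxy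
    have h1 : ∀ i, ∃ k : ℤ, x i = y i + k := fun i => by
      have := congrFun hxy i
      rw [← sub_eq_zero, ← AddCircle.coe_sub, AddCircle.coe_eq_zero_iff] at this
      obtain ⟨k, hk⟩ := this
      exact ⟨k, by rw [zsmul_eq_mul, mul_one] at hk; linarith⟩
    choose k hk using h1
    change ∑' m : Fin n → ℤ, f (x + fun i => (m i : ℝ)) =
      ∑' m : Fin n → ℤ, f (y + fun i => (m i : ℝ))
    rw [← (Equiv.addRight k).tsum_eq (fun m : Fin n → ℤ => f (y + fun i => (m i : ℝ)))]
    refine tsum_congr fun m => congrArg f ?_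
    ext i
    simp [hk i]
    ring
  have hq : IsOpenQuotientMap (Pi.map fun (_ : Fin n) (x : ℝ) => (x : UnitAddCircle)) :=
    IsOpenQuotientMap.piMap fun _ => QuotientAddGroup.isOpenQuotientMap_mk
  choose lift hlift using exists_coe_eq (n := n)
  have hH' : ∀ x : Fin n → ℝ, G (lift fun i => (x i : UnitAddCircle)) = G x := fun x =>
    hper _ _ (hlift _).symm
  let H : C(UnitAddTorus (Fin n), ℂ) := ⟨fun t => G (lift t),
    hq.isQuotientMap.continuous_iff.2 (hGc.congr fun x => (hH' x).symm)⟩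
  have hH : ∀ x : Fin n → ℝ, H (fun i => (x i : UnitAddCircle)) = G x := hH'
  have hcoef : ∀ s, mFourierCoeff H s =
      ∫ u, e (-((fun i => (s i : ℂ)) ⬝ᵥ fun i => (u i : ℂ))) * f u := by
    intro s
    let k : (Fin n → ℝ) → ℂ := fun u => e (-((fun i => (s i : ℂ)) ⬝ᵥ fun i => (u i : ℂ))) * f u
    let Q : Set (Fin n → ℝ) := {x | ∀ i, x i ∈ Set.Ioc ((0 : Fin n → ℝ) i) ((0 : Fin n → ℝ) i + 1)}
    have hQm : MeasurableSet Q := MeasurableSet.univ_pi' fun i => measurableSet_Ioc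
    have hk_norm : ∀ u, ‖k u‖ = ‖f u‖ := fun u => by
      simp only [k, norm_mul, norm_e]
      rw [show (-((fun i => (s i : ℂ)) ⬝ᵥ fun i => (u i : ℂ))).im = 0 by
        simp [dotProduct], mul_zero, neg_zero, Real.exp_zero, one_mul]
    have hkc : Continuous k := by
      refine (differentiable_e.continuous.comp ?_).mul hf
      unfold dotProduct
      fun_prop
    have hki : Integrable k := (hi.norm).mono' hkc.aestronglyMeasurable
      (Filter.Eventually.of_forall fun u => (hk_norm u).le)
    obtain ⟨g, hg, hgb⟩ := hbd 1
    have hQ1 : ∀ x ∈ Q, ‖x‖ ≤ 1 := fun x hx => by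
      rw [pi_norm_le_iff_of_nonneg zero_le_one]
      intro i
      have := hx i
      simp only [Pi.zero_apply, zero_add, Set.mem_Ioc] at this
      rw [Real.norm_eq_abs, abs_le]
      constructor <;> linarith
    let tr : (Fin n → ℤ) → Set (Fin n → ℝ) := fun m => (fun x => x + fun i => (m i : ℝ)) '' Q
    have htr : ∀ m, tr m = (fun x => x + fun i => (-(m i : ℝ))) ⁻¹' Q := fun m => by
      ext x
      constructor
      · rintro ⟨y, hy, rfl⟩
        have : y + (fun i => (m i : ℝ)) + (fun i => (-(m i : ℝ))) = y := by ext i; simp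
        rw [Set.mem_preimage]
        exact this.symm ▸ hy
      · intro hx
        exact ⟨_, hx, by ext i; simp⟩
    have htrm : ∀ m, MeasurableSet (tr m) := fun m => by
      rw [htr]
      exact hQm.preimage (measurable_add_const _)
    have hdisj : Pairwise (Function.onFun Disjoint tr) := fun m m' hmm => by
      rw [Function.onFun, Set.disjoint_left]
      intro x hx hx'
      rw [htr] at hx hx'
      apply hmm
      ext i
      have h1 := hx i
      have h2 := hx' i
      simp only [Pi.zero_apply, Pi.add_apply, zero_add, Set.mem_Ioc] at h1 h2
      have h3 : (m i : ℝ) < m' i + 1 := by linarith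
      have h4 : (m' i : ℝ) < m i + 1 := by linarith
      have h3' : m i < m' i + 1 := by exact_mod_cast h3
      have h4' : m' i < m i + 1 := by exact_mod_cast h4
      omega
    have hcover : ⋃ m, tr m = Set.univ := by
      refine Set.eq_univ_of_forall fun x => Set.mem_iUnion.2 ⟨fun i => ⌈x i⌉ - 1, ?_⟩
      rw [htr]
      intro i
      simp only [Pi.zero_apply, Pi.add_apply, zero_add, Set.mem_Ioc, Int.cast_sub, Int.cast_one]
      constructor
      · linarith [Int.ceil_lt_add_one (x i)]
      · linarith [Int.le_ceil (x i)]
    have hper_k : ∀ (x : Fin n → ℝ) (m : Fin n → ℤ), k (x + fun i => (m i : ℝ)) =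
        e (-((fun i => (s i : ℂ)) ⬝ᵥ fun i => (x i : ℂ))) * f (x + fun i => (m i : ℝ)) := by
      intro x m
      simp only [k]
      congr 1
      have : -((fun i => (s i : ℂ)) ⬝ᵥ fun i => ((x + fun i => (m i : ℝ)) i : ℂ)) =
          -((fun i => (s i : ℂ)) ⬝ᵥ fun i => (x i : ℂ)) + ((-(s ⬝ᵥ m) : ℤ) : ℂ) := by
        simp only [dotProduct, Pi.add_apply]
        push_cast
        rw [← neg_add, ← Finset.sum_add_distrib]
        simp_rw [mul_add]
      rw [this, e_add, e_intCast, mul_one]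
    -- The translates of the cube `Q = (0, 1]ⁿ` tile `ℝⁿ`, so the integral over `ℝⁿ` unfolds.
    rw [mFourierCoeff_eq_integral H s 0]
    have e1 : ∀ m, ∫ x in Q, k (x + fun i => (m i : ℝ)) = ∫ x in tr m, k x := fun m => by
      rw [← (measurePreserving_add_right volume (fun i => (m i : ℝ))).setIntegral_image_emb
        (measurableEmbedding_addRight _) k Q]
    have e2 : HasSum (fun m => ∫ x in tr m, k x) (∫ x, k x) := by
      have := hasSum_integral_iUnion (μ := volume) htrm hdisj (f := k) hki.integrableOn
      rwa [hcover, setIntegral_univ] at this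
    have hQfin : volume Q ≠ ⊤ := by
      refine (measure_mono (t := Metric.closedBall 0 1) fun x hx => ?_).trans_lt
        (measure_closedBall_lt_top) |>.ne
      simpa using hQ1 x hx
    have e3 : HasSum (fun m : Fin n → ℤ => ∫ x in Q, k (x + fun i => (m i : ℝ)))
        (∫ x in Q, ∑' m : Fin n → ℤ, k (x + fun i => (m i : ℝ))) := by
      have hbd' : ∀ m : Fin n → ℤ, ∀ᵐ x ∂(volume.restrict Q), ‖k (x + fun i => (m i : ℝ))‖ ≤ g m :=
        fun m => (ae_restrict_iff' hQm).2 (Filter.Eventually.of_forall fun x hx => by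
          rw [hk_norm]; exact hgb x m (hQ1 x hx))
      have : IsFiniteMeasure (volume.restrict Q) := ⟨by
        rw [Measure.restrict_apply_univ]; exact hQfin.lt_top⟩
      refine hasSum_integral_of_dominated_convergence (fun m _ => g m)
        (fun m => (hkc.comp (by fun_prop)).aestronglyMeasurable) hbd'
        (Filter.Eventually.of_forall fun _ => hg) (integrable_const _) ?_
      refine (ae_restrict_iff' hQm).2 (Filter.Eventually.of_forall fun x hx => ?_)
      exact (Summable.of_norm_bounded hg fun m => by
        rw [hk_norm]; exact hgb x m (hQ1 x hx)).hasSum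
    simp_rw [e1] at e3
    rw [← e3.unique e2]
    refine setIntegral_congr_fun hQm fun x hx => ?_
    have hneg : -((fun i => (s i : ℂ)) ⬝ᵥ fun i => (x i : ℂ)) =
      (fun i => ((-s) i : ℂ)) ⬝ᵥ fun i => (x i : ℂ) := by
      simp [dotProduct]
    simp only [hper_k]
    rw [tsum_mul_left, hH, smul_eq_mul, mFourier_coe, hneg]
  have hfun : mFourierCoeff H = fun s : Fin n → ℤ =>
      ∫ u, e (-((fun i => (s i : ℂ)) ⬝ᵥ fun i => (u i : ℂ))) * f u := funext hcoef
  have := (hasSum_mFourier_series_apply_of_summable (f := H) (hfun ▸ hs)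
    (fun _ => ((0 : ℝ) : UnitAddCircle))).tsum_eq
  rw [hH (fun _ => 0)] at this
  have hG0 : G (fun _ => 0) = ∑' m : Fin n → ℤ, f (fun i => (m i : ℝ)) := by
    refine tsum_congr fun m => congrArg f ?_
    ext i; simp
  rw [← hG0, ← this]
  refine tsum_congr fun s => ?_
  rw [mFourier_coe (x := fun _ => 0), ← hcoef]
  simp [dotProduct]

end Fourier

/-! ### Gaussian sums over `ℤⁿ` -/

section Gauss

open MeasureTheory

variable {n : ℕ}

/-- The coercion `ℝⁿ → ℂⁿ` of real vectors. -/
def toC (x : Fin n → ℝ) : Fin n → ℂ := fun i => (x i : ℂ)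

@[simp] theorem toC_apply (x : Fin n → ℝ) (i : Fin n) : toC x i = (x i : ℂ) := rfl

theorem toC_intCast (s : Fin n → ℤ) : toC (fun i => (s i : ℝ)) = fun i => (s i : ℂ) := by
  ext; simp

theorem map_ofReal_mulVec (A : Matrix (Fin n) (Fin n) ℝ) (x : Fin n → ℝ) :
    (A.map Complex.ofReal).mulVec (toC x) = toC (A.mulVec x) := by
  ext i; simp [Matrix.mulVec, dotProduct, toC]

theorem quadVal_ofReal (A : Matrix (Fin n) (Fin n) ℝ) (x : Fin n → ℝ) :
    quadVal (A.map Complex.ofReal) (toC x) = ((quadVal A x : ℝ) : ℂ) := by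
  simp [quadVal, dotProduct, Matrix.mulVec]

/-- A positive definite form is bounded below by a multiple of the sum of squares: the multiple is the
minimum on the unit sphere. -/
theorem exists_lower_bound {A : Matrix (Fin n) (Fin n) ℝ} (hA : A.PosDef) :
    ∃ δ : ℝ, 0 < δ ∧ ∀ x : Fin n → ℝ, δ * ∑ i, x i ^ 2 ≤ quadVal A x := by
  have hc : Continuous fun x : Fin n → ℝ => quadVal A x := by
    unfold quadVal dotProduct Matrix.mulVec dotProduct
    fun_prop
  have hs : IsCompact {x : Fin n → ℝ | ∑ i, x i ^ 2 = 1} := by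
    refine Metric.isCompact_of_isClosed_isBounded (isClosed_eq (by fun_prop) continuous_const) ?_
    refine (Metric.isBounded_closedBall (x := (0 : Fin n → ℝ)) (r := 1)).subset fun x hx => ?_
    rw [mem_closedBall_zero_iff, pi_norm_le_iff_of_nonneg zero_le_one]
    intro i
    have h1 : x i ^ 2 ≤ 1 := by
      rw [← Set.mem_ofPred_eq.mp hx]
      exact Finset.single_le_sum (f := fun i => x i ^ 2) (fun j _ => sq_nonneg _)
        (Finset.mem_univ i)
    rw [Real.norm_eq_abs]
    exact (sq_le_one_iff_abs_le_one _).1 h1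
  have hpos : ∀ x : Fin n → ℝ, x ≠ 0 → 0 < quadVal A x := fun x hx => by
    simpa [quadVal] using hA.dotProduct_mulVec_pos hx
  have hsq : ∀ x : Fin n → ℝ, x ≠ 0 → 0 < ∑ i, x i ^ 2 := fun x hx => by
    obtain ⟨i, hi⟩ := Function.ne_iff.1 hx
    exact Finset.sum_pos' (fun j _ => sq_nonneg _) ⟨i, Finset.mem_univ i, by
      have : x i ≠ 0 := hi
      positivity⟩
  have hm : ∀ x : Fin n → ℝ, x ≠ 0 →
      (Real.sqrt (∑ i, x i ^ 2))⁻¹ • x ∈ {x : Fin n → ℝ | ∑ i, x i ^ 2 = 1} := fun x hx => by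
    simp only [Set.mem_ofPred_eq, Pi.smul_apply, smul_eq_mul, mul_pow, ← Finset.mul_sum, inv_pow,
      Real.sq_sqrt (hsq x hx).le]
    exact inv_mul_cancel₀ (hsq x hx).ne'
  rcases Set.eq_empty_or_nonempty {x : Fin n → ℝ | ∑ i, x i ^ 2 = 1} with he | hne
  -- The sphere is empty only for `n = 0`.
  · refine ⟨1, one_pos, fun x => ?_⟩
    by_cases hx : x = 0
    · simp [hx, quadVal]
    · have := hm x hx
      rw [he] at this
      exact this.elim
  · obtain ⟨x₀, hx₀, hmin⟩ := hs.exists_isMinOn hne hc.continuousOn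
    have hx₀0 : x₀ ≠ 0 := by
      rintro rfl
      simp at hx₀
    refine ⟨quadVal A x₀, hpos _ hx₀0, fun x => ?_⟩
    by_cases hx : x = 0
    · simp [hx, quadVal]
    have h1 := hmin (hm x hx)
    simp only [Set.mem_ofPred_eq, quadVal_smul, inv_pow, Real.sq_sqrt (hsq x hx).le] at h1
    rw [inv_mul_eq_div, le_div_iff₀ (hsq x hx)] at h1
    exact h1

theorem summable_pi_prod {f : ℤ → ℝ} (h0 : ∀ k, 0 ≤ f k) (hf : Summable f) :
    Summable fun m : Fin n → ℤ => ∏ i, f (m i) := by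
  classical
  refine summable_of_sum_le (c := (∑' k, f k) ^ n) (fun m => Finset.prod_nonneg fun i _ => h0 _)
    fun u => ?_
  let t : Finset ℤ := Finset.univ.biUnion fun i : Fin n => u.image fun m => m i
  calc ∑ m ∈ u, ∏ i, f (m i) ≤ ∑ m ∈ Fintype.piFinset fun _ : Fin n => t, ∏ i, f (m i) := by
        refine Finset.sum_le_sum_of_subset_of_nonneg (fun m hm => ?_)
          fun m _ _ => Finset.prod_nonneg fun i _ => h0 _
        rw [Fintype.mem_piFinset]
        intro i
        exact Finset.mem_biUnion.2 ⟨i, Finset.mem_univ i, Finset.mem_image_of_mem _ hm⟩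
    _ = ∏ _i : Fin n, ∑ k ∈ t, f k := (Finset.prod_univ_sum (fun _ => t) fun _ => f).symm
    _ ≤ ∏ _i : Fin n, ∑' k, f k := Finset.prod_le_prod
        (fun i _ => Finset.sum_nonneg fun k _ => h0 k) fun i _ => hf.sum_le_tsum _ fun k _ => h0 k
    _ = (∑' k, f k) ^ n := by simp

/-- The majorant `exp(-T ∑ mᵢ² + S ∑ |mᵢ|)` of all Gaussian series over `ℤⁿ`. -/
def gaussBound (T S : ℝ) (m : Fin n → ℤ) : ℝ :=
  Real.exp (-(T * ∑ i, (m i : ℝ) ^ 2) + S * ∑ i, |(m i : ℝ)|)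

theorem summable_gaussBound {T : ℝ} (hT : 0 < T) (S : ℝ) :
    Summable (gaussBound (n := n) T S) := by
  have h := summable_pow_mul_jacobiTheta₂_term_bound (S / (2 * Real.pi)) (T := T / Real.pi)
    (by positivity) 0
  refine (summable_pi_prod (n := n) (fun k => by positivity) h).congr fun m => ?_
  rw [gaussBound, Finset.mul_sum, Finset.mul_sum, ← Finset.sum_neg_distrib,
    ← Finset.sum_add_distrib, Real.exp_sum]
  refine Finset.prod_congr rfl fun i _ => ?_
  rw [pow_zero, one_mul]
  congr 1
  rw [Int.cast_abs]
  field_simp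
  ring

theorem abs_dot_le {S : ℝ} (y x : Fin n → ℝ) (hy : ∀ i, |y i| ≤ S) :
    |y ⬝ᵥ x| ≤ S * ∑ i, |x i| := by
  rw [dotProduct, Finset.mul_sum]
  refine (Finset.abs_sum_le_sum_abs _ _).trans (Finset.sum_le_sum fun i _ => ?_)
  rw [abs_mul]
  exact mul_le_mul_of_nonneg_right (hy i) (abs_nonneg _)

theorem re_dot_toC (c : Fin n → ℂ) (x : Fin n → ℝ) :
    (c ⬝ᵥ toC x).re = (fun i => (c i).re) ⬝ᵥ x := by
  simp [dotProduct]

open scoped MatrixOrder Matrix.Norms.L2Operator in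
theorem exists_transpose_mul_self {A : Matrix (Fin n) (Fin n) ℝ} (hA : A.PosDef) :
    ∃ B : Matrix (Fin n) (Fin n) ℝ, A = B.transpose * B ∧ B.det ≠ 0 := by
  obtain ⟨B, hB⟩ := CStarAlgebra.nonneg_iff_eq_star_mul_self.mp hA.posSemidef.nonneg
  refine ⟨B, hB, fun h => ?_⟩
  have := hA.det_pos.ne'
  rw [hB, Matrix.det_mul, h, mul_zero] at this
  exact this rfl

/-- The Gaussian integral attached to a positive definite matrix. The positive constant `k`, which is
`det(A)^{-1/2}`, is left implicit: only its independence of `b` and `c` matters. -/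
theorem gaussian_integral {A : Matrix (Fin n) (Fin n) ℝ} (hA : A.PosDef) :
    ∃ k : ℝ, ∀ (b : ℂ), 0 < b.re → ∀ c : Fin n → ℂ,
      Integrable (fun u : Fin n → ℝ => Complex.exp (-b * quadVal A u + c ⬝ᵥ toC u)) ∧
      ∫ u : Fin n → ℝ, Complex.exp (-b * quadVal A u + c ⬝ᵥ toC u) =
        k * ((Real.pi / b) ^ (n / 2 : ℂ) *
          Complex.exp (quadVal (A⁻¹.map Complex.ofReal) c / (4 * b))) := by
  obtain ⟨B, rfl, hdet⟩ := exists_transpose_mul_self hA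
  have hBu : IsUnit B.det := hdet.isUnit
  refine ⟨|B.det⁻¹|, fun b hb c => ?_⟩
  let c' : Fin n → ℂ := Matrix.vecMul c (B⁻¹.map Complex.ofReal)
  let g : (Fin n → ℝ) → ℂ := fun v => Complex.exp (-b * ∑ i, (v i : ℂ) ^ 2 + ∑ i, c' i * v i)
  have hmap := Real.map_matrix_volume_pi_eq_smul_volume_pi hdet
  have hcomp : ∀ u, Complex.exp (-b * quadVal (B.transpose * B) u + c ⬝ᵥ toC u) =
      g (Matrix.toLin' B u) := by
    intro u
    have h1 : quadVal (B.transpose * B) u = ∑ i, (B.mulVec u i) ^ 2 := by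
      rw [quadVal, ← Matrix.mulVec_mulVec, Matrix.dotProduct_mulVec, Matrix.vecMul_transpose]
      simp [dotProduct, sq]
    have h2 : c ⬝ᵥ toC u = c' ⬝ᵥ toC (B.mulVec u) := by
      rw [← map_ofReal_mulVec, Matrix.dotProduct_mulVec, Matrix.vecMul_vecMul]
      have hone : B⁻¹.map Complex.ofReal * B.map Complex.ofReal = 1 := by
        change B⁻¹.map Complex.ofRealHom * B.map Complex.ofRealHom = 1
        rw [← Matrix.map_mul, Matrix.nonsing_inv_mul _ hBu]
        simp
      rw [hone, Matrix.vecMul_one]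
    rw [h1, h2]
    simp only [g, Matrix.toLin'_apply, dotProduct]
    push_cast
    rfl
  have hemb : MeasurableEmbedding (Matrix.toLin' B) := by
    have : Function.Injective (Matrix.toLin' B) := Matrix.mulVec_injective_of_det_ne_zero hdet
    exact (LinearMap.continuous_of_finiteDimensional _).measurableEmbedding this
  have hquad : ∑ i, c' i ^ 2 = quadVal ((B.transpose * B)⁻¹.map Complex.ofReal) c := by
    have hinv : (B.transpose * B)⁻¹.map Complex.ofReal =
        B⁻¹.map Complex.ofReal * (B⁻¹.map Complex.ofReal).transpose := by
      rw [Matrix.mul_inv_rev, ← Matrix.transpose_nonsing_inv, ← Matrix.transpose_map]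
      exact Matrix.map_mul (f := Complex.ofRealHom)
    rw [hinv, quadVal, ← Matrix.mulVec_mulVec, Matrix.dotProduct_mulVec, Matrix.mulVec_transpose]
    simp only [dotProduct, sq]
    rfl
  have hgi : Integrable g := GaussianFourier.integrable_cexp_neg_mul_sum_add hb c'
  simp_rw [hcomp]
  refine ⟨?_, ?_⟩
  · rw [← Function.comp_def g, ← hemb.integrable_map_iff, hmap]
    exact hgi.smul_measure (by simp)
  · rw [← hemb.integral_map (g := g), hmap, integral_smul_measure,
      GaussianFourier.integral_cexp_neg_mul_sum_add hb c', hquad,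
      ENNReal.toReal_ofReal (abs_nonneg _)]
    simp

theorem norm_gaussian_le {A : Matrix (Fin n) (Fin n) ℝ} {δ : ℝ}
    (hδ : ∀ x : Fin n → ℝ, δ * ∑ i, x i ^ 2 ≤ quadVal A x) {b : ℂ} (hb : 0 < b.re) {c : Fin n → ℂ}
    {S : ℝ} (hc : ∀ i, |(c i).re| ≤ S) (u : Fin n → ℝ) :
    ‖Complex.exp (-b * quadVal A u + c ⬝ᵥ toC u)‖ ≤
      Real.exp (-(b.re * δ * ∑ i, u i ^ 2) + S * ∑ i, |u i|) := by
  rw [Complex.norm_exp, Real.exp_le_exp, Complex.add_re, re_dot_toC, Complex.re_mul_ofReal,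
    Complex.neg_re, neg_mul, mul_assoc]
  refine add_le_add (neg_le_neg (mul_le_mul_of_nonneg_left (hδ u) hb.le)) ?_
  exact (le_abs_self _).trans (abs_dot_le _ _ hc)

/-- A Gaussian is uniformly majorized on the translates of a ball by a summable sequence. -/
theorem gaussian_majorant {A : Matrix (Fin n) (Fin n) ℝ} (hA : A.PosDef) {b : ℂ} (hb : 0 < b.re)
    (c : Fin n → ℂ) (R : ℝ) : ∃ g : (Fin n → ℤ) → ℝ, Summable g ∧
      ∀ (x : Fin n → ℝ) (m : Fin n → ℤ), ‖x‖ ≤ R →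
        ‖Complex.exp (-b * quadVal A (x + fun i => (m i : ℝ)) +
          c ⬝ᵥ toC (x + fun i => (m i : ℝ)))‖ ≤ g m := by
  obtain ⟨δ, hδ, hδA⟩ := exists_lower_bound hA
  obtain ⟨S, hS⟩ : ∃ S, ∀ i, |(c i).re| ≤ S :=
    ⟨∑ i, |(c i).re|, fun i => Finset.single_le_sum (f := fun i => |(c i).re|)
      (fun _ _ => abs_nonneg _) (Finset.mem_univ i)⟩
  have hT : 0 < b.re * δ / 2 := by positivity
  obtain ⟨K, hK⟩ : ∃ K, K = ∑ _i : Fin n, (b.re * δ * R ^ 2 + |S| * R) := ⟨_, rfl⟩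
  refine ⟨fun m => Real.exp K * gaussBound (b.re * δ / 2) |S| m,
    (summable_gaussBound hT |S|).mul_left _, fun x m hx => ?_⟩
  refine (norm_gaussian_le hδA hb (fun i => (hS i).trans (le_abs_self S)) _).trans ?_
  change _ ≤ Real.exp K * Real.exp (-(b.re * δ / 2 * ∑ i, (m i : ℝ) ^ 2) + |S| * ∑ i, |(m i : ℝ)|)
  rw [← Real.exp_add, Real.exp_le_exp]
  rw [hK]
  simp only [Finset.mul_sum, ← Finset.sum_neg_distrib, ← Finset.sum_add_distrib]
  refine Finset.sum_le_sum fun i _ => ?_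
  have hxi : |x i| ≤ R := (norm_le_pi_norm x i).trans hx
  have h1 : (m i : ℝ) ^ 2 / 2 - R ^ 2 ≤ (x i + m i) ^ 2 := by
    have h0 : x i ^ 2 ≤ R ^ 2 := sq_le_sq' (abs_le.1 hxi).1 (abs_le.1 hxi).2
    have h0' : (x i + m i) ^ 2 - (m i : ℝ) ^ 2 / 2 + x i ^ 2 = (2 * x i + m i) ^ 2 / 2 := by ring
    have h0'' : 0 ≤ (2 * x i + (m i : ℝ)) ^ 2 / 2 := by positivity
    linarith
  have h2 : |x i + m i| ≤ R + |(m i : ℝ)| := (abs_add_le _ _).trans (by linarith)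
  have h3 := mul_le_mul_of_nonneg_left h1 (by positivity : 0 ≤ b.re * δ)
  have h4 := mul_le_mul_of_nonneg_left h2 (abs_nonneg S)
  simp only [Pi.add_apply]
  linarith

theorem summable_gaussian {A : Matrix (Fin n) (Fin n) ℝ} (hA : A.PosDef) {b : ℂ} (hb : 0 < b.re)
    (c : Fin n → ℂ) : Summable fun m : Fin n → ℤ =>
      Complex.exp (-b * quadVal A (fun i => (m i : ℝ)) + c ⬝ᵥ fun i => (m i : ℂ)) := by
  obtain ⟨g, hg, hgb⟩ := gaussian_majorant hA hb c 0
  refine Summable.of_norm_bounded hg fun m => ?_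
  have := hgb 0 m (by simp)
  rwa [zero_add, toC_intCast] at this

theorem quadVal_add {R : Type*} [CommRing R] {A : Matrix (Fin n) (Fin n) R} (hA : A.IsSymm)
    (x y : Fin n → R) :
    quadVal A (x + y) = quadVal A x + 2 * (A.mulVec y ⬝ᵥ x) + quadVal A y := by
  have h : y ⬝ᵥ A.mulVec x = A.mulVec y ⬝ᵥ x := by
    rw [Matrix.dotProduct_mulVec, ← Matrix.mulVec_transpose, hA]
  simp only [quadVal, Matrix.mulVec_add, dotProduct_add, add_dotProduct, h,
    dotProduct_comm x (A.mulVec y)]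
  ring

/-- Poisson summation for Gaussian functions, with a constant `k` that depends only on `A`. -/
theorem gaussian_poisson {A : Matrix (Fin n) (Fin n) ℝ} (hA : A.PosDef) :
    ∃ k : ℝ, ∀ (b : ℂ), 0 < b.re → ∀ w : Fin n → ℂ,
      ∑' m : Fin n → ℤ,
          Complex.exp (-b * quadVal (A.map Complex.ofReal) ((fun i => (m i : ℂ)) + w)) =
        k * (Real.pi / b) ^ (n / 2 : ℂ) *
          ∑' s : Fin n → ℤ, Complex.exp (-(Real.pi ^ 2 / b) * quadVal A⁻¹ (fun i => (s i : ℝ)) +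
            2 * Real.pi * Complex.I * ((fun i => (s i : ℂ)) ⬝ᵥ w)) := by
  obtain ⟨k, hk⟩ := gaussian_integral hA
  refine ⟨k, fun b hb w => ?_⟩
  have hb0 : b ≠ 0 := fun h => by simp [h] at hb
  have hsymmR : A.IsSymm := hA.isHermitian
  have hsymm : (A.map Complex.ofReal).IsSymm := by
    rw [Matrix.IsSymm, ← Matrix.transpose_map, hsymmR]
  have hsymm' : (A⁻¹.map Complex.ofReal).IsSymm := by
    have : A⁻¹.IsSymm := hA.inv.isHermitian
    rw [Matrix.IsSymm, ← Matrix.transpose_map, this]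
  have hinv : (A⁻¹.map Complex.ofReal) * (A.map Complex.ofReal) = 1 := by
    change A⁻¹.map Complex.ofRealHom * A.map Complex.ofRealHom = 1
    rw [← Matrix.map_mul, Matrix.nonsing_inv_mul _ hA.det_pos.ne'.isUnit]
    simp
  have hquadc : Continuous fun x : Fin n → ℝ => quadVal A x := by
    unfold quadVal dotProduct Matrix.mulVec dotProduct
    fun_prop
  let c : Fin n → ℂ := (-2 * b) • (A.map Complex.ofReal).mulVec w
  let C : ℂ := Complex.exp (-b * quadVal (A.map Complex.ofReal) w)
  let f : (Fin n → ℝ) → ℂ := fun u => C * Complex.exp (-b * quadVal A u + c ⬝ᵥ toC u)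
  have hf : ∀ u : Fin n → ℝ,
      f u = Complex.exp (-b * quadVal (A.map Complex.ofReal) (toC u + w)) := by
    intro u
    simp only [f, C, c]
    rw [quadVal_add hsymm, quadVal_ofReal, ← Complex.exp_add]
    congr 1
    rw [smul_dotProduct, smul_eq_mul]
    ring
  have hfc : Continuous f := by
    refine continuous_const.mul (Complex.continuous_exp.comp ?_)
    refine (continuous_const.mul (Complex.continuous_ofReal.comp hquadc)).add ?_
    unfold dotProduct toC
    fun_prop
  have hint : ∀ s : Fin n → ℤ,
      ∫ u : Fin n → ℝ, e (-((fun i => (s i : ℂ)) ⬝ᵥ fun i => (u i : ℂ))) * f u =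
      k * (Real.pi / b) ^ (n / 2 : ℂ) *
        Complex.exp (-(Real.pi ^ 2 / b) * quadVal A⁻¹ (fun i => (s i : ℝ)) +
            2 * Real.pi * Complex.I * ((fun i => (s i : ℂ)) ⬝ᵥ w)) := by
    intro s
    let c' : Fin n → ℂ := c + (-2 * Real.pi * Complex.I) • toC fun i => (s i : ℝ)
    have h1 : ∀ u : Fin n → ℝ, e (-((fun i => (s i : ℂ)) ⬝ᵥ fun i => (u i : ℂ))) * f u =
        C * Complex.exp (-b * quadVal A u + c' ⬝ᵥ toC u) := by
      intro u
      simp only [f, e, c', add_dotProduct, smul_dotProduct, smul_eq_mul]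
      rw [mul_left_comm, ← Complex.exp_add]
      congr 2
      rw [toC_intCast, show (fun i => (u i : ℂ)) = toC u from rfl]
      ring
    simp_rw [h1]
    rw [integral_const_mul, (hk b hb c').2, quadVal_add hsymm', quadVal_smul,
      quadVal_smul, quadVal_ofReal]
    have h2 : quadVal (A⁻¹.map Complex.ofReal) ((A.map Complex.ofReal).mulVec w) =
        quadVal (A.map Complex.ofReal) w := by
      rw [quadVal, Matrix.mulVec_mulVec, hinv, Matrix.one_mulVec, dotProduct_comm]
      rfl
    have h3 : (A⁻¹.map Complex.ofReal).mulVec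
        ((-2 * Real.pi * Complex.I) • toC fun i => (s i : ℝ)) ⬝ᵥ c =
        (4 * Real.pi * Complex.I * b) * ((fun i => (s i : ℂ)) ⬝ᵥ w) := by
      simp only [c, Matrix.mulVec_smul, smul_dotProduct, dotProduct_smul, smul_eq_mul]
      rw [Matrix.dotProduct_mulVec, ← Matrix.mulVec_transpose, hsymm, Matrix.mulVec_mulVec,
        mul_eq_one_comm.1 hinv, Matrix.one_mulVec]
      simp only [toC_intCast]
      ring
    rw [h2, h3, mul_left_comm, mul_left_comm C, ← Complex.exp_add, mul_assoc (k : ℂ)]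
    congr 3
    field_simp
    linear_combination (4 * Real.pi ^ 2 * (quadVal A⁻¹ fun i => (s i : ℝ)) : ℂ) * Complex.I_sq
  have hsum : Summable fun s : Fin n → ℤ =>
      Complex.exp (-(Real.pi ^ 2 / b) * quadVal A⁻¹ (fun i => (s i : ℝ)) +
            2 * Real.pi * Complex.I * ((fun i => (s i : ℂ)) ⬝ᵥ w)) := by
    have hre : 0 < ((Real.pi : ℂ) ^ 2 / b).re := by
      rw [show (Real.pi : ℂ) ^ 2 / b = ((Real.pi ^ 2 : ℝ) : ℂ) * b⁻¹ by push_cast; rfl,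
        Complex.re_ofReal_mul, Complex.inv_re]
      have := Complex.normSq_pos.2 hb0
      positivity
    refine (summable_gaussian hA.inv hre ((2 * Real.pi * Complex.I) • w)).congr fun s => ?_
    rw [smul_dotProduct, smul_eq_mul, dotProduct_comm w]
  have hpois := poisson_summation hfc ((hk b hb c).1.const_mul C) (fun R => ?_) ?_
  · simp_rw [hint, hf] at hpois
    rw [tsum_mul_left] at hpois
    simp_rw [toC_intCast] at hpois
    exact hpois
  · obtain ⟨g, hg, hgb⟩ := gaussian_majorant hA hb c R
    refine ⟨fun m => ‖C‖ * g m, hg.mul_left _, fun x m hx => ?_⟩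
    rw [norm_mul]
    exact mul_le_mul_of_nonneg_left (hgb x m hx) (norm_nonneg _)
  · simp_rw [hint]
    exact hsum.mul_left _

end Gauss

/-! ### Theta series -/

namespace HalfIntegralForm

variable {n : ℕ} (F : HalfIntegralForm n)

theorem posDef_toMatrix : F.toMatrix.PosDef := F.posDef.smul (by norm_num)

theorem isSymm_toMatrix : F.toMatrix.IsSymm := F.posDef_toMatrix.isHermitian

theorem isSymm_toMatrixC : F.toMatrixC.IsSymm := by
  rw [toMatrixC, Matrix.IsSymm, ← Matrix.transpose_map, F.isSymm_toMatrix]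

theorem isSymm_inv : F.toMatrix⁻¹.IsSymm := F.posDef_toMatrix.inv.isHermitian

/-- The number `¼ F⁻¹[r]`, whose class modulo `1` is the discriminant form. -/
def dualForm (r : Fin n → ℤ) : ℝ := 1 / 4 * quadVal F.toMatrix⁻¹ (fun i => (r i : ℝ))

/-- The vector `½ F⁻¹ r`; the scalar product with it is the bilinear form of `dualForm`. -/
def dualVec (r : Fin n → ℤ) : Fin n → ℝ := (1 / 2 : ℝ) • F.toMatrix⁻¹.mulVec fun i => (r i : ℝ)

theorem discForm_mk (r : Fin n → ℤ) :
    F.discForm (Submodule.Quotient.mk r) = (F.dualForm r : UnitAddCircle) := rfl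

theorem eCircle_discForm_mk (r : Fin n → ℤ) :
    eCircle (F.discForm (Submodule.Quotient.mk r)) = e (F.dualForm r) := by
  rw [discForm_mk, eCircle_coe]

theorem dualForm_add (r s : Fin n → ℤ) :
    F.dualForm (r + s) = F.dualForm r + F.dualForm s + F.dualVec s ⬝ᵥ (fun i => (r i : ℝ)) := by
  have h : (fun i => ((r + s) i : ℝ)) = (fun i => (r i : ℝ)) + fun i => (s i : ℝ) := by
    ext; simp
  rw [dualForm, h, quadVal_add F.isSymm_inv, dualForm, dualForm, dualVec, smul_dotProduct,
    smul_eq_mul]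
  ring

theorem bilin_mk (r s : Fin n → ℤ) :
    bilin F.discForm (Submodule.Quotient.mk r) (Submodule.Quotient.mk s) =
      ((F.dualVec s ⬝ᵥ (fun i => (r i : ℝ)) : ℝ) : UnitAddCircle) := by
  rw [bilin, ← Submodule.Quotient.mk_add, discForm_mk, discForm_mk, discForm_mk, dualForm_add,
    ← AddCircle.coe_sub, ← AddCircle.coe_sub]
  congr 1
  ring

theorem doubleR_mulVec_intCast (l : Fin n → ℤ) :
    F.doubleR.mulVec (fun i => (l i : ℝ)) = fun i => ((F.double.mulVec l i : ℤ) : ℝ) := by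
  ext i
  simp [doubleR, Matrix.mulVec, dotProduct]

theorem dualVec_add_double (r l : Fin n → ℤ) :
    F.dualVec (r + F.double.mulVec l) = F.dualVec r + fun i => (l i : ℝ) := by
  have h : (fun i => ((r + F.double.mulVec l) i : ℝ)) =
      (fun i => (r i : ℝ)) + F.doubleR.mulVec fun i => (l i : ℝ) := by
    rw [doubleR_mulVec_intCast]
    ext
    simp
  rw [dualVec, h, Matrix.mulVec_add, inv_mulVec, smul_add, smul_smul, dualVec]
  norm_num

theorem dualForm_add_double (r l : Fin n → ℤ) :
    F.dualForm (r + F.double.mulVec l) = F.dualForm r +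
      (fun i => (r i : ℝ)) ⬝ᵥ (fun i => (l i : ℝ)) + quadVal F.toMatrix (fun i => (l i : ℝ)) := by
  have h : (fun i => ((r + F.double.mulVec l) i : ℝ)) =
      (fun i => (r i : ℝ)) + F.doubleR.mulVec fun i => (l i : ℝ) := by
    rw [doubleR_mulVec_intCast]
    ext
    simp
  rw [dualForm, h, quadVal_inv_add, dualForm, doubleR_eq]
  simp only [quadVal, Matrix.smul_mulVec, dotProduct_smul, smul_eq_mul]
  ring

theorem mk_add_double (r l : Fin n → ℤ) :
    (Submodule.Quotient.mk (r + F.double.mulVec l) : F.Disc) = Submodule.Quotient.mk r := by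
  rw [Submodule.Quotient.eq]
  exact ⟨l, by simp⟩

theorem toMatrix_mulVec_dualVec (r : Fin n → ℤ) :
    F.toMatrix.mulVec (F.dualVec r) = (1 / 2 : ℝ) • fun i => (r i : ℝ) := by
  rw [dualVec, Matrix.mulVec_smul, Matrix.mulVec_mulVec, Matrix.mul_nonsing_inv _ F.isUnit_det,
    Matrix.one_mulVec]

/-- Completing the square: `F[½F⁻¹r - z] = ¼F⁻¹[r] - rᵗz + F[z]`. -/
theorem quadVal_dualVec_sub (r : Fin n → ℤ) (z : Fin n → ℂ) :
    quadVal F.toMatrixC (toC (F.dualVec r) - z) =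
      F.dualForm r - (fun i => (r i : ℂ)) ⬝ᵥ z + quadVal F.toMatrixC z := by
  have h1 : F.toMatrixC.mulVec (toC (F.dualVec r)) = (1 / 2 : ℂ) • fun i => (r i : ℂ) := by
    rw [toMatrixC, map_ofReal_mulVec, toMatrix_mulVec_dualVec]
    ext
    simp
  have h2 : quadVal F.toMatrixC (toC (F.dualVec r)) = F.dualForm r := by
    rw [toMatrixC, quadVal_ofReal, quadVal, toMatrix_mulVec_dualVec, dualForm, dualVec,
      smul_dotProduct, dotProduct_smul, dotProduct_comm, quadVal]
    push_cast
    simp only [smul_eq_mul]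
    push_cast
    ring
  have h3 : quadVal F.toMatrixC (-z) = quadVal F.toMatrixC z := by
    simp [quadVal, Matrix.mulVec_neg]
  rw [sub_eq_neg_add, quadVal_add F.isSymm_toMatrixC, h1, h2, h3, smul_dotProduct, dotProduct_neg,
    smul_eq_mul]
  ring

theorem dualForm_neg (r : Fin n → ℤ) : F.dualForm (-r) = F.dualForm r := by
  rw [dualForm, dualForm, show (fun i => ((-r) i : ℝ)) = (-1 : ℝ) • fun i => (r i : ℝ) by ext; simp,
    quadVal_smul]
  ring

theorem exists_dualForm_lower_bound :
    ∃ δ : ℝ, 0 < δ ∧ ∀ r : Fin n → ℤ, δ * ∑ i, (r i : ℝ) ^ 2 ≤ F.dualForm r := by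
  obtain ⟨δ, hδ, h⟩ := exists_lower_bound F.posDef_toMatrix.inv
  refine ⟨1 / 4 * δ, by positivity, fun r => ?_⟩
  rw [dualForm, mul_assoc]
  exact mul_le_mul_of_nonneg_left (h _) (by norm_num)

theorem dualForm_nonneg (r : Fin n → ℤ) : 0 ≤ F.dualForm r := by
  obtain ⟨δ, hδ, h⟩ := F.exists_dualForm_lower_bound
  exact le_trans (by positivity) (h r)

end HalfIntegralForm

section Theta

variable {n : ℕ} (F : HalfIntegralForm n)

/-- The general term of the theta series. -/
def thetaTerm (τ : ℂ) (z : Fin n → ℂ) (r : Fin n → ℤ) : ℂ :=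
  e (τ * F.dualForm r + (fun i => (r i : ℂ)) ⬝ᵥ z)

theorem theta_eq_tsum (x : F.Disc) (τ : ℍ) (z : Fin n → ℂ) :
    theta F x τ z = ∑' r : {r : Fin n → ℤ // (Submodule.Quotient.mk r : F.Disc) = x},
      thetaTerm F τ z r.1 := rfl

theorem summable_thetaTerm (τ : ℍ) (z : Fin n → ℂ) : Summable (thetaTerm F τ z) := by
  have hb : 0 < (-(2 * Real.pi * Complex.I * τ / 4) : ℂ).re := by
    have : (-(2 * Real.pi * Complex.I * τ / 4) : ℂ).re = Real.pi / 2 * τ.im := by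
      simp
      ring
    rw [this]
    have := τ.im_pos
    positivity
  refine (summable_gaussian F.posDef_toMatrix.inv hb ((2 * Real.pi * Complex.I) • z)).congr
    fun r => ?_
  rw [thetaTerm, e, HalfIntegralForm.dualForm, smul_dotProduct, smul_eq_mul, dotProduct_comm z]
  congr 1
  push_cast
  ring

theorem hasSum_theta (x : F.Disc) (τ : ℍ) (z : Fin n → ℂ) :
    HasSum (fun r : {r : Fin n → ℤ // (Submodule.Quotient.mk r : F.Disc) = x} =>
      thetaTerm F τ z r.1) (theta F x τ z) :=
  ((summable_thetaTerm F τ z).subtype _).hasSum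

/-- A linear combination of the theta series, as a Fourier series in `z`. -/
theorem hasSum_theta_combination (h : F.Disc → ℂ) (τ : ℍ) (z : Fin n → ℂ) :
    HasSum (fun r : Fin n → ℤ => h (Submodule.Quotient.mk r) * thetaTerm F τ z r)
      (∑ x, h x * theta F x τ z) := by
  classical
  have h1 : ∀ x, HasSum (fun r : Fin n → ℤ =>
      h x * if (Submodule.Quotient.mk r : F.Disc) = x then thetaTerm F τ z r else 0)
        (h x * theta F x τ z) := fun x => by
    refine HasSum.mul_left _ ((Function.Injective.hasSum_iff
      (g := (Subtype.val : {r : Fin n → ℤ // (Submodule.Quotient.mk r : F.Disc) = x} → _))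
      Subtype.val_injective fun r hr => if_neg fun h => hr ⟨⟨r, h⟩, rfl⟩).1 ?_)
    refine (hasSum_theta F x τ z).congr_fun fun r => ?_
    rw [Function.comp_apply, if_pos r.2]
  have h2 := hasSum_sum (s := Finset.univ) fun x _ => h1 x
  have h3 : (fun r : Fin n → ℤ => h (Submodule.Quotient.mk r) * thetaTerm F τ z r) =
      fun r => ∑ x, h x *
        if (Submodule.Quotient.mk r : F.Disc) = x then thetaTerm F τ z r else 0 := by
    funext r
    simp
  rw [h3]
  exact h2

theorem thetaTerm_ofReal (τ : ℂ) (x : Fin n → ℝ) (r : Fin n → ℤ) :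
    thetaTerm F τ (toC x) r =
      e (τ * F.dualForm r) * e ((fun i => (r i : ℂ)) ⬝ᵥ fun i => (x i : ℂ)) := by
  rw [thetaTerm, e_add]
  rfl

/-- The coefficients of a series in the functions `e(τ ¼F⁻¹[r] + rᵗz)` are unique, by uniqueness of
Fourier coefficients in `z`. -/
theorem thetaTerm_coeff_unique {τ : ℂ} {b b' : (Fin n → ℤ) → ℂ} {f : (Fin n → ℂ) → ℂ}
    (hb : ∀ z, HasSum (fun r => b r * thetaTerm F τ z r) (f z))
    (hb' : ∀ z, HasSum (fun r => b' r * thetaTerm F τ z r) (f z)) : b = b' := by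
  have h : ∀ c : (Fin n → ℤ) → ℂ, (∀ z, HasSum (fun r => c r * thetaTerm F τ z r) (f z)) →
      ∀ x : Fin n → ℝ, HasSum (fun r => c r * e (τ * F.dualForm r) *
        e ((fun i => (r i : ℂ)) ⬝ᵥ fun i => (x i : ℂ))) (f (toC x)) := fun c hc x =>
    (hc (toC x)).congr_fun fun r => by rw [thetaTerm_ofReal, mul_assoc]
  have h1 := fourier_coeff_unique (h b hb) (h b' hb')
  ext r
  exact mul_right_cancel₀ (e_ne_zero _) (congrFun h1 r)

theorem theta_linearIndependent {h h' : F.Disc → ℂ} (τ : ℍ)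
    (hh : ∀ z, ∑ y, h y * theta F y τ z = ∑ y, h' y * theta F y τ z) : h = h' := by
  ext x
  obtain ⟨r, rfl⟩ := Submodule.Quotient.mk_surjective _ x
  exact congrFun (thetaTerm_coeff_unique F (hasSum_theta_combination F h τ)
    fun z => hh z ▸ hasSum_theta_combination F h' τ z) r

/-- The lattice action permutes the terms of the theta series. -/
theorem thetaTerm_add_double (τ : ℂ) (z : Fin n → ℂ) (l m r : Fin n → ℤ) :
    e (τ * quadVal F.toMatrixC (fun i => (l i : ℂ)) +
      2 * (z ⬝ᵥ F.toMatrixC.mulVec (fun i => (l i : ℂ)))) *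
        thetaTerm F τ (fun i => z i + l i * τ + m i) r =
      thetaTerm F τ z (r + F.double.mulVec l) := by
  rw [thetaTerm, thetaTerm, ← e_add, F.dualForm_add_double]
  have h1 : (fun i => (r i : ℂ)) ⬝ᵥ (fun i => z i + l i * τ + m i) =
      (fun i => (r i : ℂ)) ⬝ᵥ z + τ * ((fun i => (r i : ℂ)) ⬝ᵥ fun i => (l i : ℂ)) +
        ((r ⬝ᵥ m : ℤ) : ℂ) := by
    simp only [dotProduct, Finset.mul_sum, ← Finset.sum_add_distrib]
    push_cast
    simp only [← Finset.sum_add_distrib]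
    exact Finset.sum_congr rfl fun i _ => by ring
  have h2 : (fun i => ((r + F.double.mulVec l) i : ℂ)) ⬝ᵥ z = (fun i => (r i : ℂ)) ⬝ᵥ z +
      2 * (z ⬝ᵥ F.toMatrixC.mulVec fun i => (l i : ℂ)) := by
    have : (fun i => ((r + F.double.mulVec l) i : ℂ)) =
        (fun i => (r i : ℂ)) + (2 : ℂ) • F.toMatrixC.mulVec fun i => (l i : ℂ) := by
      ext i
      simp only [HalfIntegralForm.toMatrixC, HalfIntegralForm.toMatrix, Matrix.mulVec, dotProduct,
        Pi.add_apply, Pi.smul_apply, Matrix.map_apply, Matrix.smul_apply, smul_eq_mul]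
      push_cast
      rw [Finset.mul_sum]
      congr 1
      exact Finset.sum_congr rfl fun j _ => by ring
    rw [this, add_dotProduct, smul_dotProduct, smul_eq_mul, dotProduct_comm z]
  have h3 : (quadVal F.toMatrixC fun i => (l i : ℂ)) =
      ((quadVal F.toMatrix fun i => (l i : ℝ) : ℝ) : ℂ) := by
    rw [← quadVal_ofReal, toC_intCast]
    rfl
  have h4 : (((fun i => (r i : ℝ)) ⬝ᵥ fun i => (l i : ℝ) : ℝ) : ℂ) =
      (fun i => (r i : ℂ)) ⬝ᵥ fun i => (l i : ℂ) := by
    simp [dotProduct]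
  rw [h1, h2, h3, ← add_assoc, ← add_assoc, e_add _ (((r ⬝ᵥ m : ℤ) : ℂ)), e_intCast, mul_one]
  push_cast
  rw [h4]
  congr 1
  ring

theorem latticeSlash_theta (x : F.Disc) (l m : Fin n → ℤ) :
    latticeSlash F l m (theta F x) = theta F x := by
  ext τ z
  rw [latticeSlash, theta_eq_tsum, theta_eq_tsum, smul_eq_mul, ← tsum_mul_left]
  let ε : {r : Fin n → ℤ // (Submodule.Quotient.mk r : F.Disc) = x} ≃
      {r : Fin n → ℤ // (Submodule.Quotient.mk r : F.Disc) = x} :=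
    (Equiv.addRight (F.double.mulVec l)).subtypeEquiv fun r => by
      rw [Equiv.coe_addRight, F.mk_add_double]
  rw [← ε.tsum_eq (fun r => thetaTerm F τ z r.1)]
  refine tsum_congr fun r => ?_
  have hε : (ε r).1 = r.1 + F.double.mulVec l := rfl
  rw [hε, thetaTerm_add_double]

theorem jacobiSlash_T_theta (κ : ℤ) (x : F.Disc) :
    jacobiSlash κ F Mp.T (theta F x) = eCircle (F.discForm x) • theta F x := by
  ext τ z
  have h1 : (Mp.T.mat 1 0 : ℂ) = 0 := by simp [Mp.T, ModularGroup.T]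
  have h2 : autFactor Mp.T.mat τ = 1 := by simp [autFactor, Mp.T, ModularGroup.T]
  have h3 : Mp.T.w τ = 1 := rfl
  rw [jacobiSlash, h1, h2, h3]
  simp only [one_zpow, neg_zero, zero_mul, zero_div, e_zero, mul_one, inv_one, one_smul, one_mul,
    Pi.smul_apply, smul_eq_mul]
  rw [theta_eq_tsum, theta_eq_tsum, ← tsum_mul_left]
  refine tsum_congr fun r => ?_
  obtain ⟨r, rfl⟩ := r
  rw [F.eCircle_discForm_mk, thetaTerm, thetaTerm, show Mp.T.mat = ModularGroup.T from rfl,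
    Mp.coe_T_smul, ← e_add]
  congr 1
  ring

/-- The inversion formula for theta series, up to a constant that does not depend on `x`, `τ` and
`z`. The theta series over the class of `x₀` at `-1/τ` is, up to an exponential factor, the sum of a
Gaussian function over a translate of `ℤⁿ`. -/
theorem jacobiSlash_S_theta : ∃ C : ℂ, ∀ x : F.Disc,
    jacobiSlash (n : ℤ) F Mp.S (theta F x) =
      ∑ y, (C * eCircle (-bilin F.discForm y x)) • theta F y := by
  obtain ⟨k, hk⟩ := gaussian_poisson F.posDef_toMatrix
  let C : ℂ := k * Complex.exp (Complex.log (1 / (2 * Complex.I)) * (n / 2 : ℂ))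
  refine ⟨C, fun x => ?_⟩
  ext τ z
  have hτ0 : (τ : ℂ) ≠ 0 := τ.ne_zero
  have hmat : Mp.S.mat = ModularGroup.S := rfl
  have h1 : (Mp.S.mat 1 0 : ℂ) = 1 := by simp [Mp.S, ModularGroup.S]
  have h2 : autFactor Mp.S.mat τ = τ := by simp [autFactor, Mp.S, ModularGroup.S]
  obtain ⟨x₀, rfl⟩ := Submodule.Quotient.mk_surjective _ x
  set b : ℂ := 2 * Real.pi * Complex.I / τ with hb
  have hbre : 0 < b.re := by
    have : b = ((2 * Real.pi : ℝ) : ℂ) * (Complex.I * (τ : ℂ)⁻¹) := by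
      rw [hb]
      push_cast
      ring
    rw [this, Complex.re_ofReal_mul, Complex.mul_re, Complex.I_re, Complex.I_im, Complex.inv_im,
      zero_mul, zero_sub, one_mul, neg_div, neg_neg]
    have h1 := τ.im_pos
    have h2 := Complex.normSq_pos.2 hτ0
    have h3 := Real.pi_pos
    have h4 : (0 : ℝ) < (τ : ℂ).im := h1
    positivity
  let ε : (Fin n → ℤ) ≃ {r : Fin n → ℤ // (Submodule.Quotient.mk r : F.Disc) =
      Submodule.Quotient.mk x₀} :=
    Equiv.ofBijective (fun m => ⟨x₀ + F.double.mulVec m, F.mk_add_double _ _⟩) <| by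
      refine ⟨fun m m' h => ?_, fun r => ?_⟩
      · have := add_left_cancel (Subtype.ext_iff.1 h)
        exact Matrix.mulVec_injective_of_det_ne_zero F.double_det_ne_zero this
      · obtain ⟨m, hm⟩ := (Submodule.Quotient.eq _).1 r.2
        refine ⟨m, Subtype.ext ?_⟩
        rw [Matrix.mulVecLin_apply] at hm
        simp [hm]
  have hleft : e (-(Mp.S.mat 1 0 : ℂ) * quadVal F.toMatrixC z / autFactor Mp.S.mat τ) *
      theta F (Submodule.Quotient.mk x₀) (Mp.S.mat • τ) ((autFactor Mp.S.mat τ)⁻¹ • z) =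
      ∑' m : Fin n → ℤ, Complex.exp (-b * quadVal (F.toMatrix.map Complex.ofReal)
        ((fun i => (m i : ℂ)) + (toC (F.dualVec x₀) - z))) := by
    rw [theta_eq_tsum, ← ε.tsum_eq, ← tsum_mul_left]
    refine tsum_congr fun m => ?_
    have hvec : (fun i => (m i : ℂ)) + (toC (F.dualVec x₀) - z) =
        toC (F.dualVec (x₀ + F.double.mulVec m)) - z := by
      rw [F.dualVec_add_double]
      ext i
      simp
      ring
    have hε : (ε m).1 = x₀ + F.double.mulVec m := rfl
    have hq := F.quadVal_dualVec_sub (x₀ + F.double.mulVec m) z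
    rw [HalfIntegralForm.toMatrixC] at hq
    rw [hvec, hq, hε, thetaTerm, ← e_add, h1, h2, hmat, Mp.coe_S_smul, dotProduct_smul, smul_eq_mul,
      e, hb, HalfIntegralForm.toMatrixC]
    congr 1
    field_simp
    ring
  have hright : ∑' s : Fin n → ℤ, Complex.exp (-(Real.pi ^ 2 / b) *
        quadVal F.toMatrix⁻¹ (fun i => (s i : ℝ)) +
          2 * Real.pi * Complex.I * ((fun i => (s i : ℂ)) ⬝ᵥ (toC (F.dualVec x₀) - z))) =
      ∑ y, eCircle (-bilin F.discForm y (Submodule.Quotient.mk x₀)) * theta F y τ z := by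
    rw [← (hasSum_theta_combination F (fun y =>
      eCircle (-bilin F.discForm y (Submodule.Quotient.mk x₀))) τ z).tsum_eq,
      ← (Equiv.neg (Fin n → ℤ)).tsum_eq]
    refine tsum_congr fun s => ?_
    rw [F.bilin_mk, ← AddCircle.coe_neg, eCircle_coe, thetaTerm, ← e_add, e, Equiv.neg_apply,
      ← F.dualForm_neg s, HalfIntegralForm.dualForm]
    have h3 : (fun i => ((-s) i : ℂ)) ⬝ᵥ (toC (F.dualVec x₀) - z) =
        -((F.dualVec x₀ ⬝ᵥ fun i => (s i : ℝ) : ℝ) : ℂ) + (fun i => (s i : ℂ)) ⬝ᵥ z := by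
      simp only [dotProduct]
      push_cast
      rw [← Finset.sum_neg_distrib, ← Finset.sum_add_distrib]
      refine Finset.sum_congr rfl fun i _ => ?_
      simp
      ring
    rw [h3]
    congr 1
    rw [hb]
    push_cast
    have hI : (Real.pi : ℂ) ^ 2 / (2 * Real.pi * Complex.I / τ) =
        -(Real.pi * Complex.I * τ / 2) := by
      field_simp
      simp
    rw [hI]
    ring
  -- The arguments of `τ` and `1/(2i)` lie in `(0, π)` and at `-π/2`, so the principal branches of the
  -- powers multiply, and the power of `τ` is that of the chosen root `√τ`.
  have hconst : (Real.pi / b) ^ (n / 2 : ℂ) =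
      Mp.S.w τ ^ (n : ℤ) * Complex.exp (Complex.log (1 / (2 * Complex.I)) * (n / 2 : ℂ)) := by
    have hπb : Real.pi / b = τ * (1 / (2 * Complex.I)) := by
      rw [hb]
      field_simp
    have hne : (1 / (2 * Complex.I) : ℂ) ≠ 0 := by simp
    have harg : (1 / (2 * Complex.I) : ℂ).arg = -(Real.pi / 2) := by
      have : (1 / (2 * Complex.I) : ℂ) = ((1 / 2 : ℝ) : ℂ) * (-Complex.I) := by
        push_cast
        field_simp
        simp
      rw [this, Complex.arg_real_mul _ (by norm_num), Complex.arg_neg_I]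
    have hlog : Complex.log (τ * (1 / (2 * Complex.I))) =
        Complex.log τ + Complex.log (1 / (2 * Complex.I)) := by
      refine (Complex.log_mul_eq_add_log_iff hτ0 hne).2 ?_
      rw [harg]
      have h1 : 0 ≤ (τ : ℂ).arg := Complex.arg_nonneg_iff.2 τ.im_pos.le
      have h2 := Complex.arg_le_pi (τ : ℂ)
      have h3 := Real.pi_pos
      constructor <;> linarith
    rw [hπb, Complex.cpow_def_of_ne_zero (mul_ne_zero hτ0 hne), hlog, add_mul, Complex.exp_add]
    congr 1
    simp only [Mp.S]
    rw [Complex.cpow_def_of_ne_zero hτ0, zpow_natCast, ← Complex.exp_nat_mul]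
    congr 1
    ring
  rw [jacobiSlash, smul_eq_mul, mul_assoc, hleft, hk b hbre, hright, hconst, Finset.sum_apply,
    Finset.sum_apply, zpow_neg]
  have hw := zpow_ne_zero (n : ℤ) (Mp.S.w_ne_zero τ)
  simp only [Pi.smul_apply, smul_eq_mul, Finset.mul_sum, C]
  refine Finset.sum_congr rfl fun y _ => ?_
  field_simp

end Theta

/-! ### The finite quadratic module `D_F` -/

namespace HalfIntegralForm

variable {n : ℕ} (F : HalfIntegralForm n)

theorem dualVec_add (r s : Fin n → ℤ) : F.dualVec (r + s) = F.dualVec r + F.dualVec s := by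
  have h : (fun i => ((r + s) i : ℝ)) = (fun i => (r i : ℝ)) + fun i => (s i : ℝ) := by
    ext; simp
  rw [dualVec, h, Matrix.mulVec_add, smul_add]
  rfl

theorem bilin_comm (x y : F.Disc) : bilin F.discForm x y = bilin F.discForm y x := by
  rw [bilin, bilin, add_comm x y]
  abel

theorem bilin_add_right (x y z : F.Disc) :
    bilin F.discForm x (y + z) = bilin F.discForm x y + bilin F.discForm x z := by
  obtain ⟨x, rfl⟩ := Submodule.Quotient.mk_surjective _ x
  obtain ⟨y, rfl⟩ := Submodule.Quotient.mk_surjective _ y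
  obtain ⟨z, rfl⟩ := Submodule.Quotient.mk_surjective _ z
  rw [← Submodule.Quotient.mk_add, bilin_mk, bilin_mk, bilin_mk, dualVec_add, add_dotProduct,
    AddCircle.coe_add]

theorem bilin_add_left (x y z : F.Disc) :
    bilin F.discForm (x + y) z = bilin F.discForm x z + bilin F.discForm y z := by
  rw [bilin_comm, bilin_add_right, bilin_comm, bilin_comm F z y]

@[simp] theorem bilin_zero_right (x : F.Disc) : bilin F.discForm x 0 = 0 := by
  have := F.bilin_add_right x 0 0
  rwa [add_zero, left_eq_add] at this

@[simp] theorem bilin_zero_left (x : F.Disc) : bilin F.discForm 0 x = 0 := by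
  rw [bilin_comm, bilin_zero_right]

theorem bilin_neg_right (x y : F.Disc) : bilin F.discForm x (-y) = -bilin F.discForm x y := by
  rw [eq_neg_iff_add_eq_zero, ← bilin_add_right, neg_add_cancel, bilin_zero_right]

theorem bilin_neg_left (x y : F.Disc) : bilin F.discForm (-x) y = -bilin F.discForm x y := by
  rw [bilin_comm, bilin_neg_right, bilin_comm]

@[simp] theorem discForm_zero : F.discForm 0 = 0 := by
  have := F.discForm_mk 0
  rw [Submodule.Quotient.mk_zero] at this
  rw [this, dualForm]
  simp [quadVal]

theorem discForm_add (x y : F.Disc) :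
    F.discForm (x + y) = F.discForm x + F.discForm y + bilin F.discForm x y := by
  rw [bilin]
  abel

/-- The discriminant form is nondegenerate. -/
theorem eq_zero_of_bilin_eq_zero {x : F.Disc} (h : ∀ y, bilin F.discForm y x = 0) : x = 0 := by
  obtain ⟨r, rfl⟩ := Submodule.Quotient.mk_surjective _ x
  have h1 : ∀ i, ∃ m : ℤ, (m : ℝ) = F.dualVec r i := fun i => by
    have := h (Submodule.Quotient.mk (Pi.single i 1))
    rw [bilin_mk, AddCircle.coe_eq_zero_iff] at this
    obtain ⟨m, hm⟩ := this
    refine ⟨m, ?_⟩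
    rw [zsmul_eq_mul, mul_one] at hm
    rw [hm, dotProduct, Finset.sum_eq_single i]
    · simp
    · intro j _ hj
      simp [Pi.single_eq_of_ne hj]
    · simp
  choose m hm using h1
  rw [Submodule.Quotient.mk_eq_zero]
  refine ⟨m, ?_⟩
  have h2 : F.doubleR.mulVec (fun i => (m i : ℝ)) = fun i => (r i : ℝ) := by
    rw [show (fun i => (m i : ℝ)) = F.dualVec r from funext hm, dualVec, Matrix.mulVec_smul,
      mulVec_inv, smul_smul]
    norm_num
  rw [doubleR_mulVec_intCast] at h2
  ext i
  have := congrFun h2 i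
  exact_mod_cast this

theorem sum_eCircle_bilin_eq_zero {x : F.Disc} (hx : x ≠ 0) :
    ∑ y, eCircle (bilin F.discForm y x) = 0 := by
  obtain ⟨y₀, hy₀⟩ : ∃ y, bilin F.discForm y x ≠ 0 := by
    by_contra! h
    exact hx (F.eq_zero_of_bilin_eq_zero h)
  have h1 : ∑ y, eCircle (bilin F.discForm y x) =
      eCircle (bilin F.discForm y₀ x) * ∑ y, eCircle (bilin F.discForm y x) := by
    rw [Finset.mul_sum, ← Equiv.sum_comp (Equiv.addLeft y₀)]
    refine Finset.sum_congr rfl fun y _ => ?_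
    rw [Equiv.coe_addLeft, bilin_add_left, eCircle_add]
  have h2 : eCircle (bilin F.discForm y₀ x) ≠ 1 := fun h =>
    hy₀ (eCircle_injective (h.trans eCircle_zero.symm))
  have h3 : (eCircle (bilin F.discForm y₀ x) - 1) * ∑ y, eCircle (bilin F.discForm y x) = 0 := by
    rw [sub_mul, ← h1, one_mul, sub_self]
  exact (mul_eq_zero.1 h3).resolve_left (sub_ne_zero.2 h2)

/-- The absolute value of the Gauss sum of `D_F`. -/
theorem gaussSum_mul_conj :
    (∑ x, eCircle (F.discForm x)) * ∑ x, eCircle (-F.discForm x) = Fintype.card F.Disc := by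
  classical
  have h1 : ∀ y : F.Disc, (∑ x, eCircle (F.discForm x)) * eCircle (-F.discForm y) =
      ∑ d, eCircle (F.discForm d) * eCircle (bilin F.discForm y d) := fun y => by
    rw [← Equiv.sum_comp (Equiv.addLeft y), Finset.sum_mul]
    refine Finset.sum_congr rfl fun d _ => ?_
    rw [Equiv.coe_addLeft, discForm_add, ← eCircle_add, ← eCircle_add]
    congr 1
    abel
  rw [Finset.mul_sum, Finset.sum_congr rfl fun y _ => h1 y, Finset.sum_comm]
  simp_rw [← Finset.mul_sum]
  rw [Finset.sum_eq_single 0]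
  · simp
  · intro d _ hd
    rw [F.sum_eCircle_bilin_eq_zero hd, mul_zero]
  · simp

end HalfIntegralForm

/-! ### The Weil representation -/

section Weil

variable {n : ℕ} (F : HalfIntegralForm n)

theorem jacobiSlash_theta_mul {g h : Mp} {M N : Matrix F.Disc F.Disc ℂ}
    (hM : ∀ x, jacobiSlash (n : ℤ) F g (theta F x) = ∑ y, M x y • theta F y)
    (hN : ∀ x, jacobiSlash (n : ℤ) F h (theta F x) = ∑ y, N x y • theta F y) (x : F.Disc) :
    jacobiSlash (n : ℤ) F (g * h) (theta F x) = ∑ y, (M * N) x y • theta F y := by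
  rw [jacobiSlash_mul, hM, jacobiSlash_sum]
  simp_rw [jacobiSlash_smul, hN, Matrix.mul_apply, Finset.sum_smul, Finset.smul_sum, smul_smul]
  rw [Finset.sum_comm]

/-- The span of the theta series is stable under `Mp₂(ℤ)`. -/
theorem exists_matrix_jacobiSlash_theta (g : Mp) : ∃ M : Matrix F.Disc F.Disc ℂ,
    ∀ x, jacobiSlash (n : ℤ) F g (theta F x) = ∑ y, M x y • theta F y := by
  classical
  -- Inverses of the generators are treated separately: `S⁻¹ = S⁷`, and `T` acts diagonally.
  let P : Mp → Prop := fun g => ∃ M : Matrix F.Disc F.Disc ℂ,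
    ∀ x, jacobiSlash (n : ℤ) F g (theta F x) = ∑ y, M x y • theta F y
  have hone : P 1 := ⟨1, fun x => by simp [Matrix.one_apply, ite_smul]⟩
  have hmul : ∀ g h, P g → P h → P (g * h) := by
    rintro g h ⟨M, hM⟩ ⟨N, hN⟩
    exact ⟨M * N, jacobiSlash_theta_mul F hM hN⟩
  have hpow : ∀ g, P g → ∀ k : ℕ, P (g ^ k) := fun g hg k => by
    induction k with
    | zero => rw [pow_zero]; exact hone
    | succ k ih => rw [pow_succ]; exact hmul _ _ ih hg
  have hT : P Mp.T := ⟨Matrix.diagonal fun x => eCircle (F.discForm x), fun x => by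
    rw [jacobiSlash_T_theta]
    simp [Matrix.diagonal_apply, ite_smul]⟩
  have hT' : P Mp.T⁻¹ := ⟨Matrix.diagonal fun x => (eCircle (F.discForm x))⁻¹, fun x => by
    have h : jacobiSlash (n : ℤ) F Mp.T⁻¹ (eCircle (F.discForm x) • theta F x) = theta F x := by
      rw [← jacobiSlash_T_theta F (n : ℤ), ← jacobiSlash_mul, mul_inv_cancel, jacobiSlash_one]
    rw [jacobiSlash_smul] at h
    simp only [Matrix.diagonal_apply, ite_smul, zero_smul, Finset.sum_ite_eq, Finset.mem_univ,
      if_true]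
    rw [eq_inv_smul_iff₀ (eCircle_ne_zero _), h]⟩
  have hS : P Mp.S := by
    obtain ⟨C, hC⟩ := jacobiSlash_S_theta F
    exact ⟨fun x y => C * eCircle (-bilin F.discForm y x), hC⟩
  have hS' : P Mp.S⁻¹ := by
    rw [inv_eq_of_mul_eq_one_right (b := Mp.S ^ 7) (by rw [← pow_succ', Mp.S_pow_eight])]
    exact hpow _ hS 7
  have hall : P g ∧ P g⁻¹ := by
    have hg : g ∈ Subgroup.closure {Mp.S, Mp.T} := Mp.closure_S_T ▸ Subgroup.mem_top g
    induction hg using Subgroup.closure_induction with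
    | mem x hx =>
      rcases hx with rfl | rfl
      · exact ⟨hS, hS'⟩
      · exact ⟨hT, hT'⟩
    | one => exact ⟨hone, by rw [inv_one]; exact hone⟩
    | mul x y _ _ hx hy => exact ⟨hmul _ _ hx.1 hy.1, by rw [mul_inv_rev]; exact hmul _ _ hy.2 hx.2⟩
    | inv x _ hx => exact ⟨hx.2, by rw [inv_inv]; exact hx.1⟩
  exact hall.1

/-- A matrix is determined by its action on the theta series, which are linearly independent. -/
theorem matrix_ext_of_theta {M N : Matrix F.Disc F.Disc ℂ}
    (h : ∀ x, ∑ y, M x y • theta F y = ∑ y, N x y • theta F y) : M = N := by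
  ext x y
  refine congrFun (theta_linearIndependent F UpperHalfPlane.I fun z => ?_) y
  have := congrFun (congrFun (h x) UpperHalfPlane.I) z
  simpa using this

open Classical in
/-- The matrices by which `Mp₂(ℤ)` acts on the theta series. -/
def thetaMatrix : Mp →* Matrix F.Disc F.Disc ℂ where
  toFun g := (exists_matrix_jacobiSlash_theta F g).choose
  map_one' := matrix_ext_of_theta F fun x => by
    rw [← (exists_matrix_jacobiSlash_theta F 1).choose_spec x, jacobiSlash_one]
    simp [Matrix.one_apply, ite_smul]
  map_mul' g h := matrix_ext_of_theta F fun x => by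
    rw [← (exists_matrix_jacobiSlash_theta F (g * h)).choose_spec x]
    exact jacobiSlash_theta_mul F (exists_matrix_jacobiSlash_theta F g).choose_spec
      (exists_matrix_jacobiSlash_theta F h).choose_spec x

theorem jacobiSlash_theta (g : Mp) (x : F.Disc) :
    jacobiSlash (n : ℤ) F g (theta F x) = ∑ y, thetaMatrix F g x y • theta F y :=
  (exists_matrix_jacobiSlash_theta F g).choose_spec x

open Classical in
theorem thetaMatrix_T :
    thetaMatrix F Mp.T = Matrix.diagonal fun x => eCircle (F.discForm x) :=
  matrix_ext_of_theta F fun x => by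
    rw [← jacobiSlash_theta, jacobiSlash_T_theta]
    simp [Matrix.diagonal_apply, ite_smul]

/-- The constant `C` in the inversion formula is determined by the relation `T S T S T = S`: its
matrix entry at `(0, 0)` reads `C² ∑ e(Q(x)) = C`. -/
theorem thetaMatrix_S (x y : F.Disc) : thetaMatrix F Mp.S x y =
    gaussSum F.discForm * ((Real.sqrt (Fintype.card F.Disc) : ℝ) : ℂ)⁻¹ *
      eCircle (-bilin F.discForm x y) := by
  classical
  obtain ⟨C, hC⟩ := jacobiSlash_S_theta F
  have hS : thetaMatrix F Mp.S = fun x y => C * eCircle (-bilin F.discForm y x) :=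
    matrix_ext_of_theta F fun x => by rw [← jacobiSlash_theta, hC]
  have hC0 : C ≠ 0 := by
    rintro rfl
    have h1 : thetaMatrix F Mp.S * thetaMatrix F Mp.S⁻¹ = 1 := by
      rw [← map_mul, mul_inv_cancel, map_one]
    have h2 : thetaMatrix F Mp.S = 0 := by
      rw [hS]
      ext
      simp
    rw [h2, zero_mul] at h1
    have := congrFun (congrFun h1 0) 0
    simp at this
  have hS' : ∀ x y, thetaMatrix F Mp.S x y = C * eCircle (-bilin F.discForm y x) := fun x y =>
    congrFun (congrFun hS x) y
  have hrel := congrArg (fun g => thetaMatrix F g 0 0) Mp.S_T_S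
  simp only [map_mul] at hrel
  rw [thetaMatrix_T, Matrix.mul_diagonal, Matrix.diagonal_mul, Matrix.mul_apply] at hrel
  simp only [Matrix.mul_diagonal, hS', F.discForm_zero, F.bilin_zero_left, F.bilin_zero_right,
    neg_zero, eCircle_zero, mul_one, one_mul] at hrel
  have hG : C * ∑ x, eCircle (F.discForm x) = 1 := by
    refine mul_left_cancel₀ hC0 ?_
    rw [mul_one]
    refine Eq.trans ?_ hrel
    rw [Finset.mul_sum, Finset.mul_sum]
    exact Finset.sum_congr rfl fun x _ => by ring
  have hcard : (Fintype.card F.Disc : ℂ) ≠ 0 := by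
    exact_mod_cast Fintype.card_ne_zero
  have hsqrt : ((Real.sqrt (Fintype.card F.Disc) : ℝ) : ℂ) ^ 2 = Fintype.card F.Disc := by
    rw [← Complex.ofReal_pow, Real.sq_sqrt (Nat.cast_nonneg _)]
    simp
  have hval : C = gaussSum F.discForm * ((Real.sqrt (Fintype.card F.Disc) : ℝ) : ℂ)⁻¹ := by
    rw [gaussSum, mul_right_comm, ← sq, inv_pow, hsqrt]
    rw [eq_inv_mul_iff_mul_eq₀ hcard, ← F.gaussSum_mul_conj, mul_right_comm, mul_comm _ C, hG,
      one_mul]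
  rw [hS', ← hval, F.bilin_comm y x]

open Classical in
/-- The Weil representation as the transpose of the action on theta series. -/
def thetaWeilRep : Representation ℂ Mp (F.Disc →₀ ℂ) :=
  ((Matrix.toLinAlgEquiv (Finsupp.basisSingleOne (R := ℂ) (ι := F.Disc))) :
    Matrix F.Disc F.Disc ℂ →* _).comp (thetaMatrix F)

theorem thetaWeilRep_single (g : Mp) (y : F.Disc) :
    thetaWeilRep F g (Finsupp.single y 1) = ∑ x, thetaMatrix F g x y • Finsupp.single x 1 := by
  classical
  have := Matrix.toLinAlgEquiv_self (Finsupp.basisSingleOne (R := ℂ) (ι := F.Disc))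
    (thetaMatrix F g) y
  simpa [thetaWeilRep] using this

theorem isWeilRep_thetaWeilRep : IsWeilRep F.discForm (thetaWeilRep F) where
  T_apply x := by
    classical
    rw [thetaWeilRep_single, thetaMatrix_T]
    simp only [Matrix.diagonal_apply, ite_smul, zero_smul, Finset.sum_ite_eq', Finset.mem_univ,
      if_true]
  S_apply x := by
    rw [thetaWeilRep_single, Finset.smul_sum]
    refine Finset.sum_congr rfl fun y _ => ?_
    rw [thetaMatrix_S, smul_smul]

theorem IsWeilRep.unique {M : Type*} [AddCommGroup M] [Fintype M] {Q : M → UnitAddCircle}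
    {W W' : Representation ℂ Mp (M →₀ ℂ)} (h : IsWeilRep Q W) (h' : IsWeilRep Q W') : W = W' := by
  refine MonoidHom.eq_of_eqOn_dense Mp.closure_S_T ?_
  rintro g (rfl | rfl)
  · refine Finsupp.lhom_ext' fun x => LinearMap.ext_ring ?_
    simp only [LinearMap.comp_apply, Finsupp.lsingle_apply]
    rw [h.S_apply, h'.S_apply]
  · refine Finsupp.lhom_ext' fun x => LinearMap.ext_ring ?_
    simp only [LinearMap.comp_apply, Finsupp.lsingle_apply]
    rw [h.T_apply, h'.T_apply]

theorem isWeilRep_weilRep : IsWeilRep F.discForm (weilRep F) := by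
  have h : ∃ W, IsWeilRep F.discForm W := ⟨_, isWeilRep_thetaWeilRep F⟩
  rw [weilRep, dif_pos h]
  exact h.choose_spec

theorem weilRep_single (g : Mp) (y : F.Disc) :
    weilRep F g (Finsupp.single y 1) = ∑ x, thetaMatrix F g x y • Finsupp.single x 1 := by
  rw [(isWeilRep_weilRep F).unique (isWeilRep_thetaWeilRep F), thetaWeilRep_single]

theorem thetaMap_injective : Function.Injective (thetaMap F) := by
  intro v v' h
  refine Finsupp.lhom_ext' fun x => LinearMap.ext_ring ?_
  refine congrFun (theta_linearIndependent F (h := fun x => v (Finsupp.single x 1))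
    (h' := fun x => v' (Finsupp.single x 1)) UpperHalfPlane.I fun z => ?_) x
  have := congrFun (congrFun h UpperHalfPlane.I) z
  simpa [thetaMap] using this

theorem thetaMap_apply (v : Module.Dual ℂ (F.Disc →₀ ℂ)) (τ : ℍ) (z : Fin n → ℂ) :
    thetaMap F v τ z = ∑ x, v (Finsupp.single x 1) * theta F x τ z := by
  simp [thetaMap]

theorem range_thetaMap : LinearMap.range (thetaMap F) = thetaSpan F := by
  classical
  refine le_antisymm ?_ (Submodule.span_le.2 ?_)
  · rintro _ ⟨v, rfl⟩
    exact Submodule.sum_mem _ fun x _ => Submodule.smul_mem _ _ (Submodule.subset_span ⟨x, rfl⟩)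
  · rintro _ ⟨x, rfl⟩
    refine ⟨Finsupp.lapply x, ?_⟩
    ext τ z
    rw [thetaMap_apply, Finset.sum_eq_single x]
    · simp
    · intro y _ hy
      simp [hy]
    · simp

theorem thetaMap_rightDual (g : Mp) (v : Module.Dual ℂ (F.Disc →₀ ℂ)) :
    thetaMap F (rightDual (weilRep F) (MulOpposite.op g) v) =
      jacobiSlash (n : ℤ) F g (thetaMap F v) := by
  have h1 : thetaMap F v = ∑ x, v (Finsupp.single x 1) • theta F x := rfl
  rw [h1, jacobiSlash_sum]
  simp_rw [jacobiSlash_smul, jacobiSlash_theta, Finset.smul_sum, smul_smul]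
  rw [Finset.sum_comm]
  change ∑ y, v (weilRep F g (Finsupp.single y 1)) • theta F y = _
  refine Finset.sum_congr rfl fun y _ => ?_
  rw [weilRep_single, map_sum, Finset.sum_smul]
  refine Finset.sum_congr rfl fun x _ => ?_
  rw [map_smul, smul_eq_mul, mul_comm]

end Weil

/-! ### Finiteness of the image of the Weil representation -/

section FiniteImage

theorem finite_setOf_pow_eq_one {N : ℕ} (hN : 0 < N) : {z : ℂ | z ^ N = 1}.Finite := by
  refine (Polynomial.nthRootsFinset N (1 : ℂ)).finite_toSet.subset fun z hz => ?_
  exact (Polynomial.mem_nthRootsFinset hN 1).2 hz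

theorem finiteIndex_ker_of_finite_range {G M : Type*} [Group G] [Monoid M] (f : G →* M)
    (h : (Set.range f).Finite) : f.ker.FiniteIndex := by
  have h1 : f.ker = f.toHomUnits.ker := by
    ext g
    rw [MonoidHom.mem_ker, MonoidHom.mem_ker, Units.ext_iff]
    rfl
  have h2 : Finite f.toHomUnits.range := by
    refine Set.Finite.to_subtype (s := (f.toHomUnits.range : Set Mˣ)) ?_
    refine Set.Finite.of_finite_image (f := Units.val) (h.subset ?_) Units.val_injective.injOn
    rintro _ ⟨_, ⟨g, rfl⟩, rfl⟩
    exact ⟨g, rfl⟩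
  rw [h1]
  exact Subgroup.finiteIndex_ker _

variable {n : ℕ} (F : HalfIntegralForm n)

theorem HalfIntegralForm.bilin_self (x : F.Disc) :
    bilin F.discForm x x = (2 : ℕ) • F.discForm x := by
  obtain ⟨r, rfl⟩ := Submodule.Quotient.mk_surjective _ x
  rw [bilin_mk, discForm_mk, ← AddCircle.coe_nsmul, dualForm, dualVec, quadVal, smul_dotProduct,
    dotProduct_comm]
  congr 1
  simp only [smul_eq_mul, nsmul_eq_mul]
  push_cast
  ring

/-- The exponent of the discriminant group kills the bilinear form, so all values `e(Q(x))` and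
`e(B(x, y))` are roots of unity of order dividing `2|D_F|`. -/
theorem HalfIntegralForm.card_nsmul_bilin (x y : F.Disc) :
    Fintype.card F.Disc • bilin F.discForm x y = 0 := by
  let φ : F.Disc →+ UnitAddCircle := AddMonoidHom.mk' (bilin F.discForm x) (F.bilin_add_right x)
  change Fintype.card F.Disc • φ y = 0
  rw [← map_nsmul, card_nsmul_eq_zero, map_zero]

theorem eCircle_bilin_pow (x y : F.Disc) :
    eCircle (bilin F.discForm x y) ^ (2 * Fintype.card F.Disc) = 1 := by
  rw [pow_mul', ← eCircle_nsmul, F.card_nsmul_bilin, eCircle_zero, one_pow]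

theorem eCircle_discForm_pow (x : F.Disc) :
    eCircle (F.discForm x) ^ (2 * Fintype.card F.Disc) = 1 := by
  rw [pow_mul, ← eCircle_nsmul, ← F.bilin_self, ← eCircle_nsmul, F.card_nsmul_bilin, eCircle_zero]

open Classical in
/-- The Heisenberg operator given by the translation by `p.1` and the character `e(B(p.2, ·))`. -/
def heisenberg (p : F.Disc × F.Disc) : Matrix F.Disc F.Disc ℂ :=
  Matrix.of fun x y => if y = x + p.1 then eCircle (bilin F.discForm p.2 x) else 0

open Classical in
theorem heisenberg_mul_apply (p : F.Disc × F.Disc) (A : Matrix F.Disc F.Disc ℂ) (x y : F.Disc) :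
    (heisenberg F p * A) x y = eCircle (bilin F.discForm p.2 x) * A (x + p.1) y := by
  rw [Matrix.mul_apply, Finset.sum_eq_single (x + p.1)]
  · simp [heisenberg]
  · intro z _ hz
    simp [heisenberg, hz]
  · simp

open Classical in
theorem mul_heisenberg_apply (p : F.Disc × F.Disc) (A : Matrix F.Disc F.Disc ℂ) (x y : F.Disc) :
    (A * heisenberg F p) x y = A x (y - p.1) * eCircle (bilin F.discForm p.2 (y - p.1)) := by
  rw [Matrix.mul_apply, Finset.sum_eq_single (y - p.1)]
  · simp [heisenberg]
  · intro z _ hz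
    have : y ≠ z + p.1 := fun h => hz (by rw [h, add_sub_cancel_right])
    simp [heisenberg, this]
  · simp

open Classical in
/-- A matrix that commutes with all Heisenberg operators is a scalar matrix. -/
theorem eq_smul_one_of_commute_heisenberg {A : Matrix F.Disc F.Disc ℂ}
    (hA : ∀ p, heisenberg F p * A = A * heisenberg F p) : A = A 0 0 • 1 := by
  have hdiag : ∀ x, A x x = A 0 0 := fun x => by
    have := congrFun (congrFun (hA (x, 0)) 0) x
    rw [heisenberg_mul_apply, mul_heisenberg_apply] at this
    simpa using this
  ext x y
  rcases eq_or_ne x y with rfl | hxy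
  · simp [hdiag]
  · have h1 : ∃ b, bilin F.discForm b (x - y) ≠ 0 := by
      by_contra! h
      exact hxy (sub_eq_zero.1 (F.eq_zero_of_bilin_eq_zero h))
    obtain ⟨b, hb⟩ := h1
    have h2 := congrFun (congrFun (hA (0, b)) x) y
    rw [heisenberg_mul_apply, mul_heisenberg_apply] at h2
    simp only [add_zero, sub_zero] at h2
    have h3 : (eCircle (bilin F.discForm b x) - eCircle (bilin F.discForm b y)) * A x y = 0 := by
      rw [sub_mul, h2]
      ring
    have h4 : eCircle (bilin F.discForm b x) ≠ eCircle (bilin F.discForm b y) := fun h => by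
      refine hb ?_
      rw [sub_eq_add_neg, F.bilin_add_right, F.bilin_neg_right, eCircle_injective h,
        add_neg_cancel]
    have h5 := (mul_eq_zero.1 h3).resolve_left (sub_ne_zero.2 h4)
    simp [h5, hxy]

open Classical in
/-- The matrices that normalize, up to roots of unity, the set of the Heisenberg operators. -/
def heisenbergNormalizer : Submonoid (Matrix F.Disc F.Disc ℂ) where
  carrier := {A | ∀ p, ∃ q, ∃ ζ : ℂ, ζ ^ (2 * Fintype.card F.Disc) = 1 ∧
    A * heisenberg F p = ζ • (heisenberg F q * A)}
  one_mem' p := ⟨p, 1, one_pow _, by simp⟩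
  mul_mem' := by
    rintro A B hA hB p
    obtain ⟨q, ζ, hζ, hq⟩ := hB p
    obtain ⟨r, ξ, hξ, hr⟩ := hA q
    refine ⟨r, ζ * ξ, by rw [mul_pow, hζ, hξ, one_mul], ?_⟩
    rw [mul_assoc, hq, Matrix.mul_smul, ← mul_assoc, hr, Matrix.smul_mul, smul_smul, mul_assoc]

open Classical in
theorem thetaMatrix_T_pow : thetaMatrix F Mp.T ^ (2 * Fintype.card F.Disc) = 1 := by
  classical
  rw [thetaMatrix_T, Matrix.diagonal_pow, ← Matrix.diagonal_one]
  congr 1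
  ext x
  exact eCircle_discForm_pow F x

open Classical in
/-- A submonoid suffices here because both generators act by matrices of finite order. -/
theorem thetaMatrix_mem_of_generators {X : Submonoid (Matrix F.Disc F.Disc ℂ)}
    (hS : thetaMatrix F Mp.S ∈ X) (hT : thetaMatrix F Mp.T ∈ X) (g : Mp) : thetaMatrix F g ∈ X := by
  have h8 : thetaMatrix F Mp.S ^ 8 = 1 := by rw [← map_pow, Mp.S_pow_eight, map_one]
  have hinv : ∀ (g : Mp) (k : ℕ), k ≠ 0 → thetaMatrix F g ^ k = 1 → thetaMatrix F g ∈ X →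
      thetaMatrix F g⁻¹ ∈ X := fun g k hk h1 hg => by
    have : thetaMatrix F g⁻¹ = thetaMatrix F g ^ (k - 1) := by
      obtain ⟨k, rfl⟩ := Nat.exists_eq_succ_of_ne_zero hk
      have h2 : thetaMatrix F g⁻¹ * thetaMatrix F g = 1 := by
        rw [← map_mul, inv_mul_cancel, map_one]
      calc thetaMatrix F g⁻¹ = thetaMatrix F g⁻¹ * (thetaMatrix F g * thetaMatrix F g ^ k) := by
            rw [← pow_succ', h1, mul_one]
        _ = _ := by rw [← mul_assoc, h2, one_mul]; rfl
    rw [this]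
    exact pow_mem hg _
  have hg : g ∈ Subgroup.closure {Mp.S, Mp.T} := Mp.closure_S_T ▸ Subgroup.mem_top g
  suffices thetaMatrix F g ∈ X ∧ thetaMatrix F g⁻¹ ∈ X from this.1
  induction hg using Subgroup.closure_induction with
  | mem x hx =>
    rcases hx with rfl | rfl
    · exact ⟨hS, hinv _ 8 (by norm_num) h8 hS⟩
    · exact ⟨hT, hinv _ _ (mul_ne_zero two_ne_zero Fintype.card_ne_zero) (thetaMatrix_T_pow F) hT⟩
  | one => rw [inv_one, map_one]; exact ⟨X.one_mem, X.one_mem⟩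
  | mul x y _ _ hx hy =>
    rw [mul_inv_rev, map_mul, map_mul]
    exact ⟨X.mul_mem hx.1 hy.1, X.mul_mem hy.2 hx.2⟩
  | inv x _ hx => exact ⟨hx.2, by rw [inv_inv]; exact hx.1⟩

open Classical in
theorem thetaMatrix_mem_heisenbergNormalizer (g : Mp) :
    thetaMatrix F g ∈ heisenbergNormalizer F := by
  classical
  refine thetaMatrix_mem_of_generators F ?_ ?_ g
  · rintro ⟨a, b⟩
    refine ⟨(-b, a), eCircle (-bilin F.discForm b a), ?_, ?_⟩
    · rw [← F.bilin_neg_right]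
      exact eCircle_bilin_pow F _ _
    · ext x y
      rw [mul_heisenberg_apply, Matrix.smul_apply, heisenberg_mul_apply, thetaMatrix_S,
        thetaMatrix_S, smul_eq_mul]
      have h : eCircle (-bilin F.discForm x (y - a)) * eCircle (bilin F.discForm b (y - a)) =
          eCircle (-bilin F.discForm b a) * (eCircle (bilin F.discForm a x) *
            eCircle (-bilin F.discForm (x + -b) y)) := by
        rw [← eCircle_add, ← eCircle_add, ← eCircle_add]
        congr 1
        simp only [sub_eq_add_neg, F.bilin_add_right, F.bilin_add_left, F.bilin_neg_right,
          F.bilin_neg_left, F.bilin_comm a x]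
        abel
      linear_combination (gaussSum F.discForm *
        ((Real.sqrt (Fintype.card F.Disc) : ℝ) : ℂ)⁻¹) * h
  · rintro ⟨a, b⟩
    refine ⟨(a, b - a), (eCircle (F.discForm a))⁻¹, by rw [inv_pow, eCircle_discForm_pow, inv_one],
      ?_⟩
    rw [eq_inv_smul_iff₀ (eCircle_ne_zero _)]
    ext x y
    rw [Matrix.smul_apply, mul_heisenberg_apply, heisenberg_mul_apply, thetaMatrix_T,
      Matrix.diagonal_apply, Matrix.diagonal_apply]
    by_cases hy : x + a = y
    · subst hy
      simp only [add_sub_cancel_right, if_true, smul_eq_mul]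
      rw [← eCircle_add, ← eCircle_add, ← eCircle_add, F.discForm_add, sub_eq_add_neg b,
        F.bilin_add_left, F.bilin_neg_left, F.bilin_comm a x]
      congr 1
      abel
    · have hy' : x ≠ y - a := fun h => hy (by rw [h, sub_add_cancel])
      simp [hy, hy']

open Classical in
theorem det_thetaMatrix_pow (g : Mp) :
    (thetaMatrix F g).det ^ (8 * (2 * Fintype.card F.Disc)) = 1 := by
  let X : Submonoid (Matrix F.Disc F.Disc ℂ) := MonoidHom.mker
    ((powMonoidHom (8 * (2 * Fintype.card F.Disc))).comp Matrix.detMonoidHom)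
  refine thetaMatrix_mem_of_generators F (X := X) ?_ ?_ g
  · change (thetaMatrix F Mp.S).det ^ _ = 1
    rw [← Matrix.det_pow, ← map_pow, pow_mul, Mp.S_pow_eight, one_pow, map_one, Matrix.det_one]
  · change (thetaMatrix F Mp.T).det ^ _ = 1
    rw [← Matrix.det_pow, pow_mul', thetaMatrix_T_pow, one_pow, Matrix.det_one]

/-- The Weil representation has finite image: `Mp₂(ℤ)` permutes, by conjugation, a finite set of
multiples of the Heisenberg operators, and an element that acts trivially on them is a scalar whose
determinant is a root of unity of bounded order. -/
theorem finite_range_thetaMatrix : (Set.range (thetaMatrix F)).Finite := by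
  classical
  have hcard : 0 < 2 * Fintype.card F.Disc := Nat.mul_pos two_pos Fintype.card_pos
  set U : Set ℂ := {z : ℂ | z ^ (2 * Fintype.card F.Disc) = 1} with hU
  set U' : Set ℂ := {z : ℂ | z ^ (Fintype.card F.Disc * (8 * (2 * Fintype.card F.Disc))) = 1}
    with hU'
  have hUf : U.Finite := finite_setOf_pow_eq_one hcard
  have hUf' : U'.Finite := finite_setOf_pow_eq_one
    (Nat.mul_pos Fintype.card_pos (Nat.mul_pos (by norm_num) hcard))
  have hinv : ∀ g, thetaMatrix F g * thetaMatrix F g⁻¹ = 1 := fun g => by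
    rw [← map_mul, mul_inv_cancel, map_one]
  have hnon : ∀ g, (thetaMatrix F g)⁻¹ = thetaMatrix F g⁻¹ := fun g =>
    Matrix.inv_eq_right_inv (hinv g)
  let conj : Matrix F.Disc F.Disc ℂ → F.Disc × F.Disc → Matrix F.Disc F.Disc ℂ :=
    fun A p => A * heisenberg F p * A⁻¹
  -- The matrix `A` is mapped to its conjugates `A P A⁻¹` of the Heisenberg operators `P`; the image is
  -- finite, and two matrices in the same fibre differ by a scalar in the finite set `U'`.
  refine Set.Finite.of_finite_fibers conj ?_ ?_
  · have hX : (Set.image2 (fun (ζ : ℂ) q => ζ • heisenberg F q) U Set.univ).Finite :=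
      hUf.image2 _ Set.finite_univ
    refine (Set.Finite.pi' (t := fun _ : F.Disc × F.Disc =>
      Set.image2 (fun (ζ : ℂ) q => ζ • heisenberg F q) U Set.univ) fun _ => hX).subset ?_
    rintro _ ⟨_, ⟨g, rfl⟩, rfl⟩ p
    obtain ⟨q, ζ, hζ, hq⟩ := thetaMatrix_mem_heisenbergNormalizer F g p
    refine ⟨ζ, hζ, q, Set.mem_univ _, ?_⟩
    simp only [conj]
    rw [hq, hnon, Matrix.smul_mul, mul_assoc, hinv, mul_one]
  · rintro _ ⟨_, ⟨g, rfl⟩, rfl⟩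
    refine (hUf'.image fun ζ => ζ • thetaMatrix F g).subset ?_
    rintro _ ⟨⟨h, rfl⟩, hh⟩
    have hc : ∀ p, thetaMatrix F h * heisenberg F p * thetaMatrix F h⁻¹ =
        thetaMatrix F g * heisenberg F p * thetaMatrix F g⁻¹ := fun p => by
      have := congrFun hh p
      simp only [conj, hnon] at this
      exact this
    have hcomm : ∀ p, heisenberg F p * thetaMatrix F (g⁻¹ * h) =
        thetaMatrix F (g⁻¹ * h) * heisenberg F p := fun p => by
      have h1 : thetaMatrix F g⁻¹ * thetaMatrix F g = 1 := by
        rw [← map_mul, inv_mul_cancel, map_one]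
      have h2 : thetaMatrix F h⁻¹ * thetaMatrix F h = 1 := by
        rw [← map_mul, inv_mul_cancel, map_one]
      calc heisenberg F p * thetaMatrix F (g⁻¹ * h)
          = (thetaMatrix F g⁻¹ * thetaMatrix F g) * heisenberg F p *
              thetaMatrix F g⁻¹ * thetaMatrix F h := by rw [h1, one_mul, map_mul, mul_assoc]
        _ = thetaMatrix F g⁻¹ * (thetaMatrix F g * heisenberg F p * thetaMatrix F g⁻¹) *
              thetaMatrix F h := by simp only [mul_assoc]
        _ = thetaMatrix F g⁻¹ * thetaMatrix F h * heisenberg F p *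
              (thetaMatrix F h⁻¹ * thetaMatrix F h) := by rw [← hc]; simp only [mul_assoc]
        _ = _ := by rw [h2, mul_one, map_mul]
    have hs := eq_smul_one_of_commute_heisenberg F hcomm
    set ζ := thetaMatrix F (g⁻¹ * h) 0 0
    refine ⟨ζ, ?_, ?_⟩
    · have := det_thetaMatrix_pow F (g⁻¹ * h)
      rw [hs, Matrix.det_smul, Matrix.det_one, mul_one, ← pow_mul] at this
      exact this
    · change ζ • thetaMatrix F g = thetaMatrix F h
      have : thetaMatrix F h = thetaMatrix F g * thetaMatrix F (g⁻¹ * h) := by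
        rw [← map_mul, mul_inv_cancel_left]
      rw [this, hs, Matrix.mul_smul, mul_one]

end FiniteImage

/-! ### Holomorphy of theta series -/

section ThetaAnalysis

theorem hasDerivAt_e (x : ℂ) : HasDerivAt e (2 * Real.pi * Complex.I * e x) x := by
  have := ((hasDerivAt_id x).const_mul (2 * Real.pi * Complex.I)).cexp
  have he : e = fun x => Complex.exp (2 * Real.pi * Complex.I * x) := rfl
  rw [he]
  simpa [mul_comm] using this

variable {n : ℕ} (F : HalfIntegralForm n)

/-- The linear form `(τ, z) ↦ τ ¼F⁻¹[r] + rᵗz`. -/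
def thetaPhase (r : Fin n → ℤ) : (ℂ × (Fin n → ℂ)) →L[ℂ] ℂ :=
  (F.dualForm r : ℂ) • ContinuousLinearMap.fst ℂ ℂ (Fin n → ℂ) +
    ∑ i, (r i : ℂ) • (ContinuousLinearMap.proj i ∘L ContinuousLinearMap.snd ℂ ℂ (Fin n → ℂ))

theorem thetaPhase_apply (r : Fin n → ℤ) (p : ℂ × (Fin n → ℂ)) :
    thetaPhase F r p = p.1 * F.dualForm r + (fun i => (r i : ℂ)) ⬝ᵥ p.2 := by
  simp [thetaPhase, dotProduct, mul_comm p.1]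

theorem norm_thetaPhase_le (r : Fin n → ℤ) :
    ‖thetaPhase F r‖ ≤ F.dualForm r + ∑ i, |(r i : ℝ)| := by
  refine ContinuousLinearMap.opNorm_le_bound _
    (add_nonneg (F.dualForm_nonneg r) (Finset.sum_nonneg fun i _ => abs_nonneg _)) fun p => ?_
  rw [thetaPhase_apply, add_mul]
  refine (norm_add_le _ _).trans (add_le_add ?_ ?_)
  · rw [norm_mul, mul_comm, Complex.norm_real, Real.norm_of_nonneg (F.dualForm_nonneg r)]
    exact mul_le_mul_of_nonneg_left (norm_fst_le p) (F.dualForm_nonneg r)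
  · rw [dotProduct, Finset.sum_mul]
    refine (norm_sum_le _ _).trans (Finset.sum_le_sum fun i _ => ?_)
    rw [norm_mul]
    have h1 : ‖(r i : ℂ)‖ = |(r i : ℝ)| := by
      rw [← Complex.ofReal_intCast, Complex.norm_real, Real.norm_eq_abs]
    rw [h1]
    exact mul_le_mul_of_nonneg_left ((norm_le_pi_norm _ i).trans (norm_snd_le p)) (abs_nonneg _)

/-- A summable majorant for the derivatives of the terms of the theta series. The linear factor
`¼F⁻¹[r] + ∑ |rᵢ|` is absorbed into the exponential by `t ≤ exp t`, at the price of half of the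
exponent. -/
theorem norm_deriv_thetaTerm_le {δ y R : ℝ} (hy : 0 < y) (r : Fin n → ℤ)
    (hδ : δ * ∑ i, (r i : ℝ) ^ 2 ≤ F.dualForm r) {p : ℂ × (Fin n → ℂ)} (h1 : y < p.1.im)
    (h2 : ‖p.2‖ < R) :
    ‖(2 * Real.pi * Complex.I * e (thetaPhase F r p)) • thetaPhase F r‖ ≤
      2 * Real.pi * ((1 / (Real.pi * y) + 1) *
        gaussBound (Real.pi * y * δ) (2 * Real.pi * R + 1) r) := by
  have hπ := Real.pi_pos
  set q := F.dualForm r with hq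
  set s := ∑ i, |(r i : ℝ)| with hs
  have hq0 : 0 ≤ q := F.dualForm_nonneg r
  have hs0 : 0 ≤ s := Finset.sum_nonneg fun i _ => abs_nonneg _
  have him : q * y - R * s ≤ (thetaPhase F r p).im := by
    have h3 : (thetaPhase F r p).im = q * p.1.im + (fun i => (p.2 i).im) ⬝ᵥ fun i => (r i : ℝ) := by
      rw [thetaPhase_apply]
      simp [dotProduct, mul_comm, q]
    have h4 := abs_dot_le (S := R) (fun i => (p.2 i).im) (fun i => (r i : ℝ)) fun i =>
      (Complex.abs_im_le_norm _).trans ((norm_le_pi_norm p.2 i).trans h2.le)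
    have h5 := (abs_le.1 h4).1
    have h6 := mul_le_mul_of_nonneg_left h1.le hq0
    rw [h3]
    linarith
  have hexp : ‖e (thetaPhase F r p)‖ ≤ Real.exp (-(2 * Real.pi * (q * y - R * s))) := by
    rw [norm_e, Real.exp_le_exp]
    have := mul_le_mul_of_nonneg_left him (by positivity : 0 ≤ 2 * Real.pi)
    linarith
  have hG : Real.exp (-(Real.pi * y * q) + (2 * Real.pi * R + 1) * s) ≤
      gaussBound (Real.pi * y * δ) (2 * Real.pi * R + 1) r := by
    rw [gaussBound, Real.exp_le_exp]
    have := mul_le_mul_of_nonneg_left hδ (by positivity : 0 ≤ Real.pi * y)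
    rw [← mul_assoc] at this
    linarith
  have hA : Real.exp (-(2 * Real.pi * (q * y - R * s))) * q ≤ 1 / (Real.pi * y) *
      Real.exp (-(Real.pi * y * q) + (2 * Real.pi * R + 1) * s) := by
    have h3 : q ≤ 1 / (Real.pi * y) * Real.exp (Real.pi * y * q) := by
      rw [one_div, ← div_eq_inv_mul, le_div_iff₀ (by positivity)]
      have := Real.add_one_le_exp (Real.pi * y * q)
      linarith
    calc _ ≤ Real.exp (-(2 * Real.pi * (q * y - R * s))) *
          (1 / (Real.pi * y) * Real.exp (Real.pi * y * q)) :=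
          mul_le_mul_of_nonneg_left h3 (Real.exp_nonneg _)
      _ = 1 / (Real.pi * y) * Real.exp (-(2 * Real.pi * (q * y - R * s)) + Real.pi * y * q) := by
          rw [Real.exp_add]
          ring
      _ ≤ _ := by
          refine mul_le_mul_of_nonneg_left (Real.exp_le_exp.2 ?_) (by positivity)
          linarith
  have hB : Real.exp (-(2 * Real.pi * (q * y - R * s))) * s ≤
      Real.exp (-(Real.pi * y * q) + (2 * Real.pi * R + 1) * s) := by
    have h3 : s ≤ Real.exp s := by linarith [Real.add_one_le_exp s]
    have h4 : 0 ≤ Real.pi * y * q := by positivity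
    calc _ ≤ Real.exp (-(2 * Real.pi * (q * y - R * s))) * Real.exp s :=
          mul_le_mul_of_nonneg_left h3 (Real.exp_nonneg _)
      _ ≤ _ := by
          rw [← Real.exp_add, Real.exp_le_exp]
          linarith
  rw [norm_smul, norm_mul, mul_assoc]
  have h2π : ‖(2 * Real.pi * Complex.I : ℂ)‖ = 2 * Real.pi := by
    simp [abs_of_pos hπ]
  rw [h2π]
  refine mul_le_mul_of_nonneg_left ?_ (by positivity)
  calc _ ≤ Real.exp (-(2 * Real.pi * (q * y - R * s))) * (q + s) :=
        mul_le_mul hexp (norm_thetaPhase_le F r) (norm_nonneg _) (Real.exp_nonneg _)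
    _ ≤ (1 / (Real.pi * y) + 1) * Real.exp (-(Real.pi * y * q) + (2 * Real.pi * R + 1) * s) := by
        rw [mul_add, add_mul, one_mul]
        exact add_le_add hA hB
    _ ≤ _ := mul_le_mul_of_nonneg_left hG (by positivity)

/-- Theta series are holomorphic in `τ` and `z` jointly. -/
theorem differentiableOn_theta (x : F.Disc) : DifferentiableOn ℂ
    (fun p : ℂ × (Fin n → ℂ) => theta F x (UpperHalfPlane.ofComplex p.1) p.2)
    {p | 0 < p.1.im} := by
  rintro ⟨τ₀, z₀⟩ hτ₀
  obtain ⟨δ, hδ, hq⟩ := F.exists_dualForm_lower_bound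
  have hy : 0 < τ₀.im / 2 := half_pos hτ₀
  set s : Set (ℂ × (Fin n → ℂ)) := {τ | τ₀.im / 2 < τ.im} ×ˢ Metric.ball 0 (‖z₀‖ + 1) with hs
  have hso : IsOpen s := (isOpen_lt continuous_const Complex.continuous_im).prod Metric.isOpen_ball
  have hsc : IsPreconnected s :=
    ((convex_halfSpace_im_gt _).prod (convex_ball (0 : Fin n → ℂ) _)).isPreconnected
  have hmem : (τ₀, z₀) ∈ s := ⟨half_lt_self (show 0 < τ₀.im from hτ₀), by simp⟩
  have hf := hasFDerivAt_tsum_of_isPreconnected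
    (f := fun (r : {r : Fin n → ℤ // (Submodule.Quotient.mk r : F.Disc) = x}) p =>
      e (thetaPhase F r.1 p))
    (f' := fun r p => (2 * Real.pi * Complex.I * e (thetaPhase F r.1 p)) • thetaPhase F r.1)
    (u := fun r => 2 * Real.pi * ((1 / (Real.pi * (τ₀.im / 2)) + 1) *
        gaussBound (Real.pi * (τ₀.im / 2) * δ) (2 * Real.pi * (‖z₀‖ + 1) + 1) r.1))
    ((((summable_gaussBound (by have := Real.pi_pos; positivity) _).mul_left _).mul_left
      _).subtype _) hso hsc
    (fun r p _ => (hasDerivAt_e _).comp_hasFDerivAt p (thetaPhase F r.1).hasFDerivAt)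
    (fun r p hp => norm_deriv_thetaTerm_le F hy r.1 (hq r.1) hp.1 (mem_ball_zero_iff.1 hp.2))
    hmem
    (by
      refine ((summable_thetaTerm F ⟨τ₀, hτ₀⟩ z₀).subtype _).congr fun r => ?_
      rw [thetaPhase_apply]
      rfl) hmem
  refine (hf.differentiableAt.congr_of_eventuallyEq ?_).differentiableWithinAt
  filter_upwards [hso.mem_nhds hmem] with p hp
  rw [theta_eq_tsum, UpperHalfPlane.ofComplex_apply_of_im_pos (hy.trans hp.1)]
  refine tsum_congr fun r => ?_
  rw [thetaPhase_apply]
  rfl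

end ThetaAnalysis

/-! ### Fourier expansions and the theta decomposition -/

section ThetaDecomposition

theorem Mp.T_pow_apply (N : ℕ) (τ : ℍ) :
    (Mp.T ^ N).w τ = 1 ∧ (((Mp.T ^ N).mat • τ : ℍ) : ℂ) = τ + N := by
  induction N with
  | zero => simp
  | succ N ih =>
    rw [pow_succ']
    refine ⟨?_, ?_⟩
    · rw [Mp.mul_w, ih.1, mul_one]
      rfl
    · rw [Mp.mul_mat, mul_smul, show Mp.T.mat = ModularGroup.T from rfl, Mp.coe_T_smul, ih.2]
      push_cast
      ring

/-- Modular forms have an expansion in powers of `e(τ/N)`, where `T^N` lies in the subgroup on which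
the form is invariant. -/
theorem exists_qExpansion {κ : ℤ} {h : ℍ → ℂ} (hh : h ∈ modularForms κ) :
    ∃ N : ℕ, 0 < N ∧ ∃ c : ℕ → ℂ, ∀ τ : ℍ,
      HasSum (fun m : ℕ => c m * e (((m / N : ℚ) : ℂ) * τ)) (h τ) := by
  obtain ⟨hol, ⟨Δ, hΔ, hinv⟩, hbd⟩ := hh
  obtain ⟨N, hN, -, hmem⟩ := Subgroup.exists_pow_mem_of_index_ne_zero hΔ.index_ne_zero Mp.T
  have hN' : (0 : ℝ) < N := by exact_mod_cast hN
  have hT : ∀ τ τ' : ℍ, (τ' : ℂ) = τ + N → h τ' = h τ := fun τ τ' hτ => by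
    have h1 := congrFun (hinv _ hmem) τ
    rw [slash_apply, (Mp.T_pow_apply N τ).1, one_zpow, mul_one] at h1
    rw [← h1]
    congr 1
    exact UpperHalfPlane.ext (hτ.trans (Mp.T_pow_apply N τ).2.symm)
  have hper : Function.Periodic (h ∘ UpperHalfPlane.ofComplex) ((N : ℝ) : ℂ) := fun z => by
    have him : (z + ((N : ℝ) : ℂ)).im = z.im := by simp
    rcases lt_or_ge 0 z.im with hz | hz
    · refine hT _ _ ?_
      rw [ofComplex_apply_of_im_pos hz, ofComplex_apply_of_im_pos (him.symm ▸ hz)]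
      simp
    · simp only [Function.comp_apply]
      rw [ofComplex_apply_of_im_nonpos hz, ofComplex_apply_of_im_nonpos (him.trans_le hz)]
  have hbd' : IsBoundedAtImInfty h := by
    have := hbd 1
    rwa [slash_one] at this
  refine ⟨N, hN, fun m => (UpperHalfPlane.qExpansion (N : ℝ) h).coeff m, fun τ => ?_⟩
  refine (UpperHalfPlane.hasSum_qExpansion hN' hper hol hbd' τ).congr_fun fun m => ?_
  rw [smul_eq_mul, Function.Periodic.qParam, ← Complex.exp_nat_mul, e]
  congr 2
  push_cast
  ring

variable {n : ℕ} (F : HalfIntegralForm n)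

/-- The values `¼F⁻¹[r]` are rational, because `Q` takes values of finite order in `ℝ/ℤ`. -/
theorem HalfIntegralForm.exists_rat_dualForm (r : Fin n → ℤ) : ∃ q : ℚ, (q : ℝ) = F.dualForm r := by
  have h : (2 * Fintype.card F.Disc) • F.discForm (Submodule.Quotient.mk r) = 0 := by
    rw [mul_comm, mul_nsmul', ← F.bilin_self, F.card_nsmul_bilin]
  rw [discForm_mk, ← AddCircle.coe_nsmul, AddCircle.coe_eq_zero_iff] at h
  obtain ⟨m, hm⟩ := h
  have hc : (Fintype.card F.Disc : ℝ) ≠ 0 := by exact_mod_cast Fintype.card_ne_zero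
  refine ⟨m / (2 * Fintype.card F.Disc), ?_⟩
  simp only [zsmul_eq_mul, mul_one, nsmul_eq_mul, Nat.cast_mul, Nat.cast_ofNat] at hm
  push_cast
  rw [hm]
  field_simp

variable {V : Type*} [AddCommGroup V] [Module ℂ V]

theorem HasFourierExpansion.add {φ ψ : ℍ → (Fin n → ℂ) → V} (hφ : HasFourierExpansion F φ)
    (hψ : HasFourierExpansion F ψ) : HasFourierExpansion F (φ + ψ) := by
  obtain ⟨c, hc, hc'⟩ := hφ
  obtain ⟨d, hd, hd'⟩ := hψ
  refine ⟨c + d, fun l r hne => ?_, fun τ z v => ?_⟩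
  · by_cases hcz : c (l, r) = 0
    · exact hd l r fun h => hne (by simp [hcz, h])
    · exact hc l r hcz
  · simpa [add_mul] using (hc' τ z v).add (hd' τ z v)

theorem HasFourierExpansion.zero : HasFourierExpansion F (0 : ℍ → (Fin n → ℂ) → V) :=
  ⟨0, by simp, fun τ z v => by simp⟩

theorem HasFourierExpansion.map {W : Type*} [AddCommGroup W] [Module ℂ W]
    {φ : ℍ → (Fin n → ℂ) → V} (hφ : HasFourierExpansion F φ) (f : V →ₗ[ℂ] W) :
    HasFourierExpansion F fun τ z => f (φ τ z) := by
  obtain ⟨c, hc, hc'⟩ := hφ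
  refine ⟨fun p => f (c p), fun l r hne => hc l r fun h => hne (by simp [h]), fun τ z v => ?_⟩
  exact hc' τ z (v ∘ₗ f)

/-- The product of a modular form and a theta series has a Fourier expansion. -/
theorem hasFourierExpansion_mul_thetaMap {κ : ℤ} {h : ℍ → ℂ} (hh : h ∈ modularForms κ)
    (lam : Module.Dual ℂ (F.Disc →₀ ℂ)) (v : V) :
    HasFourierExpansion F fun τ z => (h τ * thetaMap F lam τ z) • v := by
  obtain ⟨N, hN, c, hc⟩ := exists_qExpansion hh
  choose q hq using F.exists_rat_dualForm
  -- The term of index `m` of the form times that of index `r` of the theta series is the Fourier term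
  -- at `(m/N + ¼F⁻¹[r], r)`, and these pairs are distinct.
  let ι : ℕ × (Fin n → ℤ) → ℚ × (Fin n → ℤ) := fun p => (p.1 / N + q p.2, p.2)
  have hι : Function.Injective ι := by
    rintro ⟨m, r⟩ ⟨m', r'⟩ h
    obtain rfl : r = r' := congrArg Prod.snd h
    have h1 : (m / N + q r : ℚ) = m' / N + q r := congrArg Prod.fst h
    have hN0 : (N : ℚ) ≠ 0 := by exact_mod_cast hN.ne'
    rw [add_left_inj, div_left_inj' hN0] at h1
    rw [Prod.mk.injEq]
    exact ⟨by exact_mod_cast h1, rfl⟩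
  let d : ℕ × (Fin n → ℤ) → V := fun p =>
    (c p.1 * lam (Finsupp.single (Submodule.Quotient.mk p.2) 1)) • v
  have hd : ∀ p ∉ Set.range ι, Function.extend ι d 0 p = 0 := fun p hp =>
    Function.extend_apply' _ _ _ hp
  refine ⟨Function.extend ι d 0, fun l r hne => ?_, fun τ z w => ?_⟩
  · by_cases hlr : (l, r) ∈ Set.range ι
    · obtain ⟨⟨m, r'⟩, h⟩ := hlr
      obtain rfl : r' = r := congrArg Prod.snd h
      obtain rfl : (m / N + q r' : ℚ) = l := congrArg Prod.fst h
      have h1 := hq r'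
      rw [HalfIntegralForm.dualForm] at h1
      have h2 : (0 : ℝ) ≤ (m : ℝ) / N := by positivity
      push_cast
      linarith
    · exact absurd (hd _ hlr) hne
  · refine (hι.hasSum_iff fun p hp => by rw [hd p hp, map_zero, zero_mul]).1 ?_
    have h1 := hc τ
    have h2 := hasSum_theta_combination F (fun x => lam (Finsupp.single x 1)) τ z
    have hprod : ∀ (f : ℕ → ℂ) (g : (Fin n → ℤ) → ℂ) (s t : ℂ), HasSum f s → HasSum g t →
        HasSum (fun p : ℕ × (Fin n → ℤ) => f p.1 * g p.2) (s * t) := fun f g s t hf hg =>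
      hf.mul hg (summable_mul_of_summable_norm hf.summable.norm hg.summable.norm)
    have h3 := (hprod _ _ _ _ h1 h2).mul_left (w v)
    rw [map_smul, smul_eq_mul, mul_comm _ (w v), thetaMap_apply]
    refine h3.congr_fun fun p => ?_
    rw [Function.comp_apply, hι.extend_apply, map_smul, smul_eq_mul, thetaTerm, ← e_add]
    have h4 : ((ι p).1 : ℂ) * τ = ((p.1 / N : ℚ) : ℂ) * τ + τ * F.dualForm p.2 := by
      rw [← hq]
      simp only [ι]
      push_cast
      ring
    rw [h4, dotProduct_comm z, add_assoc, e_add (_ * _)]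
    simp only [ι]
    ring

/-- The coefficients of a Jacobi form as a series in the functions `e(τ ¼F⁻¹[r] + rᵗz)` are
holomorphic, and bounded at `i∞` because only exponents `l ≥ ¼F⁻¹[r]` occur. -/
theorem HasFourierExpansion.exists_coeff {ψ : ℍ → (Fin n → ℂ) → ℂ}
    (hψ : HasFourierExpansion F ψ) : ∃ b : (Fin n → ℤ) → ℍ → ℂ,
      (∀ (τ : ℍ) z, HasSum (fun r => b r τ * thetaTerm F τ z r) (ψ τ z)) ∧
      ∀ r, MDifferentiable 𝓘(ℂ) 𝓘(ℂ) (b r) ∧ IsBoundedAtImInfty (b r) := by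
  obtain ⟨c, hc, hsum⟩ := hψ
  replace hsum := fun τ z => hsum τ z LinearMap.id
  simp only [LinearMap.id_apply] at hsum
  have hs : ∀ (τ : ℍ) r, Summable fun l : ℚ => c (l, r) * e (l * τ) := fun τ r => by
    have := (hsum τ 0).summable.comp_injective (i := fun l : ℚ => (l, r))
      fun l l' h => congrArg Prod.fst h
    refine this.congr fun l => ?_
    simp
  refine ⟨fun r τ => (∑' l : ℚ, c (l, r) * e (l * τ)) * e (-(τ * F.dualForm r)), fun τ z => ?_,
    fun r => ?_⟩
  · have h1 := (Equiv.prodComm (Fin n → ℤ) ℚ).hasSum_iff.2 (hsum τ z)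
    refine h1.prod_fiberwise fun r => ?_
    have h2 := (hs τ r).hasSum.mul_right (e (-(τ * F.dualForm r)) * thetaTerm F τ z r)
    rw [← mul_assoc] at h2
    refine h2.congr_fun fun l => ?_
    simp only [Function.comp_apply, Equiv.prodComm_apply, Prod.swap_prod_mk]
    rw [dotProduct_comm z, thetaTerm, e_add, e_neg]
    field_simp [e_ne_zero (τ * F.dualForm r)]
  -- The coefficient of `e(τ ¼F⁻¹[r] + rᵗz)` is `∑ c(l,r) e((l - ¼F⁻¹[r])τ)`. As no exponent is
  -- negative, the series on `Im τ ≥ y` is dominated by its value at `iy`.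
  · let G : ℂ → ℂ := fun w => ∑' l : ℚ, c (l, r) * e ((l - F.dualForm r) * w)
    have hG : ∀ τ : ℍ, (∑' l : ℚ, c (l, r) * e (l * τ)) * e (-(τ * F.dualForm r)) = G τ :=
      fun τ => by
        rw [← tsum_mul_right]
        refine tsum_congr fun l => ?_
        rw [mul_assoc, ← e_add]
        congr 2
        ring
    let u : ℝ → ℚ → ℝ := fun y l => ‖c (l, r) * e ((l - F.dualForm r) * (y * Complex.I))‖
    have hu : ∀ y, 0 < y → Summable (u y) := fun y hy => by
      have := ((hs ⟨y * Complex.I, by simpa using hy⟩ r).mul_right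
        (e (-(y * Complex.I * F.dualForm r)))).norm
      refine this.congr fun l => ?_
      rw [mul_assoc, ← e_add]
      congr 3
      change (l : ℂ) * (y * Complex.I) + _ = _
      ring
    have hle : ∀ (y : ℝ) (l : ℚ) (w : ℂ), y ≤ w.im →
        ‖c (l, r) * e ((l - F.dualForm r) * w)‖ ≤ u y l := fun y l w hw => by
      by_cases h0 : c (l, r) = 0
      · simp [u, h0]
      · have h1 := hc l r h0
        have h2 : 0 ≤ (l : ℝ) - F.dualForm r := by
          rw [HalfIntegralForm.dualForm]
          linarith
        simp only [u, norm_mul]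
        refine mul_le_mul_of_nonneg_left ?_ (norm_nonneg _)
        have h3 : ∀ w : ℂ, (((l : ℂ) - F.dualForm r) * w).im = ((l : ℝ) - F.dualForm r) * w.im :=
          fun w => by
            have : ((l : ℂ) - F.dualForm r) = (((l : ℝ) - F.dualForm r : ℝ) : ℂ) := by
              push_cast
              rfl
            rw [this, Complex.im_ofReal_mul]
        rw [norm_e, norm_e, h3, h3, Real.exp_le_exp]
        have h4 : (y * Complex.I : ℂ).im = y := by simp
        rw [h4, neg_le_neg_iff]
        exact mul_le_mul_of_nonneg_left (mul_le_mul_of_nonneg_left hw h2) (by positivity)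
    have hGd : DifferentiableOn ℂ G {w | 0 < w.im} := fun w hw => by
      have hw' : 0 < w.im / 2 := half_pos hw
      have ho : IsOpen {z : ℂ | w.im / 2 < z.im} := isOpen_lt continuous_const Complex.continuous_im
      have := Complex.differentiableOn_tsum_of_summable_norm (hu _ hw')
        (F := fun (l : ℚ) w => c (l, r) * e ((l - F.dualForm r) * w))
        (fun l => ((differentiable_e.comp (differentiable_id.const_mul _)).const_mul
          _).differentiableOn) ho fun l z hz => hle _ l z (le_of_lt hz)
      exact (this.differentiableAt (ho.mem_nhds (half_lt_self
        (show 0 < w.im from hw)))).differentiableWithinAt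
    have hfun : (fun τ : ℍ => (∑' l : ℚ, c (l, r) * e (l * τ)) * e (-(τ * F.dualForm r))) =
        fun τ : ℍ => G τ := funext hG
    beta_reduce
    rw [hfun]
    constructor
    · rw [UpperHalfPlane.mdifferentiable_iff]
      refine hGd.congr fun z hz => ?_
      rw [Function.comp_apply, ofComplex_apply_of_im_pos hz]
    · rw [UpperHalfPlane.isBoundedAtImInfty_iff]
      refine ⟨∑' l, u 1 l, 1, fun τ hτ => ?_⟩
      exact tsum_of_norm_bounded (hu 1 one_pos).hasSum fun l => hle 1 l τ hτ

/-- The coefficients of a combination of theta series that has a Fourier expansion are holomorphic,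
and bounded at `i∞`. -/
theorem HasFourierExpansion.mdifferentiable_and_isBounded {ψ : ℍ → (Fin n → ℂ) → ℂ}
    (hψ : HasFourierExpansion F ψ) {h : F.Disc → ℍ → ℂ}
    (hh : ∀ τ z, ψ τ z = ∑ x, h x τ * theta F x τ z) (x : F.Disc) :
    MDifferentiable 𝓘(ℂ) 𝓘(ℂ) (h x) ∧ IsBoundedAtImInfty (h x) := by
  obtain ⟨b, hb, hb'⟩ := hψ.exists_coeff
  obtain ⟨r, rfl⟩ := Submodule.Quotient.mk_surjective _ x
  have h1 : h (Submodule.Quotient.mk r) = b r := by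
    ext τ
    exact congrFun (thetaTerm_coeff_unique F (fun z => hh τ z ▸
      hasSum_theta_combination F (fun x => h x τ) τ z) (hb τ)) r
  rw [h1]
  exact hb' r

/-- A function that has a Fourier expansion and is invariant under the lattice is a combination of
theta series. -/
theorem HasFourierExpansion.exists_theta_combination {ψ : ℍ → (Fin n → ℂ) → ℂ}
    (hψ : HasFourierExpansion F ψ) (hl : ∀ l m, latticeSlash F l m ψ = ψ) :
    ∃ h : F.Disc → ℍ → ℂ, ∀ τ z, ψ τ z = ∑ x, h x τ * theta F x τ z := by
  obtain ⟨b, hb, -⟩ := hψ.exists_coeff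
  -- The lattice action shifts `r` by `2Fl`, so the coefficients depend on the class of `r` only.
  have hper : ∀ (τ : ℍ) l r, b (r + F.double.mulVec l) τ = b r τ := fun τ l r => by
    have h1 : ∀ z, HasSum (fun r => b (r + F.double.mulVec (-l)) τ * thetaTerm F τ z r)
        (ψ τ z) := fun z => by
      have h2 := (hb τ fun i => z i + l i * τ + (0 : Fin n → ℤ) i).mul_left
        (e (τ * quadVal F.toMatrixC (fun i => (l i : ℂ)) +
          2 * (z ⬝ᵥ F.toMatrixC.mulVec (fun i => (l i : ℂ)))))
      have h3 : latticeSlash F l 0 ψ τ z = ψ τ z := by rw [hl]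
      rw [latticeSlash, smul_eq_mul] at h3
      rw [h3] at h2
      refine (Equiv.addRight (F.double.mulVec l)).hasSum_iff.1 (h2.congr_fun fun r => ?_)
      rw [Function.comp_apply, Equiv.coe_addRight, mul_left_comm, thetaTerm_add_double,
        Matrix.mulVec_neg, add_neg_cancel_right]
    have h4 := congrFun (thetaTerm_coeff_unique F h1 (hb τ)) (r + F.double.mulVec l)
    rw [Matrix.mulVec_neg, add_neg_cancel_right] at h4
    exact h4.symm
  refine ⟨fun x τ => b (Quotient.out x) τ, fun τ z => ?_⟩
  refine (hb τ z).unique ((hasSum_theta_combination F _ τ z).congr_fun fun r => ?_)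
  have h1 : (Submodule.Quotient.mk r : F.Disc) =
      Submodule.Quotient.mk (Quotient.out (Submodule.Quotient.mk r : F.Disc)) :=
    (Quotient.out_eq _).symm
  obtain ⟨l, hl⟩ := (Submodule.Quotient.eq _).1 h1
  rw [Matrix.mulVecLin_apply] at hl
  have h2 := hper τ l (Quotient.out (Submodule.Quotient.mk r : F.Disc))
  rw [hl, add_sub_cancel] at h2
  rw [h2]

/-- The coefficients of a combination of theta series transform by the slash action and the matrices
of the Weil representation. -/
theorem jacobiSlash_theta_combination (κ : ℤ) {ψ : ℍ → (Fin n → ℂ) → ℂ} {h : F.Disc → ℍ → ℂ}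
    (hh : ∀ τ z, ψ τ z = ∑ x, h x τ * theta F x τ z) (g : Mp) (τ : ℍ) (z : Fin n → ℂ) :
    jacobiSlash κ F g ψ τ z =
      ∑ y, (∑ x, thetaMatrix F g x y * slash (κ - n) g (h x) τ) * theta F y τ z := by
  have h1 : ψ = ∑ x, fun τ z => (h x τ * theta F x τ z) • (1 : ℂ) := by
    ext τ z
    simp [hh, Finset.sum_apply]
  rw [h1, jacobiSlash_sum]
  simp_rw [jacobiSlash_mul_smul, jacobiSlash_theta]
  simp only [Finset.sum_apply, Pi.smul_apply, smul_eq_mul, mul_one, Finset.mul_sum, Finset.sum_mul]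
  rw [Finset.sum_comm]
  exact Finset.sum_congr rfl fun y _ => Finset.sum_congr rfl fun x _ => by ring

/-- The theta decomposition of a scalar valued Jacobi form on some subgroup of finite index. -/
theorem exists_modularForms_theta_combination (κ : ℤ) {ψ : ℍ → (Fin n → ℂ) → ℂ}
    (hψ : ∀ g, HasFourierExpansion F (jacobiSlash κ F g ψ))
    (hl : ∀ l m, latticeSlash F l m ψ = ψ)
    {Δ : Subgroup Mp} [Δ.FiniteIndex] (hΔ : ∀ g ∈ Δ, jacobiSlash κ F g ψ = ψ) :
    ∃ h : F.Disc → modularForms (κ - n), ∀ τ z, ψ τ z = ∑ x, (h x).1 τ * theta F x τ z := by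
  have hψ1 : HasFourierExpansion F ψ := by
    have := hψ 1
    rwa [jacobiSlash_one] at this
  obtain ⟨h, hh⟩ := hψ1.exists_theta_combination F hl
  classical
  have : (thetaMatrix F).ker.FiniteIndex :=
    finiteIndex_ker_of_finite_range _ (finite_range_thetaMatrix F)
  refine ⟨fun x => ⟨h x, (hψ1.mdifferentiable_and_isBounded F hh x).1,
    ⟨Δ ⊓ (thetaMatrix F).ker, inferInstance, fun g hg => ?_⟩, fun g => ?_⟩, hh⟩
  · ext τ
    refine congrFun (theta_linearIndependent F (h := fun x => slash (κ - n) g (h x) τ)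
      (h' := fun x => h x τ) τ fun z => ?_) x
    have h1 := jacobiSlash_theta_combination F κ hh g τ z
    rw [hΔ g hg.1, hh, MonoidHom.mem_ker.1 hg.2] at h1
    rw [h1]
    refine Finset.sum_congr rfl fun y _ => ?_
    simp [Matrix.one_apply]
  -- The coefficients of `ψ|g` are the combinations of the `h x|g` by the matrix of `g`; they are
  -- bounded, and the inverse matrix recovers the `h x|g`.
  · have h1 := fun y => ((hψ g).mdifferentiable_and_isBounded F
      (jacobiSlash_theta_combination F κ hh g) y).2
    have h2 : slash (κ - n) g (h x) = ∑ y, thetaMatrix F g⁻¹ y x •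
        fun τ => ∑ x, thetaMatrix F g x y * slash (κ - n) g (h x) τ := by
      ext τ
      have h3 : ∀ z, ∑ y, thetaMatrix F g z y * thetaMatrix F g⁻¹ y x =
          (1 : Matrix F.Disc F.Disc ℂ) z x := fun z => by
        rw [← Matrix.mul_apply, ← map_mul, mul_inv_cancel, map_one]
      simp only [Finset.sum_apply, Pi.smul_apply, smul_eq_mul, Finset.mul_sum]
      rw [Finset.sum_comm]
      have h4 : ∀ z, ∑ y, thetaMatrix F g⁻¹ y x * (thetaMatrix F g z y *
          slash (κ - n) g (h z) τ) =
            (1 : Matrix F.Disc F.Disc ℂ) z x * slash (κ - n) g (h z) τ := fun z => by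
        rw [← h3, Finset.sum_mul]
        exact Finset.sum_congr rfl fun y _ => by ring
      simp [h4, Matrix.one_apply]
    rw [h2]
    refine Submodule.sum_mem (Filter.boundedFilterSubmodule ℂ atImInfty) fun y _ => ?_
    exact Submodule.smul_mem _ _ (h1 y)

end ThetaDecomposition

/-! ### Invariants, coinvariants and induced modules -/

section Algebra

open Representation

section Trace

variable {G X : Type*} [Group G] [AddCommGroup X] [Module ℂ X] (π : Representation ℂ G X)

theorem rep_out_apply {Δ : Subgroup G} {x : X} (hx : ∀ δ ∈ Δ, π δ x = x) (g : G) :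
    π (Quotient.out (g : G ⧸ Δ)) x = π g x := by
  obtain ⟨δ, hδ⟩ := QuotientGroup.mk_out_eq_mul Δ g
  rw [hδ, map_mul, Module.End.mul_apply, hx _ δ.2]

/-- The sum of the translates of `x` over `G / Δ`; it does not depend on the choice of
representatives if `x` is fixed by `Δ`. -/
def cosetTrace (Δ : Subgroup G) [Fintype (G ⧸ Δ)] (x : X) : X := ∑ c : G ⧸ Δ, π (Quotient.out c) x

theorem cosetTrace_mem_invariants {Δ : Subgroup G} [Fintype (G ⧸ Δ)] {x : X}
    (hx : ∀ δ ∈ Δ, π δ x = x) : cosetTrace π Δ x ∈ invariants π := fun g => by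
  rw [cosetTrace, map_sum, ← Equiv.sum_comp (MulAction.toPerm g : Equiv.Perm (G ⧸ Δ))
    fun c => π (Quotient.out c) x]
  refine Finset.sum_congr rfl fun c _ => ?_
  have h : (MulAction.toPerm g : Equiv.Perm (G ⧸ Δ)) c = ((g * Quotient.out c : G) : G ⧸ Δ) := by
    conv_lhs => rw [← QuotientGroup.out_eq' c]
    rfl
  rw [h, rep_out_apply π hx, map_mul]
  rfl

theorem cosetTrace_apply {Δ : Subgroup G} [Δ.Normal] [Fintype (G ⧸ Δ)] {x : X}
    (hx : ∀ δ ∈ Δ, π δ x = x) (g : G) : cosetTrace π Δ (π g x) = cosetTrace π Δ x := by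
  rw [cosetTrace, cosetTrace, ← Equiv.sum_comp (Equiv.mulRight (g : G ⧸ Δ))
    fun c => π (Quotient.out c) x]
  refine Finset.sum_congr rfl fun c _ => ?_
  have h : (Equiv.mulRight (g : G ⧸ Δ)) c = ((Quotient.out c * g : G) : G ⧸ Δ) := by
    rw [Equiv.coe_mulRight, QuotientGroup.mk_mul, QuotientGroup.out_eq']
  rw [h, rep_out_apply π hx, map_mul]
  rfl

theorem cosetTrace_of_mem_invariants {Δ : Subgroup G} [Fintype (G ⧸ Δ)] {x : X}
    (hx : x ∈ invariants π) : cosetTrace π Δ x = (Fintype.card (G ⧸ Δ) : ℂ) • x := by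
  have h : ∀ c : G ⧸ Δ, π (Quotient.out c) x = x := fun c => hx _
  simp_rw [cosetTrace, h]
  rw [Finset.sum_const, Finset.card_univ, Nat.cast_smul_eq_nsmul]

/-- The trace over a sufficiently small normal subgroup kills the augmentation submodule. -/
theorem exists_cosetTrace_eq_zero
    (hπ : ∀ x, ∃ Δ : Subgroup G, Δ.FiniteIndex ∧ ∀ δ ∈ Δ, π δ x = x) {x : X}
    (hx : x ∈ Coinvariants.ker π) : ∃ Δ : Subgroup G, Δ.FiniteIndex ∧
      ∀ (Δ' : Subgroup G) [Δ'.Normal] [Fintype (G ⧸ Δ')], Δ' ≤ Δ → cosetTrace π Δ' x = 0 := by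
  induction hx using Submodule.span_induction with
  | mem x hx =>
    obtain ⟨⟨g, y⟩, rfl⟩ := hx
    obtain ⟨Δ, hΔ, hy⟩ := hπ y
    refine ⟨Δ, hΔ, fun Δ' _ _ hle => ?_⟩
    have h := cosetTrace_apply π (fun δ hδ => hy δ (hle hδ)) g
    have hsub : cosetTrace π Δ' (π g y - y) = cosetTrace π Δ' (π g y) - cosetTrace π Δ' y := by
      simp [cosetTrace]
    rw [hsub, h, sub_self]
  | zero => exact ⟨⊤, inferInstance, fun Δ' _ _ _ => by simp [cosetTrace]⟩
  | add x y _ _ hx hy =>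
    obtain ⟨Δ₁, h₁, hx⟩ := hx
    obtain ⟨Δ₂, h₂, hy⟩ := hy
    refine ⟨Δ₁ ⊓ Δ₂, inferInstance, fun Δ' _ _ hle => ?_⟩
    have hadd : cosetTrace π Δ' (x + y) = cosetTrace π Δ' x + cosetTrace π Δ' y := by
      simp [cosetTrace, Finset.sum_add_distrib]
    rw [hadd, hx Δ' (hle.trans inf_le_left), hy Δ' (hle.trans inf_le_right), add_zero]
  | smul a x _ hx =>
    obtain ⟨Δ, hΔ, hx⟩ := hx
    refine ⟨Δ, hΔ, fun Δ' _ _ hle => ?_⟩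
    have hsmul : cosetTrace π Δ' (a • x) = a • cosetTrace π Δ' x := by
      simp [cosetTrace, Finset.smul_sum]
    rw [hsmul, hx Δ' hle, smul_zero]

/-- If every vector is fixed by a subgroup of finite index, then the invariants of a representation
are isomorphic to its coinvariants: the inverse map is given by averaging. -/
theorem bijective_mk_invariants
    (hπ : ∀ x, ∃ Δ : Subgroup G, Δ.FiniteIndex ∧ ∀ δ ∈ Δ, π δ x = x) :
    Function.Bijective (Coinvariants.mk π ∘ₗ (invariants π).subtype) := by
  constructor
  · rw [← LinearMap.ker_eq_bot, LinearMap.ker_eq_bot']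
    rintro ⟨x, hx⟩ h
    obtain ⟨Δ, hΔ, h0⟩ := exists_cosetTrace_eq_zero π hπ ((Coinvariants.mk_eq_zero π).1 h)
    let _ : Fintype (G ⧸ Δ.normalCore) := Fintype.ofFinite _
    have h1 : cosetTrace π Δ.normalCore x = 0 := h0 Δ.normalCore Δ.normalCore_le
    rw [cosetTrace_of_mem_invariants π hx] at h1
    have h2 : (Fintype.card (G ⧸ Δ.normalCore) : ℂ) ≠ 0 := by
      exact_mod_cast Fintype.card_ne_zero
    exact Subtype.ext ((smul_eq_zero.1 h1).resolve_left h2)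
  · intro y
    obtain ⟨x, rfl⟩ := Coinvariants.mk_surjective π y
    obtain ⟨Δ, hΔ, hx⟩ := hπ x
    let _ : Fintype (G ⧸ Δ) := Fintype.ofFinite _
    refine ⟨(Fintype.card (G ⧸ Δ) : ℂ)⁻¹ • ⟨cosetTrace π Δ x, cosetTrace_mem_invariants π hx⟩, ?_⟩
    have h2 : (Fintype.card (G ⧸ Δ) : ℂ) ≠ 0 := by
      exact_mod_cast Fintype.card_ne_zero
    rw [map_smul, inv_smul_eq_iff₀ h2, LinearMap.comp_apply]
    change Coinvariants.mk π (∑ c : G ⧸ Δ, π (Quotient.out c) x) = _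
    rw [map_sum]
    simp only [Coinvariants.mk_self_apply]
    rw [Finset.sum_const, Finset.card_univ, Nat.cast_smul_eq_nsmul]

end Trace

section Induced

variable {G A V : Type*} [Group G] [AddCommGroup A] [Module ℂ A] [AddCommGroup V] [Module ℂ V]
  (α : Representation ℂ Gᵐᵒᵖ A) {Γ : Subgroup G} (ρ : Representation ℂ Γ V)

/-- The left `Γ`-module `A ⊗ V` attached to a right `G`-module `A` and a left `Γ`-module `V`, with
`γ(a ⊗ v) = aγ⁻¹ ⊗ γv`. -/
def diagonalRep : Representation ℂ Γ (A ⊗[ℂ] V) where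
  toFun γ := TensorProduct.map (α (MulOpposite.op (γ : G)⁻¹)) (ρ γ)
  map_one' := by ext; simp
  map_mul' γ γ' := by ext; simp

theorem diagonalRep_tmul (γ : Γ) (a : A) (v : V) :
    diagonalRep α ρ γ (a ⊗ₜ v) = α (MulOpposite.op (γ : G)⁻¹) a ⊗ₜ ρ γ v := rfl

/-- The map `a ⊗ v ↦ a ⊗ (1 ⊗ v)`. -/
def toBalanced : A ⊗[ℂ] V →ₗ[ℂ] BalancedTensor α (ind Γ.subtype ρ) :=
  BalancedTensor.mk α (ind Γ.subtype ρ) ∘ₗ (IndV.mk Γ.subtype ρ 1).lTensor _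

theorem toBalanced_tmul (a : A) (v : V) : toBalanced α ρ (a ⊗ₜ v) =
    BalancedTensor.mk α (ind Γ.subtype ρ) (a ⊗ₜ IndV.mk Γ.subtype ρ 1 v) := rfl

theorem BalancedTensor.mk_apply_tmul {B : Type*} [AddCommGroup B] [Module ℂ B]
    (β : Representation ℂ G B) (g : G) (a : A) (b : B) :
    BalancedTensor.mk α β (α (MulOpposite.op g) a ⊗ₜ b) = BalancedTensor.mk α β (a ⊗ₜ β g b) :=
  (Submodule.Quotient.eq _).2 (Submodule.subset_span ⟨g, a, b, rfl⟩)

theorem indV_mk_mul (γ : Γ) (h : G) (v : V) :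
    IndV.mk Γ.subtype ρ (γ * h) (ρ γ v) = IndV.mk Γ.subtype ρ h v := by
  have := Coinvariants.mk_self_apply (Representation.tprod ((leftRegular ℂ G).comp Γ.subtype) ρ) γ
    (MonoidAlgebra.single h 1 ⊗ₜ[ℂ] v)
  simpa using this

/-- Every pure tensor in `A ⊗_{ℂ[G]} Ind V` comes from `A ⊗ V`; `IndV.mk h v` is the class of
`h⁻¹ ⊗ v` in the usual notation. -/
theorem mk_tmul_indV_mk (a : A) (h : G) (v : V) :
    BalancedTensor.mk α (ind Γ.subtype ρ) (a ⊗ₜ IndV.mk Γ.subtype ρ h v) =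
      toBalanced α ρ (α (MulOpposite.op h⁻¹) a ⊗ₜ v) := by
  rw [toBalanced_tmul, BalancedTensor.mk_apply_tmul, ind_mk, inv_inv, one_mul]

theorem toBalanced_diagonalRep (γ : Γ) (x : A ⊗[ℂ] V) :
    toBalanced α ρ (diagonalRep α ρ γ x) = toBalanced α ρ x := by
  induction x using TensorProduct.induction_on with
  | zero => simp
  | add x y hx hy => rw [map_add, map_add, map_add, hx, hy]
  | tmul a v =>
    rw [diagonalRep_tmul, ← mk_tmul_indV_mk, toBalanced_tmul, ← indV_mk_mul ρ γ 1 v, mul_one]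

/-- The bilinear map `(a, h) ↦ (v ↦ [a h⁻¹ ⊗ v])` that defines the inverse of `toBalanced` on
coinvariants; here `h` stands for the class `h⁻¹ ⊗ v` in the usual notation for the induced
module. -/
def inverseAux : MonoidAlgebra ℂ G ⊗[ℂ] V →ₗ[ℂ] A →ₗ[ℂ] Coinvariants (diagonalRep α ρ) :=
  TensorProduct.lift (Finsupp.linearCombination ℂ (fun h : G =>
    (((TensorProduct.mk ℂ A V).compr₂ (Coinvariants.mk (diagonalRep α ρ))).comp
      (α (MulOpposite.op h⁻¹))).flip) ∘ₗ (MonoidAlgebra.coeffLinearEquiv ℂ).toLinearMap)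

theorem inverseAux_tmul (h : G) (v : V) (a : A) :
    inverseAux α ρ (MonoidAlgebra.single h 1 ⊗ₜ v) a =
      Coinvariants.mk (diagonalRep α ρ) (α (MulOpposite.op h⁻¹) a ⊗ₜ v) := by
  simp [inverseAux]

/-- The map `a ⊗ [h ⊗ v] ↦ [a h⁻¹ ⊗ v]`. -/
def inverseInd : IndV Γ.subtype ρ →ₗ[ℂ] A →ₗ[ℂ] Coinvariants (diagonalRep α ρ) :=
  Coinvariants.lift _ (inverseAux α ρ) fun γ => by
    refine TensorProduct.ext (MonoidAlgebra.lhom_ext' fun h => LinearMap.ext_ring ?_)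
    ext v a
    have h1 := Coinvariants.mk_self_apply (diagonalRep α ρ) γ (α (MulOpposite.op h⁻¹) a ⊗ₜ v)
    rw [diagonalRep_tmul, ← Module.End.mul_apply, ← map_mul, ← MulOpposite.op_mul,
      ← mul_inv_rev, ← inverseAux_tmul, ← inverseAux_tmul] at h1
    simpa using h1

theorem inverseInd_mk (h : G) (v : V) (a : A) : inverseInd α ρ (IndV.mk Γ.subtype ρ h v) a =
    Coinvariants.mk (diagonalRep α ρ) (α (MulOpposite.op h⁻¹) a ⊗ₜ v) :=
  inverseAux_tmul α ρ h v a

/-- The inverse of `toBalanced` on coinvariants. -/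
def balancedInverse : BalancedTensor α (ind Γ.subtype ρ) →ₗ[ℂ] Coinvariants (diagonalRep α ρ) :=
  Submodule.liftQ _ (TensorProduct.lift (inverseInd α ρ).flip) <| Submodule.span_le.2 <| by
    rintro _ ⟨g, a, b, rfl⟩
    rw [SetLike.mem_coe, LinearMap.mem_ker, map_sub, sub_eq_zero, TensorProduct.lift.tmul,
      TensorProduct.lift.tmul, LinearMap.flip_apply, LinearMap.flip_apply]
    have h : (inverseInd α ρ).flip (α (MulOpposite.op g) a) =
        (inverseInd α ρ).flip a ∘ₗ ind Γ.subtype ρ g := by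
      refine IndV.hom_ext _ _ fun h => ?_
      ext v
      simp only [LinearMap.comp_apply]
      rw [LinearMap.flip_apply, LinearMap.flip_apply]
      have h1 := ind_mk Γ.subtype ρ g h v
      have h2 := inverseInd_mk α ρ h v (α (MulOpposite.op g) a)
      have h3 := inverseInd_mk α ρ (h * g⁻¹) v a
      rw [← h1, mul_inv_rev, inv_inv, MulOpposite.op_mul, map_mul] at h3
      exact h2.trans h3.symm
    exact LinearMap.congr_fun h b

theorem balancedInverse_toBalanced (x : A ⊗[ℂ] V) :
    balancedInverse α ρ (toBalanced α ρ x) = Coinvariants.mk (diagonalRep α ρ) x := by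
  induction x using TensorProduct.induction_on with
  | zero => simp
  | add x y hx hy => rw [map_add, map_add, map_add, hx, hy]
  | tmul a v =>
    have h := inverseInd_mk α ρ 1 v a
    rw [inv_one, MulOpposite.op_one, map_one, Module.End.one_apply] at h
    exact h

theorem toBalanced_surjective : Function.Surjective (toBalanced α ρ) := by
  intro y
  obtain ⟨t, rfl⟩ := Submodule.mkQ_surjective _ y
  change ∃ x, toBalanced α ρ x = BalancedTensor.mk α (ind Γ.subtype ρ) t
  induction t using TensorProduct.induction_on with
  | zero => exact ⟨0, by simp⟩
  | add s t hs ht =>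
    obtain ⟨x, hx⟩ := hs
    obtain ⟨y, hy⟩ := ht
    exact ⟨x + y, by rw [map_add, map_add, hx, hy]⟩
  | tmul a b =>
    have h : ∀ b : IndV Γ.subtype ρ,
        BalancedTensor.mk α (ind Γ.subtype ρ) (a ⊗ₜ b) ∈ LinearMap.range (toBalanced α ρ) := by
      intro b
      obtain ⟨s, rfl⟩ := Coinvariants.mk_surjective _ b
      induction s using TensorProduct.induction_on with
      | zero => rw [map_zero, TensorProduct.tmul_zero, map_zero]; exact Submodule.zero_mem _
      | add s t hs ht =>
        rw [map_add, TensorProduct.tmul_add, map_add]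
        exact Submodule.add_mem _ hs ht
      | tmul f v =>
        induction f using MonoidAlgebra.induction_linear with
        | zero =>
          rw [TensorProduct.zero_tmul, map_zero, TensorProduct.tmul_zero, map_zero]
          exact Submodule.zero_mem _
        | add f g hf hg =>
          rw [TensorProduct.add_tmul, map_add, TensorProduct.tmul_add, map_add]
          exact Submodule.add_mem _ hf hg
        | single h c =>
          have h1 : MonoidAlgebra.single h c ⊗ₜ[ℂ] v =
              MonoidAlgebra.single h (1 : ℂ) ⊗ₜ (c • v) := by
            rw [← TensorProduct.smul_tmul, MonoidAlgebra.smul_single, smul_eq_mul, mul_one]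
          rw [h1]
          exact ⟨_, (mk_tmul_indV_mk α ρ a h (c • v)).symm⟩
    exact h b

/-- Invariants of `A ⊗ V` under `Γ` are the same as `A ⊗_{ℂ[G]} Ind V`, if all vectors are fixed by
subgroups of finite index. -/
theorem bijective_toBalanced_invariants
    (h : ∀ x, ∃ Δ : Subgroup Γ, Δ.FiniteIndex ∧ ∀ δ ∈ Δ, diagonalRep α ρ δ x = x) :
    Function.Bijective (toBalanced α ρ ∘ₗ (invariants (diagonalRep α ρ)).subtype) := by
  have hb := bijective_mk_invariants (diagonalRep α ρ) h
  constructor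
  · intro x y hxy
    refine hb.1 ?_
    have := congrArg (balancedInverse α ρ) hxy
    simpa only [LinearMap.comp_apply, balancedInverse_toBalanced] using this
  · intro y
    obtain ⟨x, rfl⟩ := toBalanced_surjective α ρ y
    obtain ⟨x', hx'⟩ := hb.2 (Coinvariants.mk _ x)
    refine ⟨x', ?_⟩
    have hle : Coinvariants.ker (diagonalRep α ρ) ≤ LinearMap.ker (toBalanced α ρ) := by
      refine Submodule.span_le.2 ?_
      rintro _ ⟨⟨γ, z⟩, rfl⟩
      simp [toBalanced_diagonalRep]
    have h1 := hle ((Coinvariants.mk_eq_iff _).1 hx')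
    rw [LinearMap.mem_ker, map_sub, sub_eq_zero] at h1
    exact h1

end Induced

end Algebra

/-! ### Theta expansions and Jacobi forms -/

section ThetaExpansion

variable {n : ℕ} (κ : ℤ) (F : HalfIntegralForm n) {V : Type*} [AddCommGroup V] [Module ℂ V]

theorem formsTensorDual_induction {P : FormsTensorDual κ F ⊗[ℂ] V → Prop} (zero : P 0)
    (tmul : ∀ h lam v, P (FormsTensorDual.tmul κ F h lam ⊗ₜ v))
    (add : ∀ s t, P s → P t → P (s + t)) (t : FormsTensorDual κ F ⊗[ℂ] V) : P t := by
  induction t using TensorProduct.induction_on with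
  | zero => exact zero
  | add s t hs ht => exact add s t hs ht
  | tmul a v =>
    refine TensorProduct.induction_on (motive := fun a : FormsTensorDual κ F => P (a ⊗ₜ v)) a
      ?_ (fun h lam => tmul h lam v) fun (a b : FormsTensorDual κ F) ha hb => ?_
    · change P ((0 : FormsTensorDual κ F) ⊗ₜ v)
      rw [TensorProduct.zero_tmul]
      exact zero
    · change P ((a + b : FormsTensorDual κ F) ⊗ₜ v)
      rw [TensorProduct.add_tmul]
      exact add _ _ ha hb

/-- The coefficient of `ϑ_{F,x}` of an element of `M ⊗ W(F)^*`. -/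
def formsCoord (x : F.Disc) : FormsTensorDual κ F →ₗ[ℂ] modularForms (κ - n) :=
  (TensorProduct.rid ℂ (modularForms (κ - n))).toLinearMap ∘ₗ
    (Module.Dual.eval ℂ (F.Disc →₀ ℂ) (Finsupp.single x 1)).lTensor (modularForms (κ - n))

theorem formsCoord_tmul (x : F.Disc) (h : modularForms (κ - n))
    (lam : Module.Dual ℂ (F.Disc →₀ ℂ)) :
    formsCoord κ F x (FormsTensorDual.tmul κ F h lam) = lam (Finsupp.single x 1) • h :=
  TensorProduct.rid_tmul (R := ℂ) h (lam (Finsupp.single x 1))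

/-- The coefficient of `ϑ_{F,x}` in the theta expansion, paired with a linear functional on `V`. -/
def thetaCoord (x : F.Disc) (v : Module.Dual ℂ V) :
    FormsTensorDual κ F ⊗[ℂ] V →ₗ[ℂ] modularForms (κ - n) :=
  (TensorProduct.rid ℂ (modularForms (κ - n))).toLinearMap ∘ₗ
    TensorProduct.map (formsCoord κ F x) v

theorem thetaCoord_tmul (x : F.Disc) (v : Module.Dual ℂ V) (h : modularForms (κ - n))
    (lam : Module.Dual ℂ (F.Disc →₀ ℂ)) (u : V) :
    thetaCoord κ F x v (FormsTensorDual.tmul κ F h lam ⊗ₜ u) =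
      v u • lam (Finsupp.single x 1) • h := by
  rw [← formsCoord_tmul]
  exact TensorProduct.rid_tmul (R := ℂ) (formsCoord κ F x (FormsTensorDual.tmul κ F h lam)) (v u)

/-- A linear functional on a theta expansion gives a combination of theta series. -/
theorem apply_thetaExpansion (v : Module.Dual ℂ V) (t : FormsTensorDual κ F ⊗[ℂ] V) (τ : ℍ)
    (z : Fin n → ℂ) :
    v (thetaExpansion κ F V t τ z) = ∑ x, (thetaCoord κ F x v t).1 τ * theta F x τ z := by
  induction t using formsTensorDual_induction with
  | zero => simp
  | add s t hs ht =>
    rw [map_add, Pi.add_apply, Pi.add_apply, map_add, hs, ht, ← Finset.sum_add_distrib]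
    refine Finset.sum_congr rfl fun x _ => ?_
    rw [map_add, Submodule.coe_add, Pi.add_apply, add_mul]
  | tmul h lam u =>
    rw [thetaExpansion_tmul, map_smul, thetaMap_apply, smul_eq_mul, Finset.mul_sum, Finset.sum_mul]
    refine Finset.sum_congr rfl fun x _ => ?_
    rw [thetaCoord_tmul, Submodule.coe_smul, Submodule.coe_smul, Pi.smul_apply, Pi.smul_apply,
      smul_eq_mul, smul_eq_mul]
    ring

theorem thetaMap_lapply (x : F.Disc) : thetaMap F (Finsupp.lapply x) = theta F x := by
  ext τ z
  rw [thetaMap_apply, Finset.sum_eq_single x]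
  · simp
  · intro y _ hy
    simp [hy]
  · simp

/-- An element of `(M ⊗ W(F)^*) ⊗ V` is recovered from its coefficients. -/
theorem eq_sum_thetaCoord {ι : Type*} [Fintype ι] (b : Module.Basis ι ℂ V)
    (t : FormsTensorDual κ F ⊗[ℂ] V) :
    t = ∑ j, ∑ x, FormsTensorDual.tmul κ F (thetaCoord κ F x (b.coord j) t)
      (Finsupp.lapply x) ⊗ₜ b j := by
  induction t using formsTensorDual_induction with
  | zero => simp
  | add s t hs ht =>
    conv_lhs => rw [hs, ht]
    simp only [map_add, LinearMap.add_apply, TensorProduct.add_tmul, Finset.sum_add_distrib]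
  | tmul h lam u =>
    have h1 : lam = ∑ x, lam (Finsupp.single x 1) • (Finsupp.lapply x : (F.Disc →₀ ℂ) →ₗ[ℂ] ℂ) := by
      classical
      refine Finsupp.lhom_ext' fun y => LinearMap.ext_ring ?_
      simp [Finsupp.single_apply]
    simp only [thetaCoord_tmul, map_smul, LinearMap.smul_apply, ← TensorProduct.smul_tmul']
    have h2 : ∀ j, ∑ x, (b.coord j) u • lam (Finsupp.single x 1) •
        (FormsTensorDual.tmul κ F h (Finsupp.lapply x) ⊗ₜ[ℂ] b j) =
          FormsTensorDual.tmul κ F h lam ⊗ₜ[ℂ] ((b.coord j) u • b j) := fun j => by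
      conv_rhs => rw [h1]
      rw [map_sum, TensorProduct.sum_tmul]
      refine Finset.sum_congr rfl fun x _ => ?_
      rw [map_smul, TensorProduct.tmul_smul, TensorProduct.smul_tmul']
    rw [Finset.sum_congr rfl fun j _ => h2 j, ← TensorProduct.tmul_sum]
    congr 1
    exact (b.sum_repr u).symm

theorem thetaExpansion_injective [FiniteDimensional ℂ V] :
    Function.Injective (thetaExpansion κ F V) := by
  rw [← LinearMap.ker_eq_bot, LinearMap.ker_eq_bot']
  intro t ht
  have h1 : ∀ v x, thetaCoord κ F x v t = 0 := fun v x => by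
    refine Subtype.ext (funext fun τ => ?_)
    refine congrFun (theta_linearIndependent F (h := fun x => (thetaCoord κ F x v t).1 τ)
      (h' := fun _ => 0) τ fun z => ?_) x
    rw [← apply_thetaExpansion, ht]
    simp
  rw [eq_sum_thetaCoord κ F (Module.finBasis ℂ V) t]
  simp [h1]

theorem thetaExpansion_lTensor {W : Type*} [AddCommGroup W] [Module ℂ W] (f : V →ₗ[ℂ] W)
    (t : FormsTensorDual κ F ⊗[ℂ] V) (τ : ℍ) (z : Fin n → ℂ) :
    thetaExpansion κ F W (f.lTensor _ t) τ z = f (thetaExpansion κ F V t τ z) := by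
  induction t using formsTensorDual_induction with
  | zero => simp
  | add s t hs ht => simp [hs, ht]
  | tmul h lam u => rw [LinearMap.lTensor_tmul, thetaExpansion_tmul, thetaExpansion_tmul, map_smul]

theorem thetaExpansion_rTensor (g : Mp) (t : FormsTensorDual κ F ⊗[ℂ] V) :
    thetaExpansion κ F V ((formsTensorDual κ F (MulOpposite.op g)).rTensor V t) =
      jacobiSlash κ F g (thetaExpansion κ F V t) := by
  induction t using formsTensorDual_induction with
  | zero =>
    ext
    simp [jacobiSlash]
  | add s t hs ht => rw [map_add, map_add, hs, ht, map_add, jacobiSlash_add]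
  | tmul h lam u =>
    have h1 : thetaExpansion κ F V (FormsTensorDual.tmul κ F h lam ⊗ₜ u) =
        fun τ z => (h.1 τ * thetaMap F lam τ z) • u := by
      ext τ z
      rw [thetaExpansion_tmul]
    rw [h1, jacobiSlash_mul_smul, LinearMap.rTensor_tmul, formsTensorDual_tmul]
    ext τ z
    rw [thetaExpansion_tmul, ← thetaMap_rightDual]
    rfl

theorem hasFourierExpansion_thetaExpansion (t : FormsTensorDual κ F ⊗[ℂ] V) :
    HasFourierExpansion F (thetaExpansion κ F V t) := by
  induction t using formsTensorDual_induction with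
  | zero =>
    rw [map_zero]
    exact HasFourierExpansion.zero F
  | add s t hs ht =>
    rw [map_add]
    exact hs.add F ht
  | tmul h lam u =>
    have h1 : thetaExpansion κ F V (FormsTensorDual.tmul κ F h lam ⊗ₜ u) =
        fun τ z => (h.1 τ * thetaMap F lam τ z) • u := by
      ext τ z
      rw [thetaExpansion_tmul]
    rw [h1]
    exact hasFourierExpansion_mul_thetaMap F h.2 lam u

theorem isHolomorphic_thetaExpansion (t : FormsTensorDual κ F ⊗[ℂ] V) :
    IsHolomorphic (thetaExpansion κ F V t) := by
  intro v
  simp_rw [apply_thetaExpansion]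
  refine DifferentiableOn.fun_sum fun x _ => DifferentiableOn.mul ?_ (differentiableOn_theta F x)
  have h1 := UpperHalfPlane.mdifferentiable_iff.1 (thetaCoord κ F x v t).2.1
  exact h1.comp differentiable_fst.differentiableOn fun p hp => hp

theorem latticeSlash_thetaExpansion [FiniteDimensional ℂ V] (l m : Fin n → ℤ)
    (t : FormsTensorDual κ F ⊗[ℂ] V) :
    latticeSlash F l m (thetaExpansion κ F V t) = thetaExpansion κ F V t := by
  ext τ z
  rw [← sub_eq_zero, ← Module.forall_dual_apply_eq_zero_iff ℂ]
  intro v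
  rw [map_sub, sub_eq_zero, latticeSlash, map_smul, apply_thetaExpansion, apply_thetaExpansion,
    smul_eq_mul, Finset.mul_sum]
  refine Finset.sum_congr rfl fun x _ => ?_
  conv_rhs => rw [← latticeSlash_theta F x l m]
  rw [latticeSlash, smul_eq_mul]
  ring

variable {Γ : Subgroup Mp} (ρ : Representation ℂ Γ V)

theorem mem_invariants_iff (t : FormsTensorDual κ F ⊗[ℂ] V) :
    t ∈ (diagonalRep (formsTensorDual κ F) ρ).invariants ↔ ∀ γ : Γ,
      (formsTensorDual κ F (MulOpposite.op (γ : Mp))).rTensor V t = (ρ γ).lTensor _ t := by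
  refine forall_congr' fun γ => ?_
  have h1 : diagonalRep (formsTensorDual κ F) ρ γ t =
      (formsTensorDual κ F (MulOpposite.op (γ : Mp)⁻¹)).rTensor V ((ρ γ).lTensor _ t) := by
    rw [← LinearMap.comp_apply, LinearMap.rTensor_comp_lTensor]
    rfl
  have h2 : ∀ g s, (formsTensorDual κ F (MulOpposite.op g)).rTensor V
      ((formsTensorDual κ F (MulOpposite.op g⁻¹)).rTensor V s) = s := fun g s => by
    rw [← LinearMap.comp_apply, ← LinearMap.rTensor_comp, ← Module.End.mul_eq_comp, ← map_mul,
      ← MulOpposite.op_mul, inv_mul_cancel, MulOpposite.op_one, map_one, Module.End.one_eq_id,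
      LinearMap.rTensor_id, LinearMap.id_apply]
  constructor
  · intro h
    rw [h1] at h
    conv_lhs => rw [← h]
    rw [h2]
  · intro h
    rw [h1, ← h]
    have h3 := h2 (γ : Mp)⁻¹ t
    rwa [inv_inv] at h3

/-- A theta expansion is a Jacobi form on `Γ` if and only if its coefficients are invariant. -/
theorem thetaExpansion_mem_jacobiForms [FiniteDimensional ℂ V]
    (t : FormsTensorDual κ F ⊗[ℂ] V) : thetaExpansion κ F V t ∈ jacobiForms κ F Γ ρ ↔
      t ∈ (diagonalRep (formsTensorDual κ F) ρ).invariants := by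
  rw [mem_invariants_iff]
  constructor
  · rintro ⟨-, h, -, -⟩ γ
    refine thetaExpansion_injective κ F ?_
    ext τ z
    rw [thetaExpansion_rTensor, thetaExpansion_lTensor, h]
  · intro h
    refine ⟨isHolomorphic_thetaExpansion κ F t, fun γ τ z => ?_,
      fun l m => latticeSlash_thetaExpansion κ F l m t, fun g => ?_⟩
    · rw [← thetaExpansion_rTensor, h, thetaExpansion_lTensor]
    · rw [← thetaExpansion_rTensor]
      exact hasFourierExpansion_thetaExpansion κ F _

/-- Every Jacobi form has a theta expansion: its coordinates are scalar valued Jacobi forms on the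
kernel of `ρ`, which has finite index. -/
theorem exists_thetaExpansion_eq [FiniteDimensional ℂ V] [Γ.FiniteIndex]
    (hρ : (Set.range ρ).Finite) {φ : ℍ → (Fin n → ℂ) → V} (hφ : φ ∈ jacobiForms κ F Γ ρ) :
    ∃ t, thetaExpansion κ F V t = φ := by
  obtain ⟨-, hinv, hlat, hexp⟩ := hφ
  have : ρ.ker.FiniteIndex := finiteIndex_ker_of_finite_range ρ hρ
  have hΔ : (ρ.ker.map Γ.subtype).FiniteIndex := by
    refine ⟨?_⟩
    rw [Subgroup.index_map_subtype]
    exact mul_ne_zero Subgroup.FiniteIndex.index_ne_zero Subgroup.FiniteIndex.index_ne_zero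
  have hv : ∀ v : Module.Dual ℂ V, ∃ h : F.Disc → modularForms (κ - n),
      ∀ τ z, v (φ τ z) = ∑ x, (h x).1 τ * theta F x τ z := fun v => by
    refine exists_modularForms_theta_combination F κ (ψ := fun τ z => v (φ τ z)) (fun g => ?_)
      (fun l m => ?_) (Δ := ρ.ker.map Γ.subtype) ?_
    · have h1 : jacobiSlash κ F g (fun τ z => v (φ τ z)) =
          fun τ z => v (jacobiSlash κ F g φ τ z) := by
        ext τ z
        rw [map_jacobiSlash]
      rw [h1]
      exact (hexp g).map F v
    · ext τ z
      conv_rhs => rw [← hlat l m]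
      simp [latticeSlash]
    · rintro _ ⟨γ, hγ, rfl⟩
      ext τ z
      rw [← map_jacobiSlash]
      have h1 := hinv γ τ z
      rw [MonoidHom.mem_ker.1 hγ] at h1
      exact congrArg v h1
  let b := Module.finBasis ℂ V
  choose h hh using fun j => hv (b.coord j)
  refine ⟨∑ j, ∑ x, FormsTensorDual.tmul κ F (h j x) (Finsupp.lapply x) ⊗ₜ b j, ?_⟩
  ext τ z
  rw [← b.sum_repr (φ τ z)]
  simp only [map_sum, Finset.sum_apply, thetaExpansion_tmul, thetaMap_lapply, ← Finset.sum_smul]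
  exact Finset.sum_congr rfl fun j _ => by rw [← hh]; rfl

/-- The vectors of `(M ⊗ W(F)^*) ⊗ V` are fixed by subgroups of finite index: this uses the definition
of `M`, the finite image of the Weil representation, and the finite image of `ρ`. -/
theorem exists_finiteIndex_fixing [Γ.FiniteIndex] (hρ : (Set.range ρ).Finite)
    (t : FormsTensorDual κ F ⊗[ℂ] V) : ∃ Δ : Subgroup Γ, Δ.FiniteIndex ∧
      ∀ δ ∈ Δ, diagonalRep (formsTensorDual κ F) ρ δ t = t := by
  classical
  have : ρ.ker.FiniteIndex := finiteIndex_ker_of_finite_range ρ hρ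
  have : (thetaMatrix F).ker.FiniteIndex :=
    finiteIndex_ker_of_finite_range _ (finite_range_thetaMatrix F)
  induction t using formsTensorDual_induction with
  | zero => exact ⟨⊤, inferInstance, fun _ _ => map_zero _⟩
  | add s t hs ht =>
    obtain ⟨Δ₁, h₁, hs⟩ := hs
    obtain ⟨Δ₂, h₂, ht⟩ := ht
    exact ⟨Δ₁ ⊓ Δ₂, inferInstance, fun δ hδ => by rw [map_add, hs δ hδ.1, ht δ hδ.2]⟩
  | tmul h lam v =>
    obtain ⟨Δ, hΔ, hh⟩ := h.2.2.1
    refine ⟨(Δ ⊓ (thetaMatrix F).ker).subgroupOf Γ ⊓ ρ.ker, inferInstance, fun δ hδ => ?_⟩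
    obtain ⟨hδ1, hδ2⟩ : (δ : Mp)⁻¹ ∈ Δ ∧ (δ : Mp)⁻¹ ∈ (thetaMatrix F).ker :=
      ⟨inv_mem hδ.1.1, inv_mem hδ.1.2⟩
    have h1 : weilRep F (δ : Mp)⁻¹ = 1 := by
      refine Finsupp.lhom_ext' fun y => LinearMap.ext_ring ?_
      simp only [LinearMap.comp_apply, Finsupp.lsingle_apply]
      rw [weilRep_single, MonoidHom.mem_ker.1 hδ2]
      simp [Matrix.one_apply]
    have h2 : (⟨slash (κ - n) (δ : Mp)⁻¹ h.1, slash_mem_modularForms h.2 _⟩ :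
        modularForms (κ - n)) = h := Subtype.ext (hh _ hδ1)
    rw [diagonalRep_tmul, formsTensorDual_tmul, MonoidHom.mem_ker.1 hδ.2, h1, h2]
    rfl

/-- The theta expansion, as an isomorphism from the invariants of `(M ⊗ W(F)^*) ⊗ V` to Jacobi
forms. -/
def jacobiFormsEquiv [FiniteDimensional ℂ V] [Γ.FiniteIndex] (hρ : (Set.range ρ).Finite) :
    (diagonalRep (formsTensorDual κ F) ρ).invariants ≃ₗ[ℂ] jacobiForms κ F Γ ρ :=
  LinearEquiv.ofBijective
    (((thetaExpansion κ F V).domRestrict _).codRestrict (jacobiForms κ F Γ ρ) fun t =>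
      (thetaExpansion_mem_jacobiForms κ F ρ t.1).2 t.2) <| by
    refine ⟨fun s t hst => ?_, fun φ => ?_⟩
    · exact Subtype.ext (thetaExpansion_injective κ F (congrArg Subtype.val hst))
    · obtain ⟨t, ht⟩ := exists_thetaExpansion_eq κ F ρ hρ φ.2
      exact ⟨⟨t, (thetaExpansion_mem_jacobiForms κ F ρ t).1 (ht ▸ φ.2)⟩, Subtype.ext ht⟩

/-- The isomorphism from Jacobi forms to `(M ⊗ W(F)^*) ⊗_{ℂ[Mp₂(ℤ)]} Ind V` that sends the theta
expansion `∑ (h ⊗ λ) ⊗ v` to the class of `∑ (h ⊗ λ) ⊗ (1 ⊗ v)`. -/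
def jacobiFormsEquivThetaTensor [FiniteDimensional ℂ V] [Γ.FiniteIndex]
    (hρ : (Set.range ρ).Finite) : jacobiForms κ F Γ ρ ≃ₗ[ℂ] ThetaTensor κ F Γ ρ :=
  (jacobiFormsEquiv κ F ρ hρ).symm.trans <| LinearEquiv.ofBijective _ <|
    bijective_toBalanced_invariants (formsTensorDual κ F) ρ (exists_finiteIndex_fixing κ F ρ hρ)

theorem jacobiFormsEquivThetaTensor_apply [FiniteDimensional ℂ V] [Γ.FiniteIndex]
    (hρ : (Set.range ρ).Finite) (φ : jacobiForms κ F Γ ρ) {t : FormsTensorDual κ F ⊗[ℂ] V}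
    (ht : thetaExpansion κ F V t = φ.1) :
    jacobiFormsEquivThetaTensor κ F ρ hρ φ = toThetaTensor κ F Γ ρ t := by
  have h1 : (jacobiFormsEquiv κ F ρ hρ).symm φ =
      ⟨t, (thetaExpansion_mem_jacobiForms κ F ρ t).1 (ht ▸ φ.2)⟩ := by
    rw [LinearEquiv.symm_apply_eq]
    exact Subtype.ext ht.symm
  rw [jacobiFormsEquivThetaTensor, LinearEquiv.trans_apply, h1]
  rfl

theorem thetaTensor_map_toThetaTensor {W : Type*} [AddCommGroup W] [Module ℂ W]
    {ρ : Representation ℂ Γ V} {σ : Representation ℂ Γ W} (f : ρ.IntertwiningMap σ)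
    (t : FormsTensorDual κ F ⊗[ℂ] V) : ThetaTensor.map κ F f (toThetaTensor κ F Γ ρ t) =
      toThetaTensor κ F Γ σ (f.toLinearMap.lTensor _ t) := by
  induction t using TensorProduct.induction_on with
  | zero => simp
  | add s t hs ht => rw [map_add, map_add, hs, ht, map_add, map_add]
  | tmul a v => rfl

theorem lTensor_mem_invariants {W : Type*} [AddCommGroup W] [Module ℂ W]
    {ρ : Representation ℂ Γ V} {σ : Representation ℂ Γ W} (f : ρ.IntertwiningMap σ)
    {t : FormsTensorDual κ F ⊗[ℂ] V}
    (ht : t ∈ (diagonalRep (formsTensorDual κ F) ρ).invariants) :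
    f.toLinearMap.lTensor _ t ∈ (diagonalRep (formsTensorDual κ F) σ).invariants := fun γ => by
  have h : ∀ s, diagonalRep (formsTensorDual κ F) σ γ (f.toLinearMap.lTensor _ s) =
      f.toLinearMap.lTensor _ (diagonalRep (formsTensorDual κ F) ρ γ s) := fun s => by
    induction s using TensorProduct.induction_on with
    | zero => simp
    | add s t hs ht => rw [map_add, map_add, hs, ht, map_add, map_add]
    | tmul a v =>
      rw [LinearMap.lTensor_tmul, diagonalRep_tmul, diagonalRep_tmul, LinearMap.lTensor_tmul]
      congr 1
      exact (f.isIntertwining _ _ γ v).symm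
  rw [h, ht γ]

end ThetaExpansion

end JacobiTheta

end

theorem mainTheorem6 {n : ℕ} (F : JacobiTheta.HalfIntegralForm n) (κ : ℤ)
    (Γ : Subgroup JacobiTheta.Mp) [Γ.FiniteIndex] :
    -- the Weil representation exists and is unique
    (JacobiTheta.IsWeilRep F.discForm (JacobiTheta.weilRep F) ∧
      ∀ W, JacobiTheta.IsWeilRep F.discForm W → W = JacobiTheta.weilRep F) ∧
    -- the theta span is isomorphic to the dual of the Weil representation
    (Function.Injective (JacobiTheta.thetaMap F) ∧
      LinearMap.range (JacobiTheta.thetaMap F) = JacobiTheta.thetaSpan F ∧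
      ∀ (g : JacobiTheta.Mp) (v : Module.Dual ℂ (F.Disc →₀ ℂ)),
        JacobiTheta.thetaMap F
            (JacobiTheta.rightDual (JacobiTheta.weilRep F) (MulOpposite.op g) v) =
          JacobiTheta.jacobiSlash (n : ℤ) F g (JacobiTheta.thetaMap F v)) ∧
    -- the isomorphisms, one for each module `V`
    ∃ Ψ : ∀ (V : Type u) [AddCommGroup V] [Module ℂ V] [FiniteDimensional ℂ V]
        (ρ : Representation ℂ Γ V), (Set.range ρ).Finite →
        (JacobiTheta.jacobiForms κ F Γ ρ ≃ₗ[ℂ] JacobiTheta.ThetaTensor κ F Γ ρ),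
      -- every Jacobi form has a unique theta expansion, and its image is read off from it
      (∀ (V : Type u) [AddCommGroup V] [Module ℂ V] [FiniteDimensional ℂ V]
        (ρ : Representation ℂ Γ V) (hρ : (Set.range ρ).Finite)
        (φ : JacobiTheta.jacobiForms κ F Γ ρ),
        ∃! t, JacobiTheta.thetaExpansion κ F V t = φ.1) ∧
      (∀ (V : Type u) [AddCommGroup V] [Module ℂ V] [FiniteDimensional ℂ V]
        (ρ : Representation ℂ Γ V) (hρ : (Set.range ρ).Finite)
        (φ : JacobiTheta.jacobiForms κ F Γ ρ) t,
        JacobiTheta.thetaExpansion κ F V t = φ.1 →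
          Ψ V ρ hρ φ = JacobiTheta.toThetaTensor κ F Γ ρ t) ∧
      -- naturality in `V`
      (∀ (V V' : Type u) [AddCommGroup V] [Module ℂ V] [FiniteDimensional ℂ V]
        [AddCommGroup V'] [Module ℂ V'] [FiniteDimensional ℂ V']
        (ρ : Representation ℂ Γ V) (hρ : (Set.range ρ).Finite)
        (ρ' : Representation ℂ Γ V') (hρ' : (Set.range ρ').Finite)
        (f : ρ.IntertwiningMap ρ') (φ : JacobiTheta.jacobiForms κ F Γ ρ),
        ∃ φ' : JacobiTheta.jacobiForms κ F Γ ρ', (∀ τ z, φ'.1 τ z = f (φ.1 τ z)) ∧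
          Ψ V' ρ' hρ' φ' =
            JacobiTheta.ThetaTensor.map κ F f (Ψ V ρ hρ φ)) := by
  refine ⟨⟨JacobiTheta.isWeilRep_weilRep F,
      fun W hW => hW.unique (JacobiTheta.isWeilRep_weilRep F)⟩,
    ⟨JacobiTheta.thetaMap_injective F, JacobiTheta.range_thetaMap F,
      JacobiTheta.thetaMap_rightDual F⟩,
    fun V _ _ _ ρ hρ => JacobiTheta.jacobiFormsEquivThetaTensor κ F ρ hρ, ?_, ?_, ?_⟩
  · intro V _ _ _ ρ hρ φ
    obtain ⟨t, ht⟩ := JacobiTheta.exists_thetaExpansion_eq κ F ρ hρ φ.2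
    exact ⟨t, ht, fun s hs => JacobiTheta.thetaExpansion_injective κ F (hs.trans ht.symm)⟩
  · intro V _ _ _ ρ hρ φ t ht
    exact JacobiTheta.jacobiFormsEquivThetaTensor_apply κ F ρ hρ φ ht
  · intro V V' _ _ _ _ _ _ ρ hρ ρ' hρ' f φ
    obtain ⟨t, ht⟩ := JacobiTheta.exists_thetaExpansion_eq κ F ρ hρ φ.2
    have ht' := (JacobiTheta.thetaExpansion_mem_jacobiForms κ F ρ t).1 (ht ▸ φ.2)
    have hs := (JacobiTheta.thetaExpansion_mem_jacobiForms κ F ρ' _).2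
      (JacobiTheta.lTensor_mem_invariants κ F f ht')
    refine ⟨⟨_, hs⟩, fun τ z => ?_, ?_⟩
    · rw [← ht]
      exact JacobiTheta.thetaExpansion_lTensor κ F f.toLinearMap t τ z
    · rw [JacobiTheta.jacobiFormsEquivThetaTensor_apply κ F ρ' hρ' ⟨_, hs⟩ rfl,
        JacobiTheta.jacobiFormsEquivThetaTensor_apply κ F ρ hρ φ ht,
        JacobiTheta.thetaTensor_map_toThetaTensor]
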